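/- **Setting.** Let $S$ be a quantum system with Hilbert space $\mathbb C^d$, let $A_S$ be a Hermitian operator on $S$ with smallest eigenvalue $0$ (the conserved quantity), and let $B_S$ be a Hermitian operator on $S$ (the quantity to be measured). $\|\cdot\|$ is the operator norm. An *implementation* $\mathcal I=(\mathcal H_E,A_E,M_E,\rho_E,U)$ consists of a complex Hilbert space $\mathcal H_E$ of any dimension, self-adjoint, possibly unbounded operators $A_E$ and $M_E$ on $\mathcal H_E$ that commute strongly, a density operator $\rho_E$ on $\mathcal H_E$, and a unitary $U$ on $\mathbb C^d\otimes\mathcal H_E$ with $[U,\,A_S\otimes1+1\otimes A_E]=0$ (that is, $U$ maps the domain of $A_S\otimes 1+1\otimes A_E$ into itself and commutes with this operator there). With $N=B_S\otimes1-U^\dagger(1\otimes M_E)U$, the error in the state $\rho_S$ is $\epsilon_{\mathcal I}(\rho_S)=\sqrt{\mathrm{Tr}[(\rho_S\otimes\rho_E)N^2]}\in[0,\infty]$, which is $\infty$ if some eigenvector of $\rho_S\otimes\rho_E$ with positive eigenvalue is not in the domain of $N$. The worst-case error is $\epsilon_{\mathcal I}=\sup_{\rho_S}\epsilon_{\mathcal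 I}(\rho_S)$ over all density operators $\rho_S$ on $S$. A *standard monotone* is a function $f$ on $[0,\infty)$ that is operator monotone ($0\le X\le Y$ implies $f(X)\le f(Y)$), satisfies $f(x)=xf(1/x)$ for $x>0$ and $f(1)=1$, and has $f(0)=\lim_{x\downarrow0}f(x)$. For a density operator $\rho$ with orthonormal eigenbasis $|i\rangle$ and eigenvalues $p_i$, the *$f$-skew information* of a self-adjoint operator $A$ is $$I^f_\rho(A)=\frac{f(0)}2\sum_{i,j}\frac{(p_i-p_j)^2}{p_jf(p_i/p_j)}\,|\langle i|A|j\rangle|^2\in[0,\infty],$$ where for $p_ip_j=0$ the coefficient of $|\langle i|A|j\rangle|^2$, including the prefactor $f(0)/2$, is read as $(p_i+p_j)/2$ (its continuous extension when $f(0)>0$), and $I^f_\rho(A)=\infty$ if some eigenvector with $p_i>0$ is not in the domain of $A$. For $\epsilon>0$ let $$I^f_{\epsilon,\mathrm{cost}}=\inf\{\,I^f_{\rho_E}(A_E)\;:\;\mathcal I\text{ an implementation with }\epsilon_{\mathcal I}\le\epsilon\,\}.$$ **Theorem.** 1. For every standard monotone $f$ and every $\epsilon>0$, $I^f_{\epsilon,\mathrm{cost}}$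 is finite and $$\sqrt{\tfrac{f(0)}2}\,\frac{\|[A_S,B_S]\|}{\epsilon}-\frac{\|A_S\|}2\le\sqrt{I^f_{\epsilon,\mathrm{cost}}}.$$ If moreover $0<\epsilon\le\frac{\|[A_S,B_S]\|}{8\|A_S\|}$ (where $A_S\neq0$), then $$\sqrt{I^f_{\epsilon,\mathrm{cost}}}\le\frac{\|[A_S,B_S]\|}{2\epsilon}+\|A_S\|.$$ 2. For every standard monotone $f$ with $f(0)=1/2$, as $\epsilon\to0^+$, $$\sqrt{I^f_{\epsilon,\mathrm{cost}}}=\frac{\|[A_S,B_S]\|}{2\epsilon}+O(\|A_S\|),$$ with an absolute constant: for all sufficiently small $\epsilon>0$ the difference is at most $\|A_S\|$ in absolute value. 3. For every $\xi>0$ there is an implementation $\mathcal I$ with $I^f_{\rho_E}(A_E)=\xi^2$ for all standard monotones $f$ simultaneously, and $$\epsilon_{\mathcal I}^2\le\frac{\|[A_S,B_S]\|^2}{4\xi^2}\Bigl(1+\frac{\|A_S\|^2}{\xi^2}\Bigr)e^{\|A_S\|^2/(2\xi^2)}.$$ -/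

import Mathlib

open Filter Topology Matrix
open scoped ENNReal InnerProductSpace ComplexOrder

namespace WAY

/-! ### Density operators and their spectral resolutions -/

/-- A density operator: a positive operator with trace one (the trace of a positive operator may be
computed in any one Hilbert basis). -/
structure DensityOperator (H : Type) [NormedAddCommGroup H] [InnerProductSpace ℂ H] where
  op : H →L[ℂ] H
  isPositive : op.IsPositive
  trace_one : ∃ (ι : Type) (b : HilbertBasis ι ℂ H), HasSum (fun i => ⟪b i, op (b i)⟫_ℂ) 1

theorem hasSum_normSq_inner {H : Type} [NormedAddCommGroup H] [InnerProductSpace ℂ H]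
    {ι : Type*} (b : HilbertBasis ι ℂ H) (x : H) :
    HasSum (fun i => ‖⟪b i, x⟫_ℂ‖ ^ 2) (‖x‖ ^ 2) := by
  have h := (Complex.hasSum_iff _ _).1 (b.hasSum_inner_mul_inner x x)
  have h1 := h.1
  have e : ∀ i, (⟪x, b i⟫_ℂ * ⟪b i, x⟫_ℂ).re = ‖⟪b i, x⟫_ℂ‖ ^ 2 := by
    intro i
    rw [← inner_conj_symm x (b i), ← Complex.normSq_eq_conj_mul_self, Complex.normSq_eq_norm_sq]
    exact Complex.ofReal_re _
  simp only [e] at h1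
  have h2 : (⟪x, x⟫_ℂ).re = ‖x‖ ^ 2 := by
    rw [inner_self_eq_norm_sq_to_K]; norm_cast
  rwa [h2] at h1

theorem tsum_ofReal_normSq_inner {H : Type} [NormedAddCommGroup H] [InnerProductSpace ℂ H]
    {ι : Type*} (b : HilbertBasis ι ℂ H) (x : H) :
    ∑' i, ENNReal.ofReal (‖⟪b i, x⟫_ℂ‖ ^ 2) = ENNReal.ofReal (‖x‖ ^ 2) := by
  rw [← (hasSum_normSq_inner b x).tsum_eq]
  exact (ENNReal.ofReal_tsum_of_nonneg (fun i => by positivity) (hasSum_normSq_inner b x).summable).symm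

theorem isCompactOperator_of_summable_normSq
    {H : Type} [NormedAddCommGroup H] [InnerProductSpace ℂ H] [CompleteSpace H]
    {ι : Type*} (b : HilbertBasis ι ℂ H) (S : H →L[ℂ] H)
    (hS : ∀ x y, ⟪S x, y⟫_ℂ = ⟪x, S y⟫_ℂ) (hsum : Summable fun i => ‖S (b i)‖ ^ 2) :
    IsCompactOperator S := by
  classical
  let T : Finset ι → H →L[ℂ] H := fun F => ∑ i ∈ F, InnerProductSpace.rankOne ℂ (b i) (S (b i))
  have hT : ∀ F z i, ⟪b i, S z - T F z⟫_ℂ = if i ∈ F then 0 else ⟪S (b i), z⟫_ℂ := by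
    intro F z i
    have h1 : ⟪b i, T F z⟫_ℂ = if i ∈ F then ⟪S (b i), z⟫_ℂ else 0 := by
      simp only [T, _root_.sum_apply, inner_sum, InnerProductSpace.rankOne_apply,
        inner_smul_right, orthonormal_iff_ite.1 b.orthonormal, mul_ite, mul_one, mul_zero,
        Finset.sum_ite_eq]
    rw [inner_sub_right, h1, ← hS]
    split_ifs <;> simp
  have hb : ∀ F z, ‖S z - T F z‖ ^ 2 ≤ (∑' i : {i // i ∉ F}, ‖S (b i)‖ ^ 2) * ‖z‖ ^ 2 := by
    intro F z
    have h1 := hasSum_normSq_inner b (S z - T F z)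
    have h2 : Summable (fun i : {i // i ∉ F} => ‖S (b i)‖ ^ 2 * ‖z‖ ^ 2) :=
      (hsum.subtype _).mul_right _
    have h3 : Function.support (fun i => ‖⟪b i, S z - T F z⟫_ℂ‖ ^ 2) ⊆ {i | i ∉ F} := by
      intro i hi hF
      simp [hT, hF] at hi
    rw [← h1.tsum_eq, ← tsum_subtype_eq_of_support_subset h3, ← tsum_mul_right]
    refine Summable.tsum_le_tsum ?_ (h1.summable.subtype _) h2
    rintro ⟨i, hi⟩
    have : i ∉ F := hi
    simp only [hT, this, if_false]
    rw [← mul_pow]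
    exact pow_le_pow_left₀ (norm_nonneg _) (norm_inner_le_norm _ _) 2
  have hlim : Filter.Tendsto T Filter.atTop (nhds S) := by
    rw [tendsto_iff_norm_sub_tendsto_zero]
    have h0 := (tendsto_tsum_compl_atTop_zero (fun i => ‖S (b i)‖ ^ 2)).sqrt
    rw [Real.sqrt_zero] at h0
    refine squeeze_zero (fun _ => norm_nonneg _) (fun F => ?_) h0
    refine ContinuousLinearMap.opNorm_le_bound _ (Real.sqrt_nonneg _) fun z => ?_
    have := Real.sqrt_le_sqrt (hb F z)
    rw [Real.sqrt_sq (norm_nonneg _), Real.sqrt_mul (tsum_nonneg fun _ => by positivity),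
      Real.sqrt_sq (norm_nonneg _)] at this
    rw [norm_sub_rev] at this
    simpa using this
  refine isCompactOperator_of_tendsto hlim (Filter.Eventually.of_forall fun F => ?_)
  have hr : ∀ x y : H, IsCompactOperator (InnerProductSpace.rankOne ℂ x y) := by
    intro x y
    have := (isCompactOperator_of_locallyCompactSpace_dom (innerSL ℂ y)).clm_comp
      (ContinuousLinearMap.toSpanSingleton ℂ x)
    have hxy : ⇑(InnerProductSpace.rankOne ℂ x y) =
        ⇑(ContinuousLinearMap.toSpanSingleton ℂ x) ∘ ⇑(innerSL ℂ y) := by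
      funext z
      simp
    rw [hxy]
    exact this
  have : T F ∈ compactOperator (RingHom.id ℂ) H H :=
    Submodule.sum_mem _ fun i _ => hr _ _
  exact this

/-- Spectral theorem: a density operator is diagonal in some Hilbert basis, and its eigenvalues are
a probability distribution. -/
theorem DensityOperator.exists_eigenbasis
    {H : Type} [NormedAddCommGroup H] [InnerProductSpace ℂ H] [CompleteSpace H]
    (ρ : DensityOperator H) :
    ∃ (ι : Type) (b : HilbertBasis ι ℂ H) (p : ι → ℝ),
      (∀ i, 0 ≤ p i) ∧ HasSum p 1 ∧ ∀ i, ρ.op (b i) = (p i : ℂ) • b i := by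
  classical
  obtain ⟨κ, c, hc⟩ := ρ.trace_one
  have hpos : (0 : H →L[ℂ] H) ≤ ρ.op := (ContinuousLinearMap.nonneg_iff_isPositive _).2 ρ.isPositive
  set S := CFC.sqrt ρ.op with hSdef
  have hSS : S * S = ρ.op := CFC.sqrt_mul_sqrt_self _ hpos
  have hSsym : ∀ x y, ⟪S x, y⟫_ℂ = ⟪x, S y⟫_ℂ :=
    ((ContinuousLinearMap.nonneg_iff_isPositive S).1 (CFC.sqrt_nonneg _)).inner_left_eq_inner_right
  have hρS : ∀ x, ⟪x, ρ.op x⟫_ℂ = ((‖S x‖ ^ 2 : ℝ) : ℂ) := by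
    intro x
    rw [← hSS, mul_apply_eq_comp, ← hSsym, inner_self_eq_norm_sq_to_K]
    norm_cast
  simp only [hρS] at hc
  have hc' : HasSum (fun i => ‖S (c i)‖ ^ 2) 1 := by
    rw [← Complex.ofReal_one] at hc
    exact Complex.hasSum_ofReal.1 hc
  have hScomp := isCompactOperator_of_summable_normSq c S hSsym hc'.summable
  have hcomp : IsCompactOperator ρ.op := by
    rw [← hSS]
    exact hScomp.comp_clm S
  have hsymm : (ρ.op : H →ₗ[ℂ] H).IsSymmetric := ρ.isPositive.isSymmetric
  let V : ℂ → Submodule ℂ H := fun μ => Module.End.eigenspace (ρ.op : H →ₗ[ℂ] H) μ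
  have hVc : ∀ μ, IsClosed (V μ : Set H) := by
    intro μ
    have : (V μ : Set H) = {x | ρ.op x = μ • x} := by
      ext x; simp [V]
    rw [this]
    exact isClosed_eq ρ.op.continuous (continuous_const_smul μ)
  have : ∀ μ, CompleteSpace (V μ) := fun μ => (hVc μ).completeSpace_coe
  choose w e he using fun μ => exists_hilbertBasis ℂ (V μ)
  let v : (Σ μ, w μ) → H := fun a => (e a.1 a.2 : H)
  have hv : Orthonormal ℂ v :=
    hsymm.orthogonalFamily_eigenspaces.orthonormal_sigma_orthonormal (fun μ => (e μ).orthonormal)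
  have hbot : (Submodule.span ℂ (Set.range v))ᗮ = ⊥ := by
    rw [eq_bot_iff, ← ContinuousLinearMap.orthogonalComplement_iSup_eigenspaces_eq_bot hcomp hsymm,
      ← Submodule.iInf_orthogonal]
    refine le_iInf fun μ x hx => ?_
    rw [Submodule.mem_orthogonal']
    intro y hy
    have hs := (e μ).hasSum_repr ⟨y, hy⟩
    have hs2 := (hs.mapL (V μ).subtypeL).mapL (innerSL ℂ x)
    have hz : ∀ i, ⟪x, v ⟨μ, i⟩⟫_ℂ = 0 := fun i => by
      rw [Submodule.mem_orthogonal'] at hx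
      exact hx _ (Submodule.subset_span ⟨_, rfl⟩)
    have h0 : ∀ i, innerSL ℂ x ((V μ).subtypeL ((e μ).repr ⟨y, hy⟩ i • e μ i)) = 0 := fun i => by
      rw [map_smul, map_smul]
      exact smul_eq_zero_of_right _ (hz i)
    simp only [h0] at hs2
    exact hs2.unique hasSum_zero
  let b := HilbertBasis.mkOfOrthogonalEqBot hv hbot
  have hbv : ∀ a, b a = v a := fun a => congrFun (HilbertBasis.coe_mkOfOrthogonalEqBot hv hbot) a
  have hev : ∀ a, ρ.op (b a) = a.1 • b a := by
    intro a
    rw [hbv]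
    exact Module.End.mem_eigenspace_iff.1 (e a.1 a.2).2
  refine ⟨_, b, fun a => ‖S (b a)‖ ^ 2, fun a => by positivity, ?_, fun a => ?_⟩
  · have key : ∑' a, ENNReal.ofReal (‖S (b a)‖ ^ 2) = 1 := by
      simp_rw [← tsum_ofReal_normSq_inner c (S _)]
      rw [ENNReal.tsum_comm]
      have : ∀ i a, ‖⟪c i, S (b a)⟫_ℂ‖ = ‖⟪b a, S (c i)⟫_ℂ‖ := by
        intro i a
        rw [← hSsym, norm_inner_symm]
      simp_rw [this, tsum_ofReal_normSq_inner b (S _)]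
      rw [← ENNReal.ofReal_tsum_of_nonneg (fun i => by positivity) hc'.summable, hc'.tsum_eq,
        ENNReal.ofReal_one]
    have hsum : Summable fun a => ‖S (b a)‖ ^ 2 := by
      have := ENNReal.summable_toReal (f := fun a => ENNReal.ofReal (‖S (b a)‖ ^ 2))
        (by rw [key]; simp)
      simpa [ENNReal.toReal_ofReal] using this
    rw [hsum.hasSum_iff]
    rw [← ENNReal.ofReal_tsum_of_nonneg (fun i => by positivity) hsum] at key
    simpa using key
  · have h1 := hρS (b a)
    rw [hev, inner_smul_right, inner_self_eq_norm_sq_to_K, b.orthonormal.1 a] at h1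
    simp only [RCLike.ofReal_one, one_pow, mul_one] at h1
    rw [hev]
    exact congrArg (· • b a) h1

noncomputable section

section Eigen

variable {H : Type} [NormedAddCommGroup H] [InnerProductSpace ℂ H] [CompleteSpace H]

/-- Index set of the eigenbasis of `ρ` (zero eigenvalues included). -/
def DensityOperator.Idx (ρ : DensityOperator H) : Type :=
  ρ.exists_eigenbasis.choose

/-- An orthonormal eigenbasis `|i⟩` of `ρ`.  Nothing defined below depends on which one is taken. -/
def DensityOperator.eigenbasis (ρ : DensityOperator H) : HilbertBasis ρ.Idx ℂ H :=
  ρ.exists_eigenbasis.choose_spec.choose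

/-- The eigenvalues `p i` of `ρ`. -/
def DensityOperator.eigenvalue (ρ : DensityOperator H) : ρ.Idx → ℝ :=
  ρ.exists_eigenbasis.choose_spec.choose_spec.choose

theorem DensityOperator.eigen_spec (ρ : DensityOperator H) :
    (∀ i, 0 ≤ ρ.eigenvalue i) ∧ HasSum ρ.eigenvalue 1 ∧
      ∀ i, ρ.op (ρ.eigenbasis i) = (ρ.eigenvalue i : ℂ) • ρ.eigenbasis i :=
  ρ.exists_eigenbasis.choose_spec.choose_spec.choose_spec

end Eigen

/-! ### Metric adjusted skew information -/

/-- Standard operator monotone functions on `[0, ∞)`.  The value `f 0` is the limit of `f` at `0`;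
values at negative arguments are irrelevant. -/
structure IsStandardMonotone (f : ℝ → ℝ) : Prop where
  monotone : ∀ (n : ℕ) (X Y : Matrix (Fin n) (Fin n) ℂ), X.PosSemidef → (Y - X).PosSemidef →
    (cfc f Y - cfc f X).PosSemidef
  symm : ∀ x : ℝ, 0 < x → f x = x * f (1 / x)
  map_one : f 1 = 1
  tendsto_zero : Tendsto f (𝓝[>] 0) (𝓝 (f 0))

/-- The coefficient `(f 0 / 2) * (p - q) ^ 2 / (q * f (p / q))`.  If `p` or `q` vanishes it is
`(p + q) / 2`, which is the continuous extension when `0 < f 0` (there `q * f (p / q)` has the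
limit `p * f 0` as `q` tends to `0`). -/
def skewWeight (f : ℝ → ℝ) (p q : ℝ) : ℝ :=
  if p = 0 ∨ q = 0 then (p + q) / 2 else f 0 / 2 * ((p - q) ^ 2 / (q * f (p / q)))

open Classical in
/-- Matrix element `⟨x|A|y⟩` of a symmetric operator, one of `x`, `y` being in its domain. -/
def matrixElement {H : Type} [NormedAddCommGroup H] [InnerProductSpace ℂ H]
    (A : H →ₗ.[ℂ] H) (x y : H) : ℂ :=
  if hx : x ∈ A.domain then ⟪A ⟨x, hx⟩, y⟫_ℂ
  else if hy : y ∈ A.domain then ⟪x, A ⟨y, hy⟩⟫_ℂ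
  else 0

open Classical in
/-- The `f`-skew information of the (possibly unbounded) self-adjoint operator `A` in the state `ρ`,
with values in `[0, ∞]`.  It is infinite if some eigenvector of `ρ` with positive eigenvalue is not
in the domain of `A`; otherwise at least one vector of each pair with nonzero coefficient is. -/
def skewInfo {H : Type} [NormedAddCommGroup H] [InnerProductSpace ℂ H] [CompleteSpace H]
    (f : ℝ → ℝ) (ρ : DensityOperator H) (A : H →ₗ.[ℂ] H) : ℝ≥0∞ :=
  if ∀ i, 0 < ρ.eigenvalue i → ρ.eigenbasis i ∈ A.domain then
    ∑' i, ∑' j, ENNReal.ofReal (skewWeight f (ρ.eigenvalue i) (ρ.eigenvalue j) *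
      ‖matrixElement A (ρ.eigenbasis i) (ρ.eigenbasis j)‖ ^ 2)
  else ⊤

/-! ### Operators on the composite system

The target system is `S = ℂ^d`.  For a Hilbert space `E`, the composite Hilbert space `S ⊗ E` is the
orthogonal sum of `d` copies of `E`. -/

/-- The Hilbert space `ℂ^d ⊗ E`. -/
abbrev Composite (d : ℕ) (E : Type) [NormedAddCommGroup E] : Type :=
  PiLp 2 (fun _ : Fin d => E)

section Composite

variable {d : ℕ} {E : Type} [NormedAddCommGroup E] [InnerProductSpace ℂ E]

/-- The product vector `s ⊗ e`. -/
def tmul (s : EuclideanSpace ℂ (Fin d)) (e : E) : Composite d E :=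
  WithLp.toLp 2 fun a => s a • e

/-- The operator `T ⊗ 1` for a matrix `T` on `S`. -/
def leftOp (T : Matrix (Fin d) (Fin d) ℂ) : Composite d E →ₗ[ℂ] Composite d E where
  toFun x := WithLp.toLp 2 fun a => ∑ b, T a b • x b
  map_add' x y := by ext a; simp [smul_add, Finset.sum_add_distrib]
  map_smul' c x := by ext a; simp [Finset.smul_sum, smul_comm c]

/-- The operator `1 ⊗ M` for a partially defined operator `M` on `E`. -/
def rightOp (M : E →ₗ.[ℂ] E) : Composite d E →ₗ.[ℂ] Composite d E where
  domain :=
    { carrier := {x | ∀ a, x a ∈ M.domain}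
      add_mem' := fun hx hy a => M.domain.add_mem (hx a) (hy a)
      zero_mem' := fun _ => M.domain.zero_mem
      smul_mem' := fun c _ hx a => M.domain.smul_mem c (hx a) }
  toFun :=
    { toFun := fun x => WithLp.toLp 2 fun a => M ⟨x.1 a, x.2 a⟩
      map_add' := fun x y => by ext a; exact M.map_add ⟨x.1 a, x.2 a⟩ ⟨y.1 a, y.2 a⟩
      map_smul' := fun c x => by ext a; exact M.map_smul c ⟨x.1 a, x.2 a⟩ }

/-- The total quantity `A ⊗ 1 + 1 ⊗ AE`. -/
def totalOp (A : Matrix (Fin d) (Fin d) ℂ) (AE : E →ₗ.[ℂ] E) : Composite d E →ₗ.[ℂ] Composite d E where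
  domain := (rightOp (d := d) AE).domain
  toFun := (leftOp A).comp (rightOp (d := d) AE).domain.subtype + (rightOp (d := d) AE).toFun

/-- The noise operator `B ⊗ 1 - U† (1 ⊗ M) U` with its natural domain. -/
def noiseOp (B : Matrix (Fin d) (Fin d) ℂ) (M : E →ₗ.[ℂ] E)
    (U : Composite d E ≃ₗᵢ[ℂ] Composite d E) : Composite d E →ₗ.[ℂ] Composite d E where
  domain := (rightOp (d := d) M).domain.comap (U.toLinearEquiv : Composite d E →ₗ[ℂ] Composite d E)
  toFun :=
    { toFun := fun x => leftOp B x.1 - U.symm (rightOp (d := d) M ⟨U x.1, x.2⟩)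
      map_add' := fun x y => by
        have h : (⟨U (x + y).1, (x + y).2⟩ : (rightOp (d := d) M).domain) =
            ⟨U x.1, x.2⟩ + ⟨U y.1, y.2⟩ := Subtype.ext (by simp)
        rw [h, LinearPMap.map_add, map_add, Submodule.coe_add, map_add]
        abel
      map_smul' := fun c x => by
        have h : (⟨U (c • x).1, (c • x).2⟩ : (rightOp (d := d) M).domain) =
            c • ⟨U x.1, x.2⟩ := Subtype.ext (by simp)
        rw [h, LinearPMap.map_smul, map_smul, Submodule.coe_smul, map_smul, RingHom.id_apply,
          smul_sub] }

end Composite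

/-! ### Commutation with unbounded operators -/

section Commute

variable {H : Type} [NormedAddCommGroup H] [InnerProductSpace ℂ H]

/-- `[T, A] = 0` for an everywhere defined `T`: `T` preserves the domain of `A`, and `A T = T A`
there. -/
def CommutesWith (T : H →ₗ[ℂ] H) (A : H →ₗ.[ℂ] H) : Prop :=
  ∀ x : A.domain, ∃ h : T x ∈ A.domain, A ⟨T x, h⟩ = T (A x)

/-- `R = (M - z)⁻¹`. -/
def IsResolvent (M : H →ₗ.[ℂ] H) (z : ℂ) (R : H →L[ℂ] H) : Prop :=
  (∀ y, ∃ h : R y ∈ M.domain, M ⟨R y, h⟩ - z • R y = y) ∧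
    ∀ x : M.domain, R (M x - z • (x : H)) = x

/-- `[M, A] = 0` for self-adjoint operators, in the usual (strong) sense: the resolvents of `M`
commute with `A`. -/
def StronglyCommute (M A : H →ₗ.[ℂ] H) : Prop :=
  ∀ z : ℂ, z.im ≠ 0 → ∀ R : H →L[ℂ] H, IsResolvent M z R → CommutesWith (R : H →ₗ[ℂ] H) A

end Commute

/-! ### Implementations of a measurement and their cost -/

/-- An implementation set `(E, AE, ME, ρE, U)` for a target system `S = ℂ^d` with conserved
quantity `A`. -/
structure Implementation {d : ℕ} (A : Matrix (Fin d) (Fin d) ℂ) (E : Type)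
    [NormedAddCommGroup E] [InnerProductSpace ℂ E] [CompleteSpace E] where
  AE : E →ₗ.[ℂ] E
  AE_selfAdjoint : IsSelfAdjoint AE
  ME : E →ₗ.[ℂ] E
  ME_selfAdjoint : IsSelfAdjoint ME
  ME_commute : StronglyCommute ME AE
  ρE : DensityOperator E
  U : Composite d E ≃ₗᵢ[ℂ] Composite d E
  conservation : CommutesWith (U.toLinearEquiv : Composite d E →ₗ[ℂ] Composite d E) (totalOp A AE)

section Cost

variable {d : ℕ} {A : Matrix (Fin d) (Fin d) ℂ}

open Classical in
/-- The squared error `Tr[(ρS ⊗ ρE) N²]`, that is the sum of `q a * p i * ‖N (s a ⊗ e i)‖ ^ 2` over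
the product eigenbasis; it is infinite if a product eigenvector with positive weight is not in the
domain of the noise operator `N`. -/
def Implementation.sqError {E : Type} [NormedAddCommGroup E] [InnerProductSpace ℂ E]
    [CompleteSpace E] (𝓘 : Implementation A E) (B : Matrix (Fin d) (Fin d) ℂ)
    (ρS : DensityOperator (EuclideanSpace ℂ (Fin d))) : ℝ≥0∞ :=
  ∑' a, ∑' i, ENNReal.ofReal (ρS.eigenvalue a * 𝓘.ρE.eigenvalue i) *
    (if h : tmul (ρS.eigenbasis a) (𝓘.ρE.eigenbasis i) ∈ (noiseOp B 𝓘.ME 𝓘.U).domain then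
      ENNReal.ofReal (‖noiseOp B 𝓘.ME 𝓘.U ⟨_, h⟩‖ ^ 2)
    else ⊤)

/-- The error of the implementation, worst case over the initial states of `S`. -/
def Implementation.worstError {E : Type} [NormedAddCommGroup E] [InnerProductSpace ℂ E]
    [CompleteSpace E] (𝓘 : Implementation A E) (B : Matrix (Fin d) (Fin d) ℂ) : ℝ≥0∞ :=
  ⨆ ρS : DensityOperator (EuclideanSpace ℂ (Fin d)), 𝓘.sqError B ρS ^ (1 / 2 : ℝ)

/-- The least `f`-skew information of `AE` in `ρE` over all implementations whose worst-case error
is at most `ε`. -/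
def cost (f : ℝ → ℝ) (A B : Matrix (Fin d) (Fin d) ℂ) (ε : ℝ) : ℝ≥0∞ :=
  ⨅ (E : Type) (_ : NormedAddCommGroup E) (_ : InnerProductSpace ℂ E) (_ : CompleteSpace E)
    (𝓘 : Implementation A E) (_ : 𝓘.worstError B ≤ ENNReal.ofReal ε), skewInfo f 𝓘.ρE 𝓘.AE

end Cost

/-- The operator norm of a matrix acting on `ℂ^d` with its Euclidean norm. -/
def opNorm {d : ℕ} (T : Matrix (Fin d) (Fin d) ℂ) : ℝ :=
  ‖Matrix.toEuclideanCLM (𝕜 := ℂ) T‖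

end

end WAY

/-! Lower bound. Write N for the noise and L = A ⊗ 1 + 1 ⊗ A_E. Both U and 1 ⊗ M_E commute with L,
so U†(1 ⊗ M_E)U drops out of the commutator and [N, L] = [B, A] ⊗ 1 as a form
(`inner_noiseOp_totalOp`). Its expectation in s ⊗ e_i, with e_i the eigenvectors of ρ_E, does not
depend on i, and averaging it with the eigenvalues p_i gives an uncertainty relation
(`norm_inner_commutator_le`). In L the A part costs the variance of A in s, at most ‖A‖²/4. The A_E
part is a double sum of p_i Im(N_ij A_ji); hermiticity turns p_i into (p_i - p_j)/2, and
Cauchy–Schwarz splits it into the error and S = ∑ (p_i - p_j)² / (2(p_i + p_j)) |A_ij|². Hence ‖[A,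
B]‖ ≤ 2ε √(‖A‖²/4 + S). Operator monotonicity and the symmetry of f give f(x) ≤ (1 + x)/2
(`IsStandardMonotone.le_arith`), whence 2 f(0) S ≤ I^f.

Upper bound. The environment is a meter ℂ^d with M_E = B and a pointer L²(ℝ) with A_E the position
Q. Let W translate the pointer by the value of A in the system, W = exp(-iA ⊗ P) with P the
momentum. It carries A ⊗ 1 + 1 ⊗ Q to 1 ⊗ Q, which the swap of system and meter preserves, so U = W†
· swap · W conserves the total. Since W commutes with B on the meter, N = B ⊗ 1 - W†(B ⊗ 1)W, where
B acts on the system. For a Gaussian pointer of position variance ξ² the momentum has variance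
1/(4ξ²), and ‖N(s ⊗ ·)‖² is the average of ‖[exp(ixA), B]s‖² ≤ x² ‖[A, B]‖² over it, so the error is
at most ‖[A, B]‖/(2ξ) (`norm_sq_noiseOp_device_le`). The state is pure with mean position 0, so its
f-skew information is its variance ξ² for every f (`skewInfo_pureState`). -/

namespace WAY

/-! ### Unbounded self-adjoint operators, their resolvents and strong commutation. -/

section SelfAdjoint

variable {H : Type} [NormedAddCommGroup H] [InnerProductSpace ℂ H] [CompleteSpace H]

theorem inner_apply_eq_of_isSelfAdjoint {M : H →ₗ.[ℂ] H} (hM : IsSelfAdjoint M)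
    (x y : M.domain) : ⟪M x, (y : H)⟫_ℂ = ⟪(x : H), M y⟫_ℂ := by
  have h := LinearPMap.adjoint_isFormalAdjoint hM.dense_domain
  rw [(LinearPMap.isSelfAdjoint_def).1 hM] at h
  exact (h x y)

theorem mem_domain_of_isSelfAdjoint {M : H →ₗ.[ℂ] H} (hM : IsSelfAdjoint M) {y w : H}
    (h : ∀ x : M.domain, ⟪w, (x : H)⟫_ℂ = ⟪y, M x⟫_ℂ) :
    ∃ hy : y ∈ M.domain, M ⟨y, hy⟩ = w := by
  have key : ∀ N : H →ₗ.[ℂ] H, N = M → y ∈ N.domain → ∃ hy : y ∈ M.domain, N.domain = M.domain := by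
    rintro N rfl h; exact ⟨h, rfl⟩
  have hy : y ∈ M.domain :=
    (key _ ((LinearPMap.isSelfAdjoint_def).1 hM) (LinearPMap.mem_adjoint_domain_of_exists y ⟨w, h⟩)).1
  refine ⟨hy, ?_⟩
  refine hM.dense_domain.eq_of_inner_left (𝕜 := ℂ) fun v hv => ?_
  rw [h ⟨v, hv⟩]
  exact inner_apply_eq_of_isSelfAdjoint hM ⟨y, hy⟩ ⟨v, hv⟩

/-- A symmetric operator for which `A + i` and `A - i` are onto is self-adjoint. -/
theorem isSelfAdjoint_of_surjective {A : H →ₗ.[ℂ] H}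
    (hs : ∀ x y : A.domain, ⟪A x, (y : H)⟫_ℂ = ⟪(x : H), A y⟫_ℂ)
    (hp : ∀ y, ∃ x : A.domain, A x + Complex.I • (x : H) = y)
    (hm : ∀ y, ∃ x : A.domain, A x - Complex.I • (x : H) = y) : IsSelfAdjoint A := by
  have hd : Dense (A.domain : Set H) := by
    rw [Submodule.dense_iff_topologicalClosure_eq_top, Submodule.topologicalClosure_eq_top_iff,
      eq_bot_iff]
    intro y hy
    obtain ⟨x, rfl⟩ := hp y
    have h1 := (Submodule.mem_orthogonal _ _).1 hy x x.2
    -- Since y = A x + i x is orthogonal to x, the imaginary part of ⟨x, A x + i x⟩, which is ‖x‖²,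
    -- vanishes; so the domain is dense.
    have him : (⟪(x : H), A x⟫_ℂ).im = 0 := by
      rw [← Complex.conj_eq_iff_im, inner_conj_symm, hs]
    have h2 := congrArg Complex.im h1
    rw [inner_add_right, inner_smul_right, Complex.add_im, him, inner_self_eq_norm_sq_to_K] at h2
    simp [← Complex.ofReal_pow] at h2
    have hx : x = 0 := h2
    simp [hx]
  rw [LinearPMap.isSelfAdjoint_def]
  have hle : A ≤ LinearPMap.adjoint A := LinearPMap.IsFormalAdjoint.le_adjoint hd (fun x y => hs x y)
  refine (LinearPMap.eq_of_le_of_domain_eq hle (le_antisymm hle.1 fun y hy => ?_)).symm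
  -- With (A - i)x = (A* - i)y, the vector y - x is killed by A* - i, hence orthogonal to the range
  -- of A + i, which is everything.
  obtain ⟨x, hx⟩ := hm (LinearPMap.adjoint A ⟨y, hy⟩ - Complex.I • y)
  have hadj := LinearPMap.adjoint_isFormalAdjoint hd (T := A)
  have hz : y - x = 0 := by
    obtain ⟨u, hu⟩ := hp (y - x)
    have h1 := hadj ⟨y, hy⟩ u
    have h2 := hs x u
    rw [← inner_self_eq_zero (𝕜 := ℂ)]
    nth_rw 2 [← hu]
    rw [inner_add_right, inner_sub_left, inner_sub_left, inner_smul_right, inner_smul_right,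
      ← h2]
    have h1' : ⟪y, A u⟫_ℂ = ⟪LinearPMap.adjoint A ⟨y, hy⟩, (u : H)⟫_ℂ := h1.symm
    rw [h1', sub_eq_iff_eq_add.1 hx.symm]
    simp only [inner_sub_left, inner_add_left, inner_smul_left, Complex.conj_I]
    have := sub_eq_iff_eq_add.1 hx
    rw [this]
    simp only [inner_sub_left, inner_add_left, inner_smul_left, Complex.conj_I]
    ring
  rw [sub_eq_zero.1 hz]
  exact x.2

theorem abs_im_mul_norm_le {M : H →ₗ.[ℂ] H} (hM : IsSelfAdjoint M) (z : ℂ) (x : M.domain) :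
    |z.im| * ‖(x : H)‖ ≤ ‖M x - z • (x : H)‖ := by
  by_cases hx : (x : H) = 0
  · simp [hx]
  have hx' : 0 < ‖(x : H)‖ := norm_pos_iff.2 hx
  have him : (⟪(x : H), M x⟫_ℂ).im = 0 := by
    rw [← Complex.conj_eq_iff_im, inner_conj_symm, inner_apply_eq_of_isSelfAdjoint hM]
  have h1 : (⟪(x : H), M x - z • (x : H)⟫_ℂ).im = -(z.im * ‖(x : H)‖ ^ 2) := by
    rw [inner_sub_right, inner_smul_right, Complex.sub_im, him, inner_self_eq_norm_sq_to_K]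
    simp [← Complex.ofReal_pow]
  have h2 : |z.im| * ‖(x : H)‖ ^ 2 ≤ ‖(x : H)‖ * ‖M x - z • (x : H)‖ := by
    calc |z.im| * ‖(x : H)‖ ^ 2 = |(⟪(x : H), M x - z • (x : H)⟫_ℂ).im| := by
          rw [h1, abs_neg, abs_mul, abs_of_nonneg (sq_nonneg ‖(x : H)‖)]
      _ ≤ ‖⟪(x : H), M x - z • (x : H)⟫_ℂ‖ := Complex.abs_im_le_norm _
      _ ≤ _ := norm_inner_le_norm _ _
  nlinarith

/-- The bound `abs_im_mul_norm_le` makes M - z injective and, as the graph of M is closed, its range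
closed. A vector orthogonal to the range lies in the domain and is an eigenvector for the conjugate
of z, so the same bound kills it. -/
theorem exists_isResolvent {M : H →ₗ.[ℂ] H} (hM : IsSelfAdjoint M) {z : ℂ} (hz : z.im ≠ 0) :
    ∃ R : H →L[ℂ] H, IsResolvent M z R ∧ ∀ y, |z.im| * ‖R y‖ ≤ ‖y‖ := by
  let T : M.domain →ₗ[ℂ] H := M.toFun - z • M.domain.subtype
  have hT : ∀ x, T x = M x - z • (x : H) := fun x => rfl
  have hpos : 0 < |z.im| := abs_pos.2 hz
  have hinj : Function.Injective T := by
    rw [← LinearMap.ker_eq_bot, LinearMap.ker_eq_bot']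
    intro x hx
    have := abs_im_mul_norm_le hM z x
    rw [← hT, hx, norm_zero] at this
    have h0 : ‖(x : H)‖ ≤ 0 := by
      by_contra h; push Not at h; nlinarith
    exact Subtype.ext (norm_le_zero_iff.1 h0)
  have hclosed : IsClosed (LinearMap.range T : Set H) := by
    refine IsSeqClosed.isClosed fun y a hy ha => ?_
    choose x hx using hy
    have hc : CauchySeq fun n => (x n : H) := by
      rw [Metric.cauchySeq_iff']
      intro ε hε
      obtain ⟨N, hN⟩ := Metric.cauchySeq_iff'.1 ha.cauchySeq (|z.im| * ε) (by positivity)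
      refine ⟨N, fun n hn => ?_⟩
      have h1 := abs_im_mul_norm_le hM z (x n - x N)
      rw [← hT, map_sub, hx, hx, ← dist_eq_norm] at h1
      have h2 := hN n hn
      rw [dist_eq_norm, ← Submodule.coe_sub]
      exact lt_of_mul_lt_mul_left (h1.trans_lt h2) hpos.le
    obtain ⟨u, hu⟩ := cauchySeq_tendsto_of_complete hc
    have hMx : Tendsto (fun n => M (x n)) atTop (𝓝 (a + z • u)) := by
      have := ha.add (hu.const_smul z)
      refine this.congr fun n => ?_
      rw [← hx, hT]; simp
    have hg : (u, a + z • u) ∈ M.graph := by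
      refine hM.isClosed.mem_of_tendsto (hu.prodMk_nhds hMx) (Eventually.of_forall fun n => ?_)
      exact M.mem_graph (x n)
    obtain ⟨v, hv1, hv2⟩ := (LinearPMap.mem_graph_iff M).1 hg
    refine ⟨v, ?_⟩
    rw [hT, hv2]
    simp only at hv1 ⊢
    rw [hv1]; simp
  have hdense : LinearMap.range T = ⊤ := by
    have hcs : CompleteSpace (LinearMap.range T) := hclosed.completeSpace_coe
    rw [← Submodule.orthogonal_eq_bot_iff, eq_bot_iff]
    intro y hy
    have h1 : ∀ x : M.domain, ⟪(starRingEnd ℂ z) • y, (x : H)⟫_ℂ = ⟪y, M x⟫_ℂ := by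
      intro x
      have := (Submodule.mem_orthogonal' _ _).1 hy (T x) ⟨x, rfl⟩
      rw [hT, inner_sub_right, inner_smul_right, sub_eq_zero] at this
      rw [this, inner_smul_left]; simp
    obtain ⟨hyd, hyM⟩ := mem_domain_of_isSelfAdjoint hM h1
    have h2 := abs_im_mul_norm_le hM (starRingEnd ℂ z) ⟨y, hyd⟩
    rw [hyM, sub_self, norm_zero, Complex.conj_im, abs_neg] at h2
    have h0 : ‖y‖ ≤ 0 := by
      by_contra h; push Not at h; simp only at h2; nlinarith
    exact norm_le_zero_iff.1 h0
  let e := LinearEquiv.ofBijective T ⟨hinj, LinearMap.range_eq_top.1 hdense⟩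
  have he : ∀ y, M (e.symm y) - z • ((e.symm y : M.domain) : H) = y := fun y => by
    rw [← hT]; exact e.apply_symm_apply y
  have hb : ∀ y, |z.im| * ‖((e.symm y : M.domain) : H)‖ ≤ ‖y‖ := fun y => by
    have := abs_im_mul_norm_le hM z (e.symm y)
    rwa [he] at this
  refine ⟨LinearMap.mkContinuous (M.domain.subtype ∘ₗ (e.symm : H →ₗ[ℂ] M.domain)) (|z.im|⁻¹)
    fun y => ?_, ⟨fun y => ⟨(e.symm y).2, he y⟩, fun x => ?_⟩, hb⟩
  · rw [← div_eq_inv_mul, le_div_iff₀' hpos]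
    exact hb y
  · change ((e.symm (T x) : M.domain) : H) = x
    rw [show T x = e x from rfl, e.symm_apply_apply]

theorem IsResolvent.inner_apply {M : H →ₗ.[ℂ] H} (hM : IsSelfAdjoint M) {z : ℂ}
    {R R' : H →L[ℂ] H} (hR : IsResolvent M z R) (hR' : IsResolvent M (starRingEnd ℂ z) R')
    (x y : H) : ⟪R x, y⟫_ℂ = ⟪x, R' y⟫_ℂ := by
  obtain ⟨h1, e1⟩ := hR.1 x
  obtain ⟨h2, e2⟩ := hR'.1 y
  have := inner_apply_eq_of_isSelfAdjoint hM ⟨_, h1⟩ ⟨_, h2⟩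
  nth_rw 1 [← e2]
  nth_rw 2 [← e1]
  rw [inner_sub_left, inner_sub_right, inner_smul_left, inner_smul_right, this]

/-- On the domain, -zRu - u = -R(Mu), which is at most ‖Mu‖/|Im z|. The operators zR are
contractions, so density of the domain extends the limit to every vector. -/
theorem tendsto_smul_resolvent {M : H →ₗ.[ℂ] H} (hM : IsSelfAdjoint M) {z : ℕ → ℂ}
    {R : ℕ → H →L[ℂ] H} (hz : ∀ n, ‖z n‖ = |(z n).im|) (hz0 : ∀ n, (z n).im ≠ 0)
    (hzt : Tendsto (fun n => |(z n).im|) atTop atTop) (hR : ∀ n, IsResolvent M (z n) (R n))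
    (hb : ∀ n y, |(z n).im| * ‖R n y‖ ≤ ‖y‖) (w : H) :
    Tendsto (fun n => -(z n • R n w)) atTop (𝓝 w) := by
  have hn : ∀ n y, ‖z n • R n y‖ ≤ ‖y‖ := fun n y => by rw [norm_smul, hz]; exact hb n y
  have hd : ∀ u : M.domain, ∀ n, ‖-(z n • R n (u : H)) - u‖ ≤ ‖M u‖ / |(z n).im| := by
    intro u n
    have h1 := (hR n).2 u
    rw [map_sub, map_smul] at h1
    have h2 : -(z n • R n (u : H)) - u = -R n (M u) := by
      nth_rw 2 [← h1]; abel
    rw [h2, norm_neg, le_div_iff₀' (abs_pos.2 (hz0 n))]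
    exact hb n _
  rw [Metric.tendsto_atTop]
  intro ε hε
  obtain ⟨u, hu, hwu⟩ := Metric.dense_iff.1 hM.dense_domain w (ε / 3) (by positivity)
  have ht : Tendsto (fun n => ‖M ⟨u, hwu⟩‖ / |(z n).im|) atTop (𝓝 0) :=
    Tendsto.div_atTop tendsto_const_nhds hzt
  obtain ⟨N, hN⟩ := (ht.eventually (gt_mem_nhds (show 0 < ε / 3 by positivity))).exists_forall_of_atTop
  refine ⟨N, fun n hnN => ?_⟩
  have h1 := hd ⟨u, hwu⟩ n
  have h2 := hN n hnN
  have h3 := hn n (u - w)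
  rw [Metric.mem_ball, dist_eq_norm] at hu
  have e : -(z n • R n w) - w = (-(z n • R n u) - u) + z n • R n (u - w) + (u - w) := by
    rw [map_sub, smul_sub]; abel
  rw [dist_eq_norm, e]
  have h4 := norm_add_le (-(z n • R n u) - u + z n • R n (u - w)) (u - w)
  have h5 := norm_add_le (-(z n • R n u) - u) (z n • R n (u - w))
  simp only at h1
  linarith

/-- Strongly commuting self-adjoint operators commute in the sense of quadratic forms. -/
theorem StronglyCommute.inner_apply {M A : H →ₗ.[ℂ] H} (hM : IsSelfAdjoint M)
    (hA : IsSelfAdjoint A) (hc : StronglyCommute M A) {u v : H} (huM : u ∈ M.domain)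
    (huA : u ∈ A.domain) (hvM : v ∈ M.domain) (hvA : v ∈ A.domain) :
    ⟪M ⟨u, huM⟩, A ⟨v, hvA⟩⟫_ℂ = ⟪A ⟨u, huA⟩, M ⟨v, hvM⟩⟫_ℂ := by
  -- By the resolvent limit, -zR(z) with z = i(n + 1) may be inserted before M u, and its adjoint
  -- before M v. As R M u = u + z R u and R commutes with A, the two inner products then agree for
  -- every n.
  let z : ℕ → ℂ := fun n => ((n : ℝ) + 1 : ℝ) * Complex.I
  let z' : ℕ → ℂ := fun n => starRingEnd ℂ (z n)
  have him : ∀ n, (z n).im = (n : ℝ) + 1 := fun n => by simp [z]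
  have him' : ∀ n, (z' n).im = -((n : ℝ) + 1) := fun n => by simp [z', z]
  have hp : ∀ n : ℕ, (0 : ℝ) < (n : ℝ) + 1 := fun n => by positivity
  have habs : ∀ n, |(z n).im| = (n : ℝ) + 1 := fun n => by rw [him, abs_of_pos (hp n)]
  have habs' : ∀ n, |(z' n).im| = (n : ℝ) + 1 := fun n => by rw [him', abs_neg, abs_of_pos (hp n)]
  have hz0 : ∀ n, (z n).im ≠ 0 := fun n => by rw [him]; exact (hp n).ne'
  have hz0' : ∀ n, (z' n).im ≠ 0 := fun n => by rw [him']; exact (neg_lt_zero.2 (hp n)).ne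
  have hnz : ∀ n, ‖z n‖ = |(z n).im| := fun n => by
    rw [habs]
    simp only [z, norm_mul, Complex.norm_I, mul_one, Complex.norm_real, Real.norm_eq_abs]
    exact abs_of_pos (hp n)
  have hnz' : ∀ n, ‖z' n‖ = |(z' n).im| := fun n => by
    rw [habs', ← habs, ← hnz]; simp [z']
  have hlim : Tendsto (fun n : ℕ => (n : ℝ) + 1) atTop atTop :=
    tendsto_atTop_add_const_right _ _ tendsto_natCast_atTop_atTop
  choose R hR hRb using fun n => exists_isResolvent hM (hz0 n)
  choose R' hR' hRb' using fun n => exists_isResolvent hM (hz0' n)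
  have t1 := tendsto_smul_resolvent hM hnz hz0 (by simpa only [habs] using hlim) hR hRb (M ⟨u, huM⟩)
  have t2 := tendsto_smul_resolvent hM hnz' hz0' (by simpa only [habs'] using hlim) hR' hRb'
    (M ⟨v, hvM⟩)
  have t3 := t1.inner (𝕜 := ℂ) (tendsto_const_nhds (x := A ⟨v, hvA⟩))
  have t4 := (tendsto_const_nhds (x := A ⟨u, huA⟩)).inner (𝕜 := ℂ) t2
  refine tendsto_nhds_unique t3 (t4.congr fun n => ?_)
  have rM : ∀ {z : ℂ} {R : H →L[ℂ] H} (_ : IsResolvent M z R) {x : H} (hx : x ∈ M.domain),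
      R (M ⟨x, hx⟩) = x + z • R x := by
    intro z R h x hx
    have := h.2 ⟨x, hx⟩
    rw [map_sub, map_smul, sub_eq_iff_eq_add] at this
    exact this
  obtain ⟨hRu, hARu⟩ := hc (z n) (hz0 n) (R n) (hR n) ⟨u, huA⟩
  simp only [ContinuousLinearMap.coe_coe] at hRu hARu
  have s1 := inner_apply_eq_of_isSelfAdjoint hA ⟨u, huA⟩ ⟨v, hvA⟩
  have s2 := inner_apply_eq_of_isSelfAdjoint hA ⟨_, hRu⟩ ⟨v, hvA⟩
  rw [hARu, (hR n).inner_apply hM (hR' n)] at s2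
  rw [rM (hR n) huM, rM (hR' n) hvM]
  simp only [inner_neg_left, inner_neg_right, inner_smul_left, inner_smul_right, inner_add_left,
    inner_add_right, smul_add]
  simp only at s1 s2
  rw [s1, s2]

end SelfAdjoint

/-! ### Product vectors and tensor-factor operators on ℂ^d ⊗ E. -/

section CompositeAlgebra

variable {d : ℕ} {E : Type} [NormedAddCommGroup E] [InnerProductSpace ℂ E]

theorem tmul_apply (s : EuclideanSpace ℂ (Fin d)) (e : E) (a : Fin d) : tmul s e a = s a • e := rfl

theorem smul_tmul (c : ℂ) (s : EuclideanSpace ℂ (Fin d)) (e : E) :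
    tmul (c • s) e = c • tmul s e := by
  ext a; simp [tmul_apply, smul_smul]

theorem tmul_smul (c : ℂ) (s : EuclideanSpace ℂ (Fin d)) (e : E) :
    tmul s (c • e) = c • tmul s e := by
  ext a; simp [tmul_apply, smul_smul, mul_comm]

theorem sub_tmul (s t : EuclideanSpace ℂ (Fin d)) (e : E) :
    tmul (s - t) e = tmul s e - tmul t e := by
  ext a; simp [tmul_apply, sub_smul]

theorem inner_tmul_tmul (s t : EuclideanSpace ℂ (Fin d)) (e e' : E) :
    ⟪tmul s e, tmul t e'⟫_ℂ = ⟪s, t⟫_ℂ * ⟪e, e'⟫_ℂ := by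
  simp only [PiLp.inner_apply, tmul_apply, inner_smul_left, inner_smul_right, Finset.sum_mul,
    RCLike.inner_apply]
  refine Finset.sum_congr rfl fun a _ => by ring

theorem norm_tmul (s : EuclideanSpace ℂ (Fin d)) (e : E) : ‖tmul s e‖ = ‖s‖ * ‖e‖ := by
  have h := inner_tmul_tmul s s e e
  simp only [inner_self_eq_norm_sq_to_K] at h
  rw [← mul_pow] at h
  have h' : ‖tmul s e‖ ^ 2 = (‖s‖ * ‖e‖) ^ 2 := by exact_mod_cast h
  exact (pow_left_inj₀ (norm_nonneg _) (by positivity) two_ne_zero).1 h'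

theorem leftOp_apply (T : Matrix (Fin d) (Fin d) ℂ) (x : Composite d E) (a : Fin d) :
    leftOp T x a = ∑ b, T a b • x b := rfl

theorem leftOp_tmul (T : Matrix (Fin d) (Fin d) ℂ) (s : EuclideanSpace ℂ (Fin d)) (e : E) :
    leftOp T (tmul s e) = tmul (toEuclideanCLM (𝕜 := ℂ) T s) e := by
  ext a
  rw [leftOp_apply, tmul_apply, ofLp_toEuclideanCLM]
  simp [Matrix.mulVec, dotProduct, tmul_apply, Finset.sum_smul, smul_smul]

theorem leftOp_mul (S T : Matrix (Fin d) (Fin d) ℂ) (x : Composite d E) :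
    leftOp (S * T) x = leftOp S (leftOp T x) := by
  ext a
  simp only [leftOp_apply, Matrix.mul_apply, Finset.sum_smul, Finset.smul_sum, smul_smul]
  exact Finset.sum_comm

theorem leftOp_one (x : Composite d E) : leftOp (1 : Matrix (Fin d) (Fin d) ℂ) x = x := by
  ext a
  simp [leftOp_apply, Matrix.one_apply]

theorem leftOp_sub (S T : Matrix (Fin d) (Fin d) ℂ) (x : Composite d E) :
    leftOp (S - T) x = leftOp S x - leftOp T x := by
  ext a
  simp [leftOp_apply, sub_smul]

theorem inner_leftOp_left (T : Matrix (Fin d) (Fin d) ℂ) (x y : Composite d E) :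
    ⟪leftOp T x, y⟫_ℂ = ⟪x, leftOp Tᴴ y⟫_ℂ := by
  simp only [PiLp.inner_apply, leftOp_apply, sum_inner, inner_sum, inner_smul_left,
    inner_smul_right, Matrix.conjTranspose_apply]
  rw [Finset.sum_comm]
  rfl

theorem totalOp_apply (A : Matrix (Fin d) (Fin d) ℂ) (M : E →ₗ.[ℂ] E)
    (x : (totalOp A M).domain) : totalOp A M x = leftOp A x.1 + rightOp (d := d) M ⟨x.1, x.2⟩ := rfl

theorem noiseOp_apply (B : Matrix (Fin d) (Fin d) ℂ) (M : E →ₗ.[ℂ] E)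
    (U : Composite d E ≃ₗᵢ[ℂ] Composite d E) (x : (noiseOp B M U).domain) :
    noiseOp B M U x = leftOp B x.1 - U.symm (rightOp (d := d) M ⟨U x.1, x.2⟩) := rfl

theorem tmul_mem_rightOp_domain {M : E →ₗ.[ℂ] E} {s : EuclideanSpace ℂ (Fin d)} {e : E}
    (he : e ∈ M.domain) : tmul s e ∈ (rightOp (d := d) M).domain :=
  fun a => M.domain.smul_mem (s a) he

theorem rightOp_tmul {M : E →ₗ.[ℂ] E} {s : EuclideanSpace ℂ (Fin d)} {e : E}
    (he : e ∈ M.domain) (h : tmul s e ∈ (rightOp (d := d) M).domain) :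
    rightOp M ⟨tmul s e, h⟩ = tmul s (M ⟨e, he⟩) := by
  ext a
  exact M.map_smul (s a) ⟨e, he⟩

theorem commutesWith_leftOp_rightOp (T : Matrix (Fin d) (Fin d) ℂ) (M : E →ₗ.[ℂ] E) :
    CommutesWith (leftOp T : Composite d E →ₗ[ℂ] Composite d E) (rightOp M) := by
  intro x
  have h : leftOp T x.1 ∈ (rightOp (d := d) M).domain := fun a => by
    rw [leftOp_apply]
    exact M.domain.sum_mem fun b _ => M.domain.smul_mem _ (x.2 b)
  refine ⟨h, ?_⟩
  ext a
  have e : (⟨leftOp T x.1 a, h a⟩ : M.domain) = ∑ b, T a b • ⟨x.1 b, x.2 b⟩ := by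
    ext; simp [leftOp_apply]
  change M ⟨leftOp T x.1 a, h a⟩ = _
  rw [e, ← LinearPMap.toFun_eq_coe, map_sum]
  simp only [map_smul]
  rfl

/-- Contraction of the first tensor factor with `s`. -/
noncomputable def contract (s : EuclideanSpace ℂ (Fin d)) (z : Composite d E) : E :=
  ∑ a, (starRingEnd ℂ (s a)) • z a

theorem inner_tmul_right (s : EuclideanSpace ℂ (Fin d)) (z : Composite d E) (e : E) :
    ⟪z, tmul s e⟫_ℂ = ⟪contract s z, e⟫_ℂ := by
  simp [contract, PiLp.inner_apply, tmul_apply, inner_smul_right, mul_comm]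

theorem inner_tmul_left (s : EuclideanSpace ℂ (Fin d)) (z : Composite d E) (e : E) :
    ⟪tmul s e, z⟫_ℂ = ⟪e, contract s z⟫_ℂ := by
  rw [← inner_conj_symm, inner_tmul_right, inner_conj_symm]

/-- Pythagoras: `tmul s (contract s z)` is the orthogonal projection of z onto s ⊗ E. -/
theorem norm_sub_tmul_contract_sq {s : EuclideanSpace ℂ (Fin d)} (hs : ‖s‖ = 1)
    (z : Composite d E) :
    ‖z - tmul s (contract s z)‖ ^ 2 + ‖contract s z‖ ^ 2 = ‖z‖ ^ 2 := by
  have h : ⟪z - tmul s (contract s z), tmul s (contract s z)⟫_ℂ = 0 := by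
    rw [inner_sub_left, inner_tmul_right, inner_tmul_tmul, inner_self_eq_norm_sq_to_K (𝕜 := ℂ) s,
      hs]
    simp
  have h2 := norm_add_sq_eq_norm_sq_add_norm_sq_of_inner_eq_zero _ _ h
  rw [sub_add_cancel, norm_tmul, hs, one_mul] at h2
  simp only [sq]
  exact h2.symm

variable [CompleteSpace E]

/-- The operator 1 ⊗ M - z is inverted component by component by the resolvent of M. -/
theorem isSelfAdjoint_rightOp {M : E →ₗ.[ℂ] E} (hM : IsSelfAdjoint M) :
    IsSelfAdjoint (rightOp (d := d) M) := by
  have hsurj : ∀ z : ℂ, z.im ≠ 0 → ∀ y : Composite d E,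
      ∃ x : (rightOp (d := d) M).domain, rightOp M x - z • (x : Composite d E) = y := by
    intro z hz y
    obtain ⟨R, hR, -⟩ := exists_isResolvent hM hz
    choose h e using hR.1
    refine ⟨⟨WithLp.toLp 2 fun a => R (y a), fun a => h (y a)⟩, ?_⟩
    ext a
    exact e (y a)
  refine isSelfAdjoint_of_surjective ?_ ?_ (hsurj _ (by simp))
  · intro x y
    simp only [PiLp.inner_apply]
    exact Finset.sum_congr rfl fun a _ => inner_apply_eq_of_isSelfAdjoint hM ⟨x.1 a, x.2 a⟩ ⟨y.1 a, y.2 a⟩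
  · intro y
    obtain ⟨x, hx⟩ := hsurj (-Complex.I) (by simp) y
    exact ⟨x, by rw [← hx]; simp⟩

end CompositeAlgebra

/-! ### Standard monotones lie below the arithmetic mean. -/

section StandardMonotone

/-- No regularity of f is needed: on the finite set of spectral points and values of D it agrees
with a Lagrange polynomial, and polynomials pass through conjugation and act entrywise on diagonals.
-/
theorem cfc_conj_diagonal {n : Type*} [Fintype n] [DecidableEq n] (f : ℝ → ℝ)
    (V : unitary (Matrix n n ℂ)) (D : n → ℝ) :
    cfc f ((V : Matrix n n ℂ) * diagonal (fun i => (D i : ℂ)) * star (V : Matrix n n ℂ)) =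
      (V : Matrix n n ℂ) * diagonal (fun i => (f (D i) : ℂ)) * star (V : Matrix n n ℂ) := by
  classical
  set Y := (V : Matrix n n ℂ) * diagonal (fun i => (D i : ℂ)) * star (V : Matrix n n ℂ) with hY
  have hYs : IsSelfAdjoint Y := by
    rw [isSelfAdjoint_iff, hY, star_mul, star_mul, star_star, mul_assoc]
    simp [Matrix.star_eq_conjTranspose, Matrix.diagonal_conjTranspose, Pi.star_def]
  have hfin : (spectrum ℝ Y).Finite := Matrix.finite_real_spectrum
  let S : Finset ℝ := hfin.toFinset ∪ Finset.univ.image D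
  let q := Lagrange.interpolate S id f
  have hq : ∀ x ∈ S, q.eval x = f x := fun x hx =>
    Lagrange.eval_interpolate_at_node f (fun _ _ _ _ h => h) hx
  have h1 : cfc f Y = cfc q.eval Y := cfc_congr fun x hx =>
    (hq x (Finset.mem_union_left _ (hfin.mem_toFinset.2 hx))).symm
  rw [h1, cfc_polynomial q Y hYs]
  have h2 : Y = Unitary.conjStarAlgAut ℝ _ V (Matrix.diagonalAlgHom ℝ fun i => (D i : ℂ)) := rfl
  have h3 : Polynomial.aeval Y q = Unitary.conjStarAlgAut ℝ _ V
      (Polynomial.aeval (Matrix.diagonalAlgHom ℝ fun i => (D i : ℂ)) q) := by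
    rw [h2]
    exact Polynomial.aeval_algHom_apply
      ((Unitary.conjStarAlgAut ℝ (Matrix n n ℂ) V : _ ≃⋆ₐ[ℝ] _) : Matrix n n ℂ →ₐ[ℝ] Matrix n n ℂ) _ q
  have h4 : Polynomial.aeval (fun i => (D i : ℂ)) q = fun i => (f (D i) : ℂ) := by
    funext i
    have := Polynomial.aeval_algHom_apply (Pi.evalAlgHom ℝ (fun _ : n => ℂ) i)
      (fun i => (D i : ℂ)) q
    refine this.symm.trans ?_
    change Polynomial.aeval (algebraMap ℝ ℂ (D i)) q = _
    rw [Polynomial.aeval_algebraMap_apply, Polynomial.coe_aeval_eq_eval,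
      hq _ (Finset.mem_union_right _ (Finset.mem_image_of_mem D (Finset.mem_univ i)))]
    rfl
  rw [h3, Polynomial.aeval_algHom_apply, h4]
  rfl

theorem cfc_diagonal {n : Type*} [Fintype n] [DecidableEq n] (f : ℝ → ℝ) (D : n → ℝ) :
    cfc f (diagonal (fun i => (D i : ℂ)) : Matrix n n ℂ) = diagonal (fun i => (f (D i) : ℂ)) := by
  simpa using cfc_conj_diagonal f 1 D

/-- The rotation with first row `(c, -s)`. -/
noncomputable def rotation (c s : ℝ) : Matrix (Fin 2) (Fin 2) ℂ := !![(c : ℂ), -s; s, c]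

theorem rotation_mem_unitary {c s : ℝ} (h : c ^ 2 + s ^ 2 = 1) :
    rotation c s ∈ unitary (Matrix (Fin 2) (Fin 2) ℂ) := by
  have h' : (c : ℂ) * c + s * s = 1 := by rw [← sq, ← sq]; exact_mod_cast h
  have h'' : (s : ℂ) * s + c * c = 1 := by rw [add_comm]; exact h'
  rw [Unitary.mem_iff]
  constructor <;> ext i j <;> fin_cases i <;> fin_cases j <;>
    simp [rotation, Matrix.mul_apply, h', h'', mul_comm]

theorem rotation_conj_diagonal (c s : ℝ) (D : Fin 2 → ℝ) :
    rotation c s * diagonal (fun i => (D i : ℂ)) * star (rotation c s) =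
      !![((c ^ 2 * D 0 + s ^ 2 * D 1 : ℝ) : ℂ), ((c * s * (D 0 - D 1) : ℝ) : ℂ);
        ((c * s * (D 0 - D 1) : ℝ) : ℂ), ((s ^ 2 * D 0 + c ^ 2 * D 1 : ℝ) : ℂ)] := by
  ext i j
  fin_cases i <;> fin_cases j <;>
    simp [rotation, Matrix.mul_apply, Matrix.vecMul_diagonal] <;> ring

variable {f : ℝ → ℝ}

theorem IsStandardMonotone.le_of_le (hf : IsStandardMonotone f) {x y : ℝ} (hx : 0 ≤ x)
    (hxy : x ≤ y) : f x ≤ f y := by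
  have h := hf.monotone 1 (diagonal fun _ => (x : ℂ)) (diagonal fun _ => (y : ℂ))
    (Matrix.PosSemidef.diagonal fun _ => by simpa using hx)
    (by
      rw [Matrix.diagonal_sub]
      exact Matrix.PosSemidef.diagonal fun _ => by simpa using hxy)
  rw [cfc_diagonal f (fun _ => x), cfc_diagonal f (fun _ => y)] at h
  have := h.diag_nonneg (i := 0)
  simpa using this

theorem IsStandardMonotone.one_add_le (hf : IsStandardMonotone f) {ε : ℝ} (hε : 0 < ε) :
    f (1 + ε) ≤ 1 + ε := by
  rw [hf.symm _ (by positivity)]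
  have h : f (1 / (1 + ε)) ≤ f 1 :=
    hf.le_of_le (by positivity) (by rw [div_le_one (by positivity)]; linarith)
  rw [hf.map_one] at h
  nlinarith

/-- Operator monotone functions are concave. The rotated diagonal matrix with eigenvalues x, y has
corner c²x + s²y; raising that corner by ε and choosing the other entry large enough dominates it by
a diagonal matrix. Applying f and comparing corners gives the inequality. -/
theorem IsStandardMonotone.weighted_le (hf : IsStandardMonotone f) {c s x y ε : ℝ}
    (hcs : c ^ 2 + s ^ 2 = 1) (hx : 0 ≤ x) (hy : 0 ≤ y) (hε : 0 < ε) :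
    c ^ 2 * f x + s ^ 2 * f y ≤ f (c ^ 2 * x + s ^ 2 * y + ε) := by
  let D : Fin 2 → ℝ := ![x, y]
  let b := c * s * (x - y)
  -- The excess b²/ε is the smallest one that works: the difference of the two matrices becomes the
  -- rank-one matrix w w*.
  let K := s ^ 2 * x + c ^ 2 * y + b ^ 2 / ε
  let D' : Fin 2 → ℝ := ![c ^ 2 * x + s ^ 2 * y + ε, K]
  let V : unitary (Matrix (Fin 2) (Fin 2) ℂ) := ⟨rotation c s, rotation_mem_unitary hcs⟩
  have hV : (V : Matrix (Fin 2) (Fin 2) ℂ) = rotation c s := rfl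
  have hX : (rotation c s * diagonal (fun i => (D i : ℂ)) * star (rotation c s)).PosSemidef :=
    Matrix.PosSemidef.mul_mul_conjTranspose_same
      (Matrix.PosSemidef.diagonal fun i => by fin_cases i <;> simpa [D]) _
  let w : Fin 2 → ℂ := ![(√ε : ℝ), (-(b / √ε) : ℝ)]
  have hsq : √ε * √ε = ε := Real.mul_self_sqrt hε.le
  have hne : √ε ≠ 0 := (Real.sqrt_pos.2 hε).ne'
  have hYX : (diagonal (fun i => (D' i : ℂ)) -
      rotation c s * diagonal (fun i => (D i : ℂ)) * star (rotation c s)).PosSemidef := by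
    have e : diagonal (fun i => (D' i : ℂ)) -
        rotation c s * diagonal (fun i => (D i : ℂ)) * star (rotation c s) =
        Matrix.vecMulVec w (star w) := by
      rw [rotation_conj_diagonal]
      have e1 : √ε * (b / √ε) = b := by field_simp
      have e2 : b / √ε * (b / √ε) = b ^ 2 / ε := by
        rw [div_mul_div_comm, hsq, sq]
      ext i j
      fin_cases i <;> fin_cases j
      · simp only [Matrix.sub_apply, Matrix.vecMulVec_apply, D, D', w]
        simp [← Complex.ofReal_mul, hsq]
      · simp only [Matrix.sub_apply, Matrix.vecMulVec_apply, D, D', w]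
        simp
        exact_mod_cast e1.symm
      · simp only [Matrix.sub_apply, Matrix.vecMulVec_apply, D, D', w]
        simp
        exact_mod_cast (mul_comm _ √ε ▸ e1.symm : b = b / √ε * √ε)
      · simp only [Matrix.sub_apply, Matrix.vecMulVec_apply, D, D', w]
        simp [K]
        exact_mod_cast e2.symm
    rw [e]
    exact Matrix.posSemidef_vecMulVec_self_star w
  have h := hf.monotone 2 _ _ hX hYX
  rw [cfc_diagonal, ← hV, cfc_conj_diagonal, hV, rotation_conj_diagonal c s (fun i => f (D i))] at h
  have h0 := h.diag_nonneg (i := 0)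
  simp only [Matrix.sub_apply, Matrix.diagonal_apply_eq, Matrix.of_apply, Matrix.cons_val_zero,
    Matrix.cons_val', D, D', ← Complex.ofReal_sub] at h0
  norm_num at h0
  exact_mod_cast h0

/-- Concavity at the points x and 1/x with weights 1/(1 + x) and x/(1 + x), whose mean is 1. By
symmetry f(1/x) = f(x)/x, so both terms contribute f(x)/(1 + x); the slack ε is harmless because f(1
+ ε) ≤ 1 + ε. -/
theorem IsStandardMonotone.le_arith (hf : IsStandardMonotone f) {x : ℝ} (hx : 0 < x) :
    f x ≤ (1 + x) / 2 := by
  have h1 : ∀ ε : ℝ, 0 < ε → 2 * f x / (1 + x) ≤ 1 + ε := by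
    intro ε hε
    have hc : √(1 / (1 + x)) ^ 2 = 1 / (1 + x) := Real.sq_sqrt (by positivity)
    have hs : √(x / (1 + x)) ^ 2 = x / (1 + x) := Real.sq_sqrt (by positivity)
    have h := hf.weighted_le (c := √(1 / (1 + x))) (s := √(x / (1 + x))) (x := x) (y := 1 / x)
      (by rw [hc, hs]; field_simp) hx.le (by positivity) hε
    rw [hc, hs] at h
    have e1 : 1 / (1 + x) * x + x / (1 + x) * (1 / x) = 1 := by field_simp; ring
    rw [e1] at h
    refine le_trans (le_of_eq ?_) (h.trans (hf.one_add_le hε))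
    rw [hf.symm x hx]
    field_simp
    ring
  have h2 : 2 * f x / (1 + x) ≤ 1 := le_of_forall_pos_le_add h1
  rw [div_le_one (by positivity)] at h2
  linarith

theorem IsStandardMonotone.pos (hf : IsStandardMonotone f) {x : ℝ} (hx : 0 < x) : 0 < f x := by
  have h1 : ∀ y : ℝ, 1 ≤ y → 0 < f y := fun y hy => by
    have := hf.le_of_le zero_le_one hy
    rw [hf.map_one] at this
    linarith
  rcases le_total 1 x with h | h
  · exact h1 x h
  · rw [hf.symm x hx]
    exact mul_pos hx (h1 _ (by rw [le_div_iff₀ hx]; linarith))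

theorem IsStandardMonotone.zero_nonneg (hf : IsStandardMonotone f) : 0 ≤ f 0 :=
  ge_of_tendsto hf.tendsto_zero (by
    filter_upwards [self_mem_nhdsWithin] with x hx using (hf.pos hx).le)

theorem IsStandardMonotone.zero_le_half (hf : IsStandardMonotone f) : f 0 ≤ 1 / 2 := by
  have h : Tendsto (fun x : ℝ => (1 + x) / 2) (𝓝[>] 0) (𝓝 ((1 + 0) / 2)) :=
    (Continuous.tendsto (by fun_prop) 0).mono_left nhdsWithin_le_nhds
  have := le_of_tendsto_of_tendsto hf.tendsto_zero h (by
    filter_upwards [self_mem_nhdsWithin] with x hx using hf.le_arith hx)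
  simpa using this

/-- The weight `(p - q) ^ 2 / (2 * (p + q))` of the arithmetic mean. -/
noncomputable def arithWeight (p q : ℝ) : ℝ := (p - q) ^ 2 / (2 * (p + q))

theorem arithWeight_nonneg {p q : ℝ} (hp : 0 ≤ p) (hq : 0 ≤ q) : 0 ≤ arithWeight p q := by
  unfold arithWeight; positivity

theorem arithWeight_zero_right {p : ℝ} : arithWeight p 0 = p / 2 := by
  unfold arithWeight
  rcases eq_or_ne p 0 with rfl | h
  · simp
  · rw [sub_zero, add_zero, sq]; field_simp

theorem arithWeight_comm (p q : ℝ) : arithWeight p q = arithWeight q p := by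
  unfold arithWeight; rw [add_comm, ← neg_sub, neg_sq]

/-- For positive p, q this is f(x) ≤ (1 + x)/2 in the denominator. If one of them vanishes the
coefficients are f(0)(p + q) and (p + q)/2, and f(0) ≤ 1/2. -/
theorem IsStandardMonotone.arithWeight_le_skewWeight (hf : IsStandardMonotone f) {p q : ℝ}
    (hp : 0 ≤ p) (hq : 0 ≤ q) : 2 * f 0 * arithWeight p q ≤ skewWeight f p q := by
  have h0 := hf.zero_nonneg
  have h1 := hf.zero_le_half
  unfold skewWeight
  split_ifs with h
  · rcases h with rfl | rfl
    · rw [arithWeight_comm, arithWeight_zero_right]; nlinarith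
    · rw [arithWeight_zero_right]; nlinarith
  · push Not at h
    have hp' := lt_of_le_of_ne hp (Ne.symm h.1)
    have hq' := lt_of_le_of_ne hq (Ne.symm h.2)
    have hpq : 0 < p / q := div_pos hp' hq'
    have h2 : q * f (p / q) ≤ (p + q) / 2 := by
      have := mul_le_mul_of_nonneg_left (hf.le_arith hpq) hq
      have e : q * ((1 + p / q) / 2) = (p + q) / 2 := by field_simp; ring
      linarith
    have h3 : (p - q) ^ 2 / ((p + q) / 2) ≤ (p - q) ^ 2 / (q * f (p / q)) :=
      div_le_div_of_nonneg_left (sq_nonneg _) (mul_pos hq' (hf.pos hpq)) h2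
    have e : 2 * f 0 * arithWeight p q = f 0 / 2 * ((p - q) ^ 2 / ((p + q) / 2)) := by
      unfold arithWeight; field_simp
    rw [e]
    exact mul_le_mul_of_nonneg_left h3 (by positivity)

end StandardMonotone

/-! ### Spectral data of pure states. -/

section PureState

variable {H : Type} [NormedAddCommGroup H] [InnerProductSpace ℂ H] [CompleteSpace H]

/-- The pure state `|s⟩⟨s|`. -/
noncomputable def pureState (s : H) (hs : ‖s‖ = 1) : DensityOperator H where
  op := InnerProductSpace.rankOne ℂ s s
  isPositive := InnerProductSpace.isPositive_rankOne_self s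
  trace_one := by
    obtain ⟨w, b, -⟩ := exists_hilbertBasis ℂ H
    refine ⟨w, b, ?_⟩
    have h := b.hasSum_inner_mul_inner s s
    rw [inner_self_eq_norm_sq_to_K, hs] at h
    simpa [inner_smul_right] using h

/-- An eigenvector with nonzero eigenvalue lies on the line of s, and orthonormality allows only one
such vector. The phase c is not determined by the state, so later uses must not depend on it. -/
theorem pureState_eigen (s : H) (hs : ‖s‖ = 1) :
    ∃ i₀, (pureState s hs).eigenvalue i₀ = 1 ∧
      (∀ i, i ≠ i₀ → (pureState s hs).eigenvalue i = 0) ∧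
      ∃ c : ℂ, ‖c‖ = 1 ∧ (pureState s hs).eigenbasis i₀ = c • s := by
  set ρ := pureState s hs with hρ
  obtain ⟨-, h1, h2⟩ := ρ.eigen_spec
  have h3 : ∀ i, ⟪s, ρ.eigenbasis i⟫_ℂ • s = (ρ.eigenvalue i : ℂ) • ρ.eigenbasis i := h2
  have hn := ρ.eigenbasis.orthonormal
  have key : ∀ i, ρ.eigenvalue i ≠ 0 →
      ∃ c : ℂ, c ≠ 0 ∧ ρ.eigenbasis i = c • s := fun i hi => by
    have e : ρ.eigenbasis i = ((ρ.eigenvalue i : ℂ)⁻¹ * ⟪s, ρ.eigenbasis i⟫_ℂ) • s := by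
      rw [mul_smul, h3, smul_smul, inv_mul_cancel₀ (by exact_mod_cast hi), one_smul]
    refine ⟨_, fun h0 => ?_, e⟩
    rw [h0, zero_smul] at e
    have := hn.1 i
    rw [e, norm_zero] at this
    exact zero_ne_one this
  obtain ⟨i₀, hi₀⟩ : ∃ i, ρ.eigenvalue i ≠ 0 := by
    by_contra! h
    rw [show ρ.eigenvalue = fun _ => 0 from funext h] at h1
    exact zero_ne_one (hasSum_zero.unique h1)
  obtain ⟨c, hc, hcs⟩ := key i₀ hi₀
  have hz : ∀ i, i ≠ i₀ → ρ.eigenvalue i = 0 := fun i hi => by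
    by_contra h
    obtain ⟨c', hc', hcs'⟩ := key i h
    have : ⟪ρ.eigenbasis i, ρ.eigenbasis i₀⟫_ℂ = 0 := hn.2 hi
    rw [hcs, hcs', inner_smul_left, inner_smul_right, inner_self_eq_norm_sq_to_K, hs] at this
    simp [hc, hc'] at this
  refine ⟨i₀, (hasSum_single i₀ hz).unique h1, hz, c, ?_, hcs⟩
  have := hn.1 i₀
  rwa [hcs, norm_smul, hs, mul_one] at this

end PureState

/-! ### Matrix elements of unbounded operators. -/

section MatrixElement

variable {H : Type} [NormedAddCommGroup H] [InnerProductSpace ℂ H] {A : H →ₗ.[ℂ] H}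

theorem matrixElement_of_left {x y : H} (hx : x ∈ A.domain) :
    matrixElement A x y = ⟪A ⟨x, hx⟩, y⟫_ℂ := by
  rw [matrixElement, dif_pos hx]

theorem matrixElement_of_right [CompleteSpace H] (hA : IsSelfAdjoint A) {x y : H}
    (hy : y ∈ A.domain) : matrixElement A x y = ⟪x, A ⟨y, hy⟩⟫_ℂ := by
  by_cases hx : x ∈ A.domain
  · rw [matrixElement_of_left hx]
    exact inner_apply_eq_of_isSelfAdjoint hA ⟨x, hx⟩ ⟨y, hy⟩
  · rw [matrixElement, dif_neg hx, dif_pos hy]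

end MatrixElement

/-! ### The weighted Cauchy–Schwarz estimate in the eigenbasis. -/

section Commutator

/-- The two sides differ by a perfect square. The parameter l stays free so that such estimates can
be summed before optimising. -/
theorem abs_sub_mul_le {p q x y l : ℝ} (hp : 0 ≤ p) (hq : 0 ≤ q) (hl : 0 < l) :
    |p - q| * (x * y) ≤ l * (arithWeight p q * y ^ 2) + (p + q) * x ^ 2 / (2 * l) := by
  unfold arithWeight
  rcases eq_or_lt_of_le (add_nonneg hp hq) with h | h
  · have hp0 : p = 0 := by linarith
    have hq0 : q = 0 := by linarith
    simp [hp0, hq0]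
  · rw [← sq_abs (p - q)]
    generalize |p - q| = t
    have e : l * (t ^ 2 / (2 * (p + q)) * y ^ 2) + (p + q) * x ^ 2 / (2 * l) - t * (x * y) =
        (l * t * y - (p + q) * x) ^ 2 / (2 * l * (p + q)) := by
      field_simp; ring
    have : 0 ≤ (l * t * y - (p + q) * x) ^ 2 / (2 * l * (p + q)) := by positivity
    linarith

variable {E : Type} [NormedAddCommGroup E] [InnerProductSpace ℂ E] [CompleteSpace E]

/-- The contribution of one pair of eigenvectors. If p, q > 0, hermiticity makes the two products
complex conjugate, so the imaginary parts combine with coefficient g - h. If one eigenvalue is 0,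
its vector may lie outside the domains and hermiticity is not available, but then its coefficient
vanishes too. -/
theorem im_mul_inner_pair_le {x y : E} {A : E →ₗ.[ℂ] E} (hA : IsSelfAdjoint A)
    {p q g h l : ℝ} (hp : 0 ≤ p) (hq : 0 ≤ q) (hl : 0 < l) (hg : 0 < p ∨ g = 0)
    (hh : 0 < q ∨ h = 0) (hx : 0 < p → x ∈ A.domain) (hy : 0 < q → y ∈ A.domain)
    (hgh : |g - h| ≤ |p - q|) {u v a b : E} (huv : 0 < p → 0 < q → ⟪u, y⟫_ℂ = ⟪x, v⟫_ℂ)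
    (ha : ∀ hx : x ∈ A.domain, a = A ⟨x, hx⟩) (hb : ∀ hy : y ∈ A.domain, b = A ⟨y, hy⟩) :
    |g * (⟪u, y⟫_ℂ * ⟪y, a⟫_ℂ).im + h * (⟪v, x⟫_ℂ * ⟪x, b⟫_ℂ).im| ≤
      l * (arithWeight p q * ‖matrixElement A x y‖ ^ 2) +
        (p * ‖⟪u, y⟫_ℂ‖ ^ 2 + q * ‖⟪v, x⟫_ℂ‖ ^ 2) / (2 * l) := by
  have h1 : 0 < p → ‖⟪y, a⟫_ℂ‖ = ‖matrixElement A x y‖ := fun h => by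
    rw [matrixElement_of_left (hx h), ha (hx h), norm_inner_symm]
  have h2 : 0 < q → ‖⟪x, b⟫_ℂ‖ = ‖matrixElement A x y‖ := fun h => by
    rw [matrixElement_of_right hA (hy h), hb (hy h)]
  have him : ∀ z w : ℂ, |(z * w).im| ≤ ‖z‖ * ‖w‖ := fun z w => by
    rw [← norm_mul]; exact Complex.abs_im_le_norm _
  rcases eq_or_lt_of_le hp with hp0 | hp0 <;> rcases eq_or_lt_of_le hq with hq0 | hq0
  · have hg0 : g = 0 := hg.resolve_left (by rw [← hp0]; exact lt_irrefl _)
    have hh0 : h = 0 := hh.resolve_left (by rw [← hq0]; exact lt_irrefl _)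
    simp [← hp0, ← hq0, hg0, hh0, arithWeight]
  · have hg0 : g = 0 := hg.resolve_left (by rw [← hp0]; exact lt_irrefl _)
    have := abs_sub_mul_le (x := ‖⟪v, x⟫_ℂ‖) (y := ‖matrixElement A x y‖) hp hq hl
    rw [hg0, zero_mul, zero_add, abs_mul]
    rw [hg0, zero_sub, abs_neg] at hgh
    have h3 := him ⟪v, x⟫_ℂ ⟪x, b⟫_ℂ
    rw [h2 hq0] at h3
    have h4 := mul_le_mul hgh h3 (abs_nonneg _) (abs_nonneg _)
    refine (h4.trans this).trans (le_of_eq ?_)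
    rw [← hp0]; ring
  · have hh0 : h = 0 := hh.resolve_left (by rw [← hq0]; exact lt_irrefl _)
    have := abs_sub_mul_le (x := ‖⟪u, y⟫_ℂ‖) (y := ‖matrixElement A x y‖) hp hq hl
    rw [hh0, zero_mul, add_zero, abs_mul]
    rw [hh0, sub_zero] at hgh
    have h3 := him ⟪u, y⟫_ℂ ⟪y, a⟫_ℂ
    rw [h1 hp0] at h3
    have h4 := mul_le_mul hgh h3 (abs_nonneg _) (abs_nonneg _)
    refine (h4.trans this).trans (le_of_eq ?_)
    rw [← hq0]; ring
  · have e1 : ⟪v, x⟫_ℂ = starRingEnd ℂ ⟪u, y⟫_ℂ := by rw [huv hp0 hq0, inner_conj_symm]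
    have e2 : ⟪x, b⟫_ℂ = starRingEnd ℂ ⟪y, a⟫_ℂ := by
      rw [inner_conj_symm, ha (hx hp0), hb (hy hq0)]
      exact (inner_apply_eq_of_isSelfAdjoint hA ⟨x, hx hp0⟩ ⟨y, hy hq0⟩).symm
    have e3 : (⟪v, x⟫_ℂ * ⟪x, b⟫_ℂ).im = -(⟪u, y⟫_ℂ * ⟪y, a⟫_ℂ).im := by
      rw [e1, e2, ← map_mul, Complex.conj_im]
    have e4 : ‖⟪v, x⟫_ℂ‖ = ‖⟪u, y⟫_ℂ‖ := by rw [e1, RCLike.norm_conj]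
    have := abs_sub_mul_le (x := ‖⟪u, y⟫_ℂ‖) (y := ‖matrixElement A x y‖) hp hq hl
    rw [e3, e4, mul_neg, ← sub_eq_add_neg, ← sub_mul, abs_mul]
    have h3 := him ⟪u, y⟫_ℂ ⟪y, a⟫_ℂ
    rw [h1 hp0] at h3
    have h4 := mul_le_mul hgh h3 (abs_nonneg _) (abs_nonneg _)
    refine (h4.trans this).trans (le_of_eq ?_)
    ring

/-- Parseval expands each ⟨u i, a i⟩ over the eigenbasis. On a finite square J × J containing the
support of g, the terms (i, j) and (j, i) are paired and estimated; `hS` bounds the matrix elements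
of A, while Bessel's inequality and `hK` bound those of u. Then J exhausts the index set. -/
theorem abs_sum_im_inner_le {ι : Type} {e : HilbertBasis ι ℂ E} {A : E →ₗ.[ℂ] E}
    (hA : IsSelfAdjoint A) {p g : ι → ℝ} (hp : ∀ i, 0 ≤ p i)
    (hdom : ∀ i, 0 < p i → e i ∈ A.domain) (hg : ∀ i, 0 < p i ∨ g i = 0)
    (hgp : ∀ i j, |g i - g j| ≤ |p i - p j|) {F : Finset ι} (hF : ∀ i, i ∉ F → g i = 0)
    {u a : ι → E} (ha : ∀ i (h : e i ∈ A.domain), a i = A ⟨e i, h⟩)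
    (hu : ∀ i j, 0 < p i → 0 < p j → ⟪u i, e j⟫_ℂ = ⟪e i, u j⟫_ℂ) {l S K : ℝ} (hl : 0 < l)
    (hS : ∀ J : Finset ι, ∑ i ∈ J, ∑ j ∈ J,
      arithWeight (p i) (p j) * ‖matrixElement A (e i) (e j)‖ ^ 2 ≤ S)
    (hK : ∀ J : Finset ι, F ⊆ J → ∑ i ∈ J, p i * ‖u i‖ ^ 2 ≤ K) :
    |∑ i ∈ F, g i * (⟪u i, a i⟫_ℂ).im| ≤ l / 2 * S + K / (2 * l) := by
  classical
  let D : ι → ι → ℝ := fun i j => g i * (⟪u i, e j⟫_ℂ * ⟪e j, a i⟫_ℂ).im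
  let W : ι → ι → ℝ := fun i j => arithWeight (p i) (p j) * ‖matrixElement A (e i) (e j)‖ ^ 2
  have hlim : Tendsto (fun J : Finset ι => |∑ i ∈ F, ∑ j ∈ J, D i j|) atTop
      (𝓝 |∑ i ∈ F, g i * (⟪u i, a i⟫_ℂ).im|) := by
    refine Tendsto.abs (tendsto_finsetSum _ fun i _ => ?_)
    have h := (Complex.hasSum_iff _ _).1 (e.hasSum_inner_mul_inner (u i) (a i))
    exact h.2.mul_left (g i)
  refine le_of_tendsto hlim ?_
  filter_upwards [eventually_ge_atTop F] with J hJ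
  have h1 : ∑ i ∈ F, ∑ j ∈ J, D i j = ∑ i ∈ J, ∑ j ∈ J, D i j := by
    refine Finset.sum_subset hJ fun i _ hi => Finset.sum_eq_zero fun j _ => ?_
    simp [D, hF i hi]
  have h2 : ∑ i ∈ J, ∑ j ∈ J, (D i j + D j i) = 2 * ∑ i ∈ J, ∑ j ∈ J, D i j := by
    simp only [Finset.sum_add_distrib]
    rw [Finset.sum_comm (f := fun i j => D j i), two_mul]
  have h3 : ∀ i j, |D i j + D j i| ≤ l * W i j +
      (p i * ‖⟪u i, e j⟫_ℂ‖ ^ 2 + p j * ‖⟪u j, e i⟫_ℂ‖ ^ 2) / (2 * l) := fun i j =>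
    im_mul_inner_pair_le hA (hp i) (hp j) hl (hg i) (hg j) (hdom i) (hdom j) (hgp i j)
      (hu i j) (ha i) (ha j)
  have h4 : ∑ i ∈ J, ∑ j ∈ J, p i * ‖⟪u i, e j⟫_ℂ‖ ^ 2 ≤ K := by
    refine le_trans (Finset.sum_le_sum fun i _ => ?_) (hK J hJ)
    rw [← Finset.mul_sum]
    refine mul_le_mul_of_nonneg_left ?_ (hp i)
    have := e.orthonormal.sum_inner_products_le (u i) (s := J)
    simpa only [norm_inner_symm] using this
  have h5 : |2 * ∑ i ∈ J, ∑ j ∈ J, D i j| ≤ l * S + 2 * K / (2 * l) := by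
    rw [← h2]
    calc |∑ i ∈ J, ∑ j ∈ J, (D i j + D j i)| ≤ ∑ i ∈ J, ∑ j ∈ J, |D i j + D j i| :=
          (Finset.abs_sum_le_sum_abs _ _).trans
            (Finset.sum_le_sum fun i _ => Finset.abs_sum_le_sum_abs _ _)
      _ ≤ ∑ i ∈ J, ∑ j ∈ J, (l * W i j +
          (p i * ‖⟪u i, e j⟫_ℂ‖ ^ 2 + p j * ‖⟪u j, e i⟫_ℂ‖ ^ 2) / (2 * l)) :=
          Finset.sum_le_sum fun i _ => Finset.sum_le_sum fun j _ => h3 i j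
      _ = l * ∑ i ∈ J, ∑ j ∈ J, W i j +
          2 * (∑ i ∈ J, ∑ j ∈ J, p i * ‖⟪u i, e j⟫_ℂ‖ ^ 2) / (2 * l) := by
          simp only [Finset.sum_add_distrib, ← Finset.mul_sum, ← Finset.sum_div]
          rw [Finset.sum_comm (f := fun i j => p j * ‖⟪u j, e i⟫_ℂ‖ ^ 2)]
          simp only [← Finset.mul_sum]
          ring
      _ ≤ _ := by
          have := hS J
          gcongr
  rw [h1]
  rw [abs_mul, abs_two] at h5
  have e1 : 2 * K / (2 * l) = 2 * (K / (2 * l)) := by ring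
  linarith

end Commutator

/-! ### Operator norm, numerical radius and variance of matrices. -/

section MatrixNorm

variable {d : ℕ}

theorem inner_toEuclideanCLM_left (T : Matrix (Fin d) (Fin d) ℂ) (x y : EuclideanSpace ℂ (Fin d)) :
    ⟪toEuclideanCLM (𝕜 := ℂ) T x, y⟫_ℂ = ⟪x, toEuclideanCLM (𝕜 := ℂ) Tᴴ y⟫_ℂ := by
  rw [← Matrix.star_eq_conjTranspose, map_star, ContinuousLinearMap.star_eq_adjoint,
    ContinuousLinearMap.adjoint_inner_right]

theorem opNorm_nonneg (T : Matrix (Fin d) (Fin d) ℂ) : 0 ≤ opNorm T := norm_nonneg _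

/-- The norm of a skew-Hermitian matrix is bounded by its numerical radius. -/
theorem opNorm_le_of_inner_le {T : Matrix (Fin d) (Fin d) ℂ} (hT : Tᴴ = -T) {K : ℝ} (hK : 0 ≤ K)
    (h : ∀ s : EuclideanSpace ℂ (Fin d), ‖s‖ = 1 → ‖⟪s, toEuclideanCLM (𝕜 := ℂ) T s⟫_ℂ‖ ≤ K) :
    opNorm T ≤ K := by
  set L := toEuclideanCLM (𝕜 := ℂ) T with hL
  have hs : ∀ x y, ⟪L x, y⟫_ℂ = -⟪x, L y⟫_ℂ := fun x y => by
    rw [hL, inner_toEuclideanCLM_left, hT, map_neg, _root_.neg_apply, inner_neg_right]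
  -- Multiplication by i makes the operator symmetric without changing its norm, so the norm is the
  -- supremum of the Rayleigh quotients.
  have hsym : (Complex.I • L).IsSymmetric := fun x y => by
    simp only [ContinuousLinearMap.coe_coe, _root_.smul_apply, inner_smul_left, inner_smul_right, hs,
      Complex.conj_I]
    ring
  have hn : opNorm T = ‖Complex.I • L‖ := by
    rw [norm_smul, Complex.norm_I, one_mul]; rfl
  rw [hn, ContinuousLinearMap.norm_eq_iSup_rayleighQuotient _ hsym]
  refine ciSup_le fun x => ?_
  by_cases hx : x = 0
  · simp [hx, hK]
  have hx' : ((‖x‖⁻¹ : ℝ) : ℂ) ≠ 0 := by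
    simpa using hx
  rw [← ContinuousLinearMap.rayleigh_smul _ x hx']
  set s := ((‖x‖⁻¹ : ℝ) : ℂ) • x with hs'
  have hs1 : ‖s‖ = 1 := by
    rw [hs', norm_smul, Complex.norm_real, norm_inv, norm_norm,
      inv_mul_cancel₀ (norm_ne_zero_iff.2 hx)]
  rw [ContinuousLinearMap.rayleighQuotient, hs1, one_pow, div_one,
    ContinuousLinearMap.reApplyInnerSelf_apply]
  refine (RCLike.abs_re_le_norm _).trans ?_
  rw [norm_inner_symm, _root_.smul_apply, inner_smul_right, norm_mul, Complex.norm_I, one_mul]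
  exact h s hs1

/-- With S = √L: ‖S(Sx)‖² ≤ ‖S‖² ‖Sx‖², where ‖S‖² = ‖L‖ and ‖Sx‖² = ⟨x, Lx⟩. -/
theorem norm_sq_apply_le_of_isPositive {H : Type} [NormedAddCommGroup H] [InnerProductSpace ℂ H]
    [CompleteSpace H] {L : H →L[ℂ] H} (hL : L.IsPositive) (x : H) :
    ‖L x‖ ^ 2 ≤ ‖L‖ * (⟪x, L x⟫_ℂ).re := by
  have hpos : (0 : H →L[ℂ] H) ≤ L := (ContinuousLinearMap.nonneg_iff_isPositive _).2 hL
  set S := CFC.sqrt L with hS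
  have hSS : S * S = L := CFC.sqrt_mul_sqrt_self _ hpos
  have hSp := (ContinuousLinearMap.nonneg_iff_isPositive S).1 (CFC.sqrt_nonneg _)
  have hn : ‖L‖ = ‖S‖ ^ 2 := by
    rw [sq, ← CStarRing.norm_star_mul_self, hSp.isSelfAdjoint.star_eq, hSS]
  have hLx : L x = S (S x) := by rw [← mul_apply_eq_comp, hSS]
  have hi : (⟪x, L x⟫_ℂ).re = ‖S x‖ ^ 2 := by
    rw [hLx, ← hSp.inner_left_eq_inner_right, inner_self_eq_norm_sq_to_K]
    exact_mod_cast rfl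
  rw [hi, hn, ← mul_pow, hLx]
  exact pow_le_pow_left₀ (norm_nonneg _) (S.le_opNorm _) 2

theorem norm_sq_apply_le {T : Matrix (Fin d) (Fin d) ℂ} (hT : T.PosSemidef)
    (x : EuclideanSpace ℂ (Fin d)) :
    ‖toEuclideanCLM (𝕜 := ℂ) T x‖ ^ 2 ≤ opNorm T * (⟪x, toEuclideanCLM (𝕜 := ℂ) T x⟫_ℂ).re :=
  norm_sq_apply_le_of_isPositive (L := toEuclideanCLM (𝕜 := ℂ) T)
    (Matrix.isPositive_toEuclideanLin_iff.2 hT) x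

/-- Variance bound: `Var ≤ ‖T‖ ^ 2 / 4` for `0 ≤ T`. -/
theorem norm_sub_inner_smul_sq_le {T : Matrix (Fin d) (Fin d) ℂ} (hT : T.PosSemidef)
    {s : EuclideanSpace ℂ (Fin d)} (hs : ‖s‖ = 1) :
    ‖toEuclideanCLM (𝕜 := ℂ) T s - ⟪s, toEuclideanCLM (𝕜 := ℂ) T s⟫_ℂ • s‖ ^ 2
      ≤ opNorm T ^ 2 / 4 := by
  have h1 := norm_sq_apply_le hT s
  set y := toEuclideanCLM (𝕜 := ℂ) T s
  have him : (⟪s, y⟫_ℂ).im = 0 := by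
    rw [← Complex.conj_eq_iff_im, inner_conj_symm, inner_toEuclideanCLM_left, hT.1]
  have h0 : ⟪y - ⟪s, y⟫_ℂ • s, ⟪s, y⟫_ℂ • s⟫_ℂ = 0 := by
    rw [inner_smul_right, inner_sub_left, inner_smul_left, inner_self_eq_norm_sq_to_K, hs,
      inner_conj_symm]
    simp
  have h2 := norm_add_sq_eq_norm_sq_add_norm_sq_of_inner_eq_zero _ _ h0
  rw [sub_add_cancel, norm_smul, hs, mul_one, ← sq, ← sq, ← sq] at h2
  have h3 : ‖⟪s, y⟫_ℂ‖ ^ 2 = (⟪s, y⟫_ℂ).re ^ 2 := by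
    rw [← Complex.normSq_eq_norm_sq, Complex.normSq_apply, him]; ring
  -- With m the mean of T, the variance is ‖Ts‖² - m² ≤ ‖T‖m - m², maximal at m = ‖T‖/2.
  nlinarith [sq_nonneg ((⟪s, y⟫_ℂ).re - opNorm T / 2)]

end MatrixNorm

/-! ### The commutator of the noise with the conserved quantity. -/

section Noise

variable {d : ℕ} {E : Type} [NormedAddCommGroup E] [InnerProductSpace ℂ E] [CompleteSpace E]
  {A B : Matrix (Fin d) (Fin d) ℂ}

theorem inner_leftOp_rightOp {T : Matrix (Fin d) (Fin d) ℂ} (hT : Tᴴ = T) {M : E →ₗ.[ℂ] E}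
    (hM : IsSelfAdjoint M) {x y : Composite d E} (hx : x ∈ (rightOp (d := d) M).domain)
    (hy : y ∈ (rightOp (d := d) M).domain) :
    ⟪leftOp T x, rightOp M ⟨y, hy⟩⟫_ℂ = ⟪rightOp M ⟨x, hx⟩, leftOp T y⟫_ℂ := by
  obtain ⟨h, e⟩ := commutesWith_leftOp_rightOp T M ⟨x, hx⟩
  have := inner_apply_eq_of_isSelfAdjoint (isSelfAdjoint_rightOp (d := d) hM) ⟨_, h⟩ ⟨y, hy⟩
  rw [e, inner_leftOp_left, hT] at this
  exact this.symm

theorem noiseOp_inner_apply (hB : Bᴴ = B) {M : E →ₗ.[ℂ] E} (hM : IsSelfAdjoint M)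
    (U : Composite d E ≃ₗᵢ[ℂ] Composite d E) (x y : (noiseOp B M U).domain) :
    ⟪noiseOp B M U x, (y : Composite d E)⟫_ℂ = ⟪(x : Composite d E), noiseOp B M U y⟫_ℂ := by
  have h1 : ∀ w z : Composite d E, ⟪U.symm w, z⟫_ℂ = ⟪w, U z⟫_ℂ := fun w z => by
    rw [← U.inner_map_map, U.apply_symm_apply]
  have h2 : ∀ w z : Composite d E, ⟪z, U.symm w⟫_ℂ = ⟪U z, w⟫_ℂ := fun w z => by
    rw [← U.inner_map_map, U.apply_symm_apply]
  rw [noiseOp_apply, noiseOp_apply, inner_sub_left, inner_sub_right, inner_leftOp_left, hB, h1, h2]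
  congr 1
  exact inner_apply_eq_of_isSelfAdjoint (isSelfAdjoint_rightOp (d := d) hM) ⟨U x.1, x.2⟩
    ⟨U y.1, y.2⟩

theorem inner_rightOp_totalOp (hA : Aᴴ = A) {M AE : E →ₗ.[ℂ] E} (hM : IsSelfAdjoint M)
    (hAE : IsSelfAdjoint AE) (hc : StronglyCommute M AE) {x y : Composite d E}
    (hxM : x ∈ (rightOp (d := d) M).domain) (hyM : y ∈ (rightOp (d := d) M).domain)
    (hxA : x ∈ (totalOp A AE).domain) (hyA : y ∈ (totalOp A AE).domain) :
    ⟪rightOp M ⟨x, hxM⟩, totalOp A AE ⟨y, hyA⟩⟫_ℂ =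
      ⟪totalOp A AE ⟨x, hxA⟩, rightOp M ⟨y, hyM⟩⟫_ℂ := by
  rw [totalOp_apply, totalOp_apply, inner_add_left, inner_add_right,
    inner_leftOp_rightOp hA hM hxM hyM]
  congr 1
  simp only [PiLp.inner_apply]
  exact Finset.sum_congr rfl fun a _ => hc.inner_apply hM hAE (hxM a) (hxA a) (hyM a) (hyA a)

/-- The commutator of the noise operator with the total conserved quantity, as a form. -/
theorem inner_noiseOp_totalOp (hA : Aᴴ = A) (hB : Bᴴ = B) (𝓘 : Implementation A E)
    {x y : Composite d E} (hxN : x ∈ (noiseOp B 𝓘.ME 𝓘.U).domain)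
    (hyN : y ∈ (noiseOp B 𝓘.ME 𝓘.U).domain) (hxA : x ∈ (totalOp A 𝓘.AE).domain)
    (hyA : y ∈ (totalOp A 𝓘.AE).domain) :
    ⟪noiseOp B 𝓘.ME 𝓘.U ⟨x, hxN⟩, totalOp A 𝓘.AE ⟨y, hyA⟩⟫_ℂ -
      ⟪totalOp A 𝓘.AE ⟨x, hxA⟩, noiseOp B 𝓘.ME 𝓘.U ⟨y, hyN⟩⟫_ℂ =
      ⟪x, leftOp (B * A - A * B) y⟫_ℂ := by
  set U := 𝓘.U
  have h1 : ∀ w z : Composite d E, ⟪U.symm w, z⟫_ℂ = ⟪w, U z⟫_ℂ := fun w z => by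
    rw [← U.inner_map_map, U.apply_symm_apply]
  have h2 : ∀ w z : Composite d E, ⟪z, U.symm w⟫_ℂ = ⟪U z, w⟫_ℂ := fun w z => by
    rw [← U.inner_map_map, U.apply_symm_apply]
  obtain ⟨hUx, eUx⟩ := 𝓘.conservation ⟨x, hxA⟩
  obtain ⟨hUy, eUy⟩ := 𝓘.conservation ⟨y, hyA⟩
  -- Conservation moves U past the total quantity, and 1 ⊗ M commutes with that quantity, so the
  -- meter part of the noise cancels and only [B, A] survives.
  have h3 := inner_rightOp_totalOp hA 𝓘.ME_selfAdjoint 𝓘.AE_selfAdjoint 𝓘.ME_commute hxN hyN hUx hUy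
  rw [eUx, eUy] at h3
  have h4 := inner_leftOp_rightOp hB 𝓘.AE_selfAdjoint hxA hyA
  rw [noiseOp_apply, noiseOp_apply, inner_sub_left, inner_sub_right, h1, h2]
  have h5 : ⟪rightOp (d := d) 𝓘.ME ⟨U x, hxN⟩, U (totalOp A 𝓘.AE ⟨y, hyA⟩)⟫_ℂ =
      ⟪U (totalOp A 𝓘.AE ⟨x, hxA⟩), rightOp (d := d) 𝓘.ME ⟨U y, hyN⟩⟫_ℂ := h3
  rw [h5, sub_sub_sub_cancel_right, totalOp_apply, totalOp_apply, inner_add_left, inner_add_right]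
  simp only at h4 ⊢
  rw [h4]
  simp only [inner_leftOp_left, hA, hB, leftOp_sub, leftOp_mul, inner_sub_right]
  ring

end Noise

/-! ### The uncertainty relation for a fixed system state. -/

section LowerBound

/-- Truncation of a probability distribution at a level `δ` at which little mass is lost. -/
theorem exists_truncation {ι : Type} {p : ι → ℝ} (hp : ∀ i, 0 ≤ p i) (h1 : HasSum p 1) {η : ℝ}
    (hη : 0 < η) :
    ∃ (g : ι → ℝ) (F : Finset ι), (∀ i, 0 ≤ g i) ∧ (∀ i, g i ≤ p i) ∧ (∀ i, 0 < p i ∨ g i = 0) ∧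
      (∀ i j, |g i - g j| ≤ |p i - p j|) ∧ (∀ i, i ∉ F → g i = 0) ∧ 1 - η ≤ ∑ i ∈ F, g i := by
  classical
  obtain ⟨F₀, hF₀⟩ := (h1.eventually (lt_mem_nhds (show 1 - η / 2 < 1 by linarith))).exists
  -- The weights are (p - δ)⁺. Lowering p by δ loses at most η/2 on F₀, which misses at most η/2 of
  -- the mass. A sharp cutoff of p would break |g i - g j| ≤ |p i - p j|, whereas t ↦ (t - δ)⁺ is
  -- 1-Lipschitz.
  set δ : ℝ := η / (2 * (F₀.card + 1)) with hδ
  have hδ0 : 0 < δ := by positivity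
  have hfin : {i | δ < p i}.Finite := by
    have := h1.summable.tendsto_cofinite_zero.eventually (gt_mem_nhds hδ0)
    refine Set.Finite.subset this fun i (hi : δ < p i) => ?_
    exact not_lt.2 hi.le
  have hoff : ∀ i, i ∉ hfin.toFinset → max (p i - δ) 0 = 0 := fun i hi => by
    rw [Set.Finite.mem_toFinset, Set.mem_ofPred_eq, not_lt] at hi
    exact max_eq_right (by linarith)
  refine ⟨fun i => max (p i - δ) 0, hfin.toFinset, fun i => le_max_right _ _,
    fun i => max_le (by linarith) (hp i), fun i => ?_, fun i j => ?_, hoff, ?_⟩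
  · rcases eq_or_lt_of_le (hp i) with h | h
    · right; exact max_eq_right (by linarith)
    · exact Or.inl h
  · refine (abs_max_sub_max_le_abs _ _ _).trans (le_of_eq ?_)
    congr 1; ring
  · have h2 : ∑ i ∈ F₀, max (p i - δ) 0 ≤ ∑ i ∈ hfin.toFinset, max (p i - δ) 0 := by
      rw [Finset.sum_subset (Finset.subset_union_right (s₁ := F₀) (s₂ := hfin.toFinset))
        fun i _ hi => hoff i hi]
      exact Finset.sum_le_sum_of_subset_of_nonneg Finset.subset_union_left
        fun i _ _ => le_max_right _ _
    have h3 : ∑ i ∈ F₀, (p i - δ) ≤ ∑ i ∈ F₀, max (p i - δ) 0 :=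
      Finset.sum_le_sum fun i _ => le_max_left _ _
    rw [Finset.sum_sub_distrib, Finset.sum_const, nsmul_eq_mul] at h3
    have h4 : F₀.card * δ ≤ η / 2 := by
      rw [hδ, mul_div_assoc', div_le_div_iff₀ (by positivity) (by positivity)]
      nlinarith
    linarith

variable {d : ℕ} {E : Type} [NormedAddCommGroup E] [InnerProductSpace ℂ E] [CompleteSpace E]
  {A B : Matrix (Fin d) (Fin d) ℂ}

/-- Uncertainty relation between the noise and the skew information of the conserved quantity, with
a free parameter `l`. -/
theorem norm_inner_commutator_le (hA : Aᴴ = A) (hB : Bᴴ = B) (𝓘 : Implementation A E)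
    {s : EuclideanSpace ℂ (Fin d)} (hs : ‖s‖ = 1) {l V S K : ℝ} (hl : 0 < l)
    (hV : ‖toEuclideanCLM (𝕜 := ℂ) A s - ⟪s, toEuclideanCLM (𝕜 := ℂ) A s⟫_ℂ • s‖ ^ 2 ≤ V)
    (hdom : ∀ i, 0 < 𝓘.ρE.eigenvalue i → 𝓘.ρE.eigenbasis i ∈ 𝓘.AE.domain)
    (hS : ∀ J : Finset 𝓘.ρE.Idx, ∑ i ∈ J, ∑ j ∈ J,
      arithWeight (𝓘.ρE.eigenvalue i) (𝓘.ρE.eigenvalue j) *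
        ‖matrixElement 𝓘.AE (𝓘.ρE.eigenbasis i) (𝓘.ρE.eigenbasis j)‖ ^ 2 ≤ S)
    {n : 𝓘.ρE.Idx → Composite d E}
    (hN : ∀ i, 0 < 𝓘.ρE.eigenvalue i →
      ∃ h : tmul s (𝓘.ρE.eigenbasis i) ∈ (noiseOp B 𝓘.ME 𝓘.U).domain,
        n i = noiseOp B 𝓘.ME 𝓘.U ⟨_, h⟩)
    (hK : ∀ J : Finset 𝓘.ρE.Idx, ∑ i ∈ J, 𝓘.ρE.eigenvalue i * ‖n i‖ ^ 2 ≤ K) :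
    ‖⟪s, toEuclideanCLM (𝕜 := ℂ) (B * A - A * B) s⟫_ℂ‖ ≤ l * (V + S) + K / l := by
  classical
  obtain ⟨hp0, hp1, -⟩ := 𝓘.ρE.eigen_spec
  set p := 𝓘.ρE.eigenvalue
  set e := 𝓘.ρE.eigenbasis
  set c := ⟪s, toEuclideanCLM (𝕜 := ℂ) (B * A - A * B) s⟫_ℂ with hc
  set m := ⟪s, toEuclideanCLM (𝕜 := ℂ) A s⟫_ℂ with hm
  set r := toEuclideanCLM (𝕜 := ℂ) A s - m • s with hr
  have hss : ⟪s, s⟫_ℂ = 1 := by rw [inner_self_eq_norm_sq_to_K, hs]; simp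
  have hmc : starRingEnd ℂ m = m := by rw [hm, inner_conj_symm, inner_toEuclideanCLM_left, hA]
  have hsr : ⟪s, r⟫_ℂ = 0 := by rw [hr, inner_sub_right, inner_smul_right, hss, ← hm]; ring
  let a : 𝓘.ρE.Idx → E := fun i => if h : e i ∈ 𝓘.AE.domain then 𝓘.AE ⟨e i, h⟩ else 0
  have ha : ∀ i (h : e i ∈ 𝓘.AE.domain), a i = 𝓘.AE ⟨e i, h⟩ := fun i h => dif_pos h
  -- The noise vector splits orthogonally as n i = s ⊗ u i + v i. Up to a real multiple of s ⊗ e i,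
  -- the total quantity sends s ⊗ e i to r ⊗ e i + s ⊗ a i with r ⊥ s, so v pairs only with r and u
  -- only with a.
  let u : 𝓘.ρE.Idx → E := fun i => contract s (n i)
  let v : 𝓘.ρE.Idx → Composite d E := fun i => n i - tmul s (u i)
  have huv : ∀ i, ‖v i‖ ^ 2 + ‖u i‖ ^ 2 = ‖n i‖ ^ 2 := fun i => norm_sub_tmul_contract_sq hs (n i)
  have hee : ∀ i, ⟪e i, e i⟫_ℂ = 1 := fun i => by
    rw [inner_self_eq_norm_sq_to_K, e.orthonormal.1 i]; simp
  have hu : ∀ i j, 0 < p i → 0 < p j → ⟪u i, e j⟫_ℂ = ⟪e i, u j⟫_ℂ := fun i j hi hj => by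
    obtain ⟨h1, e1⟩ := hN i hi
    obtain ⟨h2, e2⟩ := hN j hj
    rw [← inner_tmul_right, ← inner_tmul_left, e1, e2]
    exact noiseOp_inner_apply hB 𝓘.ME_selfAdjoint 𝓘.U ⟨_, h1⟩ ⟨_, h2⟩
  -- The expectation c is purely imaginary, twice the imaginary part of ⟨n i, L(s ⊗ e i)⟩ times i,
  -- and is the same for every i of positive weight.
  have hkey : ∀ i, 0 < p i → ‖c‖ = 2 * |(c.im / 2)| ∧
      c.im / 2 = (⟪v i, tmul r (e i)⟫_ℂ).im + (⟪u i, a i⟫_ℂ).im := by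
    intro i hi
    obtain ⟨h1, e1⟩ := hN i hi
    have hx : tmul s (e i) ∈ (totalOp A 𝓘.AE).domain := tmul_mem_rightOp_domain (hdom i hi)
    have h2 := inner_noiseOp_totalOp hA hB 𝓘 h1 h1 hx hx
    rw [← e1, leftOp_tmul, inner_tmul_tmul, hee, mul_one, ← hc,
      ← inner_conj_symm (totalOp A 𝓘.AE ⟨_, hx⟩) (n i)] at h2
    have h3 : totalOp A 𝓘.AE ⟨tmul s (e i), hx⟩ =
        m • tmul s (e i) + tmul r (e i) + tmul s (a i) := by
      rw [totalOp_apply, leftOp_tmul, ha i (hdom i hi)]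
      congr 1
      · rw [hr, sub_tmul, smul_tmul]; abel
      · exact rightOp_tmul (hdom i hi) hx
    have h4 : (⟪n i, tmul s (e i)⟫_ℂ).im = 0 := by
      rw [← Complex.conj_eq_iff_im, inner_conj_symm, e1]
      exact (noiseOp_inner_apply hB 𝓘.ME_selfAdjoint 𝓘.U ⟨_, h1⟩ ⟨_, h1⟩).symm
    have h5 : ⟪n i, tmul r (e i)⟫_ℂ = ⟪v i, tmul r (e i)⟫_ℂ := by
      simp only [v, inner_sub_left, inner_tmul_tmul, hsr]
      ring
    have h6 : (⟪n i, totalOp A 𝓘.AE ⟨_, hx⟩⟫_ℂ).im =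
        (⟪v i, tmul r (e i)⟫_ℂ).im + (⟪u i, a i⟫_ℂ).im := by
      rw [h3, inner_add_right, inner_add_right, inner_smul_right, inner_tmul_right s (n i) (a i), h5,
        Complex.add_im, Complex.add_im, Complex.mul_im, h4, Complex.conj_eq_iff_im.1 hmc]
      ring
    rw [Complex.sub_conj] at h2
    have h7 : c.im = 2 * (⟪n i, totalOp A 𝓘.AE ⟨_, hx⟩⟫_ℂ).im := by
      rw [← h2]; simp
    refine ⟨?_, by rw [h7, ← h6]; ring⟩
    rw [← h2]
    simp only [norm_mul, Complex.norm_I, mul_one, Complex.norm_real, Real.norm_eq_abs,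
      Complex.mul_im, Complex.ofReal_im, Complex.I_re, Complex.I_im, mul_zero, Complex.ofReal_re,
      abs_div, abs_mul, abs_two, add_zero]
    ring
  obtain ⟨i₀, hi₀⟩ : ∃ i, 0 < p i := by
    by_contra! h
    have : p = fun _ => 0 := funext fun i => le_antisymm (h i) (hp0 i)
    rw [this] at hp1
    exact zero_ne_one (hasSum_zero.unique hp1)
  rw [(hkey i₀ hi₀).1]
  set κ := c.im / 2
  suffices h : |κ| ≤ l / 2 * (V + S) + K / (2 * l) by
    have e1 : K / (2 * l) = K / l / 2 := by field_simp
    rw [e1] at h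
    linarith
  refine le_of_forall_pos_le_add fun η' hη' => ?_
  -- The mass lost by truncation multiplies |κ|; this choice keeps the total loss below η'.
  obtain ⟨g, F, hg0, hgp, hg, hgd, hgF, hgs⟩ := exists_truncation hp0 hp1
    (show 0 < η' / (|κ| + 1) by positivity)
  -- The components v i over F take their share of the error K; only the remainder is available for
  -- u.
  have hcore := abs_sum_im_inner_le (K := K - ∑ i ∈ F, p i * ‖v i‖ ^ 2) 𝓘.AE_selfAdjoint hp0 hdom
    hg hgd hgF ha hu hl hS fun J hJ => by
      have h1 := hK J
      have h2 : ∑ i ∈ F, p i * ‖v i‖ ^ 2 ≤ ∑ i ∈ J, p i * ‖v i‖ ^ 2 :=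
        Finset.sum_le_sum_of_subset_of_nonneg hJ fun i _ _ => mul_nonneg (hp0 i) (sq_nonneg _)
      have h3 : ∑ i ∈ J, p i * ‖n i‖ ^ 2 =
          ∑ i ∈ J, p i * ‖v i‖ ^ 2 + ∑ i ∈ J, p i * ‖u i‖ ^ 2 := by
        rw [← Finset.sum_add_distrib]
        exact Finset.sum_congr rfl fun i _ => by rw [← huv]; ring
      linarith
  have hmain : κ * ∑ i ∈ F, g i = ∑ i ∈ F, g i * (⟪v i, tmul r (e i)⟫_ℂ).im +
      ∑ i ∈ F, g i * (⟪u i, a i⟫_ℂ).im := by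
    rw [← Finset.sum_add_distrib, Finset.mul_sum]
    refine Finset.sum_congr rfl fun i _ => ?_
    rcases hg i with h | h
    · rw [(hkey i h).2]; ring
    · simp [h]
  have hr2 : |∑ i ∈ F, g i * (⟪v i, tmul r (e i)⟫_ℂ).im| ≤
      l / 2 * V + (∑ i ∈ F, p i * ‖v i‖ ^ 2) / (2 * l) := by
    have h1 : ∀ i ∈ F, |g i * (⟪v i, tmul r (e i)⟫_ℂ).im| ≤
        p i * (l / 2 * V) + p i * ‖v i‖ ^ 2 / (2 * l) := fun i _ => by
      have h2 : |(⟪v i, tmul r (e i)⟫_ℂ).im| ≤ ‖v i‖ * ‖r‖ := by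
        refine (Complex.abs_im_le_norm _).trans ((norm_inner_le_norm _ _).trans (le_of_eq ?_))
        rw [norm_tmul, e.orthonormal.1 i, mul_one]
      have h3 : ‖v i‖ * ‖r‖ ≤ l / 2 * ‖r‖ ^ 2 + ‖v i‖ ^ 2 / (2 * l) := by
        have e1 : l / 2 * ‖r‖ ^ 2 + ‖v i‖ ^ 2 / (2 * l) - ‖v i‖ * ‖r‖ =
            (l * ‖r‖ - ‖v i‖) ^ 2 / (2 * l) := by field_simp; ring
        have : 0 ≤ (l * ‖r‖ - ‖v i‖) ^ 2 / (2 * l) := by positivity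
        linarith
      have h4 : l / 2 * ‖r‖ ^ 2 ≤ l / 2 * V := mul_le_mul_of_nonneg_left hV (by positivity)
      rw [abs_mul, abs_of_nonneg (hg0 i)]
      calc g i * |(⟪v i, tmul r (e i)⟫_ℂ).im| ≤ p i * (l / 2 * V + ‖v i‖ ^ 2 / (2 * l)) :=
            mul_le_mul (hgp i) (by linarith) (abs_nonneg _) (hp0 i)
        _ = _ := by ring
    refine (Finset.abs_sum_le_sum_abs _ _).trans ((Finset.sum_le_sum h1).trans ?_)
    rw [Finset.sum_add_distrib, ← Finset.sum_mul, ← Finset.sum_div]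
    have h5 : ∑ i ∈ F, p i ≤ 1 := sum_le_hasSum F (fun i _ => hp0 i) hp1
    have h6 : 0 ≤ V := (sq_nonneg _).trans hV
    have h7 := mul_le_mul_of_nonneg_right h5 (show 0 ≤ l / 2 * V by positivity)
    linarith
  have h1 : |κ| * ∑ i ∈ F, g i ≤ l / 2 * (V + S) + K / (2 * l) := by
    rw [← abs_of_nonneg (Finset.sum_nonneg fun i (_ : i ∈ F) => hg0 i), ← abs_mul, hmain]
    refine (abs_add_le _ _).trans ((add_le_add hr2 hcore).trans (le_of_eq ?_))
    ring
  have h2 : |κ| * (η' / (|κ| + 1)) ≤ η' := by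
    rw [mul_div_assoc', div_le_iff₀ (by positivity)]
    nlinarith [abs_nonneg κ]
  have h3 := mul_le_mul_of_nonneg_left hgs (abs_nonneg κ)
  linarith

end LowerBound

/-! ### From the uncertainty relation to a lower bound on the skew information. -/

section LowerBoundCost

variable {d : ℕ} {E : Type} [NormedAddCommGroup E] [InnerProductSpace ℂ E] [CompleteSpace E]
  {A B : Matrix (Fin d) (Fin d) ℂ}

theorem sum_sum_le_of_tsum_tsum_le {ι : Type} {w : ι → ι → ℝ} (hw : ∀ i j, 0 ≤ w i j) {T : ℝ}
    (hT : 0 ≤ T) (h : ∑' i, ∑' j, ENNReal.ofReal (w i j) ≤ ENNReal.ofReal T) (J : Finset ι) :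
    ∑ i ∈ J, ∑ j ∈ J, w i j ≤ T := by
  rw [← ENNReal.ofReal_le_ofReal_iff hT]
  refine le_trans ?_ h
  rw [ENNReal.ofReal_sum_of_nonneg fun i _ => Finset.sum_nonneg fun j _ => hw i j]
  refine le_trans (Finset.sum_le_sum fun i _ => ?_) (ENNReal.sum_le_tsum J)
  rw [ENNReal.ofReal_sum_of_nonneg fun j _ => hw i j]
  exact ENNReal.sum_le_tsum J

/-- The optimal l is K/√V, which degenerates when K or V is 0. Replacing it by (K + t)/(√V + t)
makes each term at most (K + t)(√V + t), and t → 0. -/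
theorem le_two_mul_sqrt_of_forall {c V K : ℝ} (hV : 0 ≤ V) (hK : 0 ≤ K)
    (h : ∀ l : ℝ, 0 < l → c ≤ l * V + K ^ 2 / l) : c ≤ 2 * (K * √V) := by
  have hs : √V ^ 2 = V := Real.sq_sqrt hV
  refine le_of_forall_pos_le_add fun η hη => ?_
  have hden : 0 < 2 * (K + √V + 1) := by positivity
  set t := min 1 (η / (2 * (K + √V + 1))) with ht
  have ht0 : 0 < t := lt_min one_pos (by positivity)
  have ht1 : t ≤ 1 := min_le_left _ _
  have ht2 : t * (2 * (K + √V + 1)) ≤ η := (le_div_iff₀ hden).1 (min_le_right _ _)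
  have h1 := h ((K + t) / (√V + t)) (by positivity)
  have hsv := Real.sqrt_nonneg V
  have e1 : (K + t) / (√V + t) * V ≤ (K + t) * (√V + t) := by
    rw [div_mul_eq_mul_div, div_le_iff₀ (by positivity)]
    have : V ≤ (√V + t) * (√V + t) := by nlinarith
    nlinarith [mul_le_mul_of_nonneg_left this (show 0 ≤ K + t by positivity)]
  have e2 : K ^ 2 / ((K + t) / (√V + t)) ≤ (K + t) * (√V + t) := by
    rw [div_div_eq_mul_div, div_le_iff₀ (by positivity)]
    have : K ^ 2 ≤ (K + t) * (K + t) := by nlinarith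
    nlinarith [mul_le_mul_of_nonneg_left this (show 0 ≤ √V + t by positivity)]
  nlinarith

theorem norm_inner_commutator_le_of_worstError_le (hA : A.PosSemidef) (hB : Bᴴ = B)
    (𝓘 : Implementation A E) {ε S : ℝ} (hε : 0 < ε) (hS0 : 0 ≤ S)
    (h𝓘 : 𝓘.worstError B ≤ ENNReal.ofReal ε)
    (hdom : ∀ i, 0 < 𝓘.ρE.eigenvalue i → 𝓘.ρE.eigenbasis i ∈ 𝓘.AE.domain)
    (hS : ∀ J : Finset 𝓘.ρE.Idx, ∑ i ∈ J, ∑ j ∈ J,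
      arithWeight (𝓘.ρE.eigenvalue i) (𝓘.ρE.eigenvalue j) *
        ‖matrixElement 𝓘.AE (𝓘.ρE.eigenbasis i) (𝓘.ρE.eigenbasis j)‖ ^ 2 ≤ S)
    {s : EuclideanSpace ℂ (Fin d)} (hs : ‖s‖ = 1) :
    ‖⟪s, toEuclideanCLM (𝕜 := ℂ) (B * A - A * B) s⟫_ℂ‖ ≤ 2 * (ε * √(opNorm A ^ 2 / 4 + S)) := by
  classical
  obtain ⟨hp0, -, -⟩ := 𝓘.ρE.eigen_spec
  obtain ⟨k, hk1, -, z, hz, hks⟩ := pureState_eigen s hs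
  set t := (pureState s hs).eigenbasis k with ht
  have ht1 : ‖t‖ = 1 := (pureState s hs).eigenbasis.orthonormal.1 k
  -- The error is evaluated at the eigenvector t, which is s up to a phase; expectations do not see
  -- the phase.
  have hst : ⟪s, toEuclideanCLM (𝕜 := ℂ) (B * A - A * B) s⟫_ℂ =
      ⟪t, toEuclideanCLM (𝕜 := ℂ) (B * A - A * B) t⟫_ℂ := by
    rw [hks, map_smul, inner_smul_left, inner_smul_right, ← mul_assoc, mul_comm _ z,
      Complex.mul_conj, Complex.normSq_eq_norm_sq, hz, one_pow, Complex.ofReal_one, one_mul]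
  have h1 : 𝓘.sqError B (pureState s hs) ≤ ENNReal.ofReal (ε ^ 2) := by
    have h2 : 𝓘.sqError B (pureState s hs) ^ (1 / 2 : ℝ) ≤ ENNReal.ofReal ε :=
      (le_iSup (fun ρ => 𝓘.sqError B ρ ^ (1 / 2 : ℝ)) (pureState s hs)).trans h𝓘
    have h3 := ENNReal.rpow_le_rpow h2 (show (0 : ℝ) ≤ 2 by norm_num)
    rw [← ENNReal.rpow_mul, ENNReal.ofReal_rpow_of_pos hε] at h3
    norm_num at h3
    exact h3
  have h2 : ∑' i, ENNReal.ofReal (𝓘.ρE.eigenvalue i) *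
      (if h : tmul t (𝓘.ρE.eigenbasis i) ∈ (noiseOp B 𝓘.ME 𝓘.U).domain then
        ENNReal.ofReal (‖noiseOp B 𝓘.ME 𝓘.U ⟨_, h⟩‖ ^ 2) else ⊤) ≤ ENNReal.ofReal (ε ^ 2) := by
    refine le_trans ?_ h1
    rw [Implementation.sqError]
    refine le_trans (le_of_eq ?_) (ENNReal.le_tsum k)
    rw [hk1]
    simp only [one_mul]
    rfl
  have h3 : ∀ i, 0 < 𝓘.ρE.eigenvalue i →
      tmul t (𝓘.ρE.eigenbasis i) ∈ (noiseOp B 𝓘.ME 𝓘.U).domain := by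
    intro i hi
    by_contra hn
    have h4 := (ENNReal.le_tsum i).trans h2
    rw [dif_neg hn, ENNReal.mul_top (ENNReal.ofReal_pos.2 hi).ne'] at h4
    exact ENNReal.ofReal_ne_top (top_le_iff.1 h4)
  let n : 𝓘.ρE.Idx → Composite d E := fun i =>
    if h : tmul t (𝓘.ρE.eigenbasis i) ∈ (noiseOp B 𝓘.ME 𝓘.U).domain then
      noiseOp B 𝓘.ME 𝓘.U ⟨_, h⟩ else 0
  have hK : ∀ J : Finset 𝓘.ρE.Idx, ∑ i ∈ J, 𝓘.ρE.eigenvalue i * ‖n i‖ ^ 2 ≤ ε ^ 2 := by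
    intro J
    rw [← ENNReal.ofReal_le_ofReal_iff (by positivity)]
    refine le_trans ?_ h2
    rw [ENNReal.ofReal_sum_of_nonneg fun i _ => mul_nonneg (hp0 i) (sq_nonneg _)]
    refine le_trans (Finset.sum_le_sum fun i _ => ?_) (ENNReal.sum_le_tsum J)
    rw [ENNReal.ofReal_mul (hp0 i)]
    refine mul_le_mul_right ?_ _
    by_cases h : tmul t (𝓘.ρE.eigenbasis i) ∈ (noiseOp B 𝓘.ME 𝓘.U).domain
    · simp only [n, dif_pos h, le_refl]
    · simp only [dif_neg h, le_top]
  rw [hst]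
  refine le_two_mul_sqrt_of_forall (by positivity) hε.le fun l hl => ?_
  exact norm_inner_commutator_le hA.1 hB 𝓘 ht1 hl (norm_sub_inner_smul_sq_le hA ht1) hdom hS
    (fun i hi => ⟨h3 i hi, dif_pos (h3 i hi)⟩) hK

theorem ofReal_sq_le_skewInfo (hA : A.PosSemidef) (hB : Bᴴ = B) {f : ℝ → ℝ}
    (hf : IsStandardMonotone f) (𝓘 : Implementation A E) {ε : ℝ} (hε : 0 < ε)
    (h𝓘 : 𝓘.worstError B ≤ ENNReal.ofReal ε)
    (hL : 0 ≤ √(f 0 / 2) * opNorm (A * B - B * A) / ε - opNorm A / 2) :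
    ENNReal.ofReal ((√(f 0 / 2) * opNorm (A * B - B * A) / ε - opNorm A / 2) ^ 2) ≤
      skewInfo f 𝓘.ρE 𝓘.AE := by
  obtain ⟨hp0, -, -⟩ := 𝓘.ρE.eigen_spec
  by_cases htop : skewInfo f 𝓘.ρE 𝓘.AE = ⊤
  · rw [htop]; exact le_top
  set T := (skewInfo f 𝓘.ρE 𝓘.AE).toReal with hT
  have hT0 : 0 ≤ T := ENNReal.toReal_nonneg
  have hTe : skewInfo f 𝓘.ρE 𝓘.AE = ENNReal.ofReal T := (ENNReal.ofReal_toReal htop).symm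
  have hdom : ∀ i, 0 < 𝓘.ρE.eigenvalue i → 𝓘.ρE.eigenbasis i ∈ 𝓘.AE.domain := by
    by_contra h
    exact htop (by rw [skewInfo, if_neg h])
  rw [hTe]
  refine ENNReal.ofReal_le_ofReal ?_
  have ha := opNorm_nonneg A
  have hf0 := hf.zero_nonneg
  have hf1 := hf.zero_le_half
  -- If f(0) = 0 the bound is -‖A‖/2, and its nonnegativity forces ‖A‖ = 0.
  rcases eq_or_lt_of_le hf0 with h0 | h0
  · rw [← h0] at hL ⊢
    simp only [zero_div, Real.sqrt_zero, zero_mul, zero_sub] at hL ⊢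
    have : opNorm A = 0 := by linarith
    rw [this]; simpa using hT0
  have hw0 : ∀ p q : ℝ, 0 ≤ p → 0 ≤ q → 0 ≤ skewWeight f p q := fun p q hp hq =>
    (mul_nonneg (by positivity) (arithWeight_nonneg hp hq)).trans
      (hf.arithWeight_le_skewWeight hp hq)
  have hsum : ∀ J : Finset 𝓘.ρE.Idx, ∑ i ∈ J, ∑ j ∈ J,
      arithWeight (𝓘.ρE.eigenvalue i) (𝓘.ρE.eigenvalue j) *
        ‖matrixElement 𝓘.AE (𝓘.ρE.eigenbasis i) (𝓘.ρE.eigenbasis j)‖ ^ 2 ≤ T / (2 * f 0) := by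
    intro J
    have h1 := sum_sum_le_of_tsum_tsum_le (w := fun i j =>
      skewWeight f (𝓘.ρE.eigenvalue i) (𝓘.ρE.eigenvalue j) *
        ‖matrixElement 𝓘.AE (𝓘.ρE.eigenbasis i) (𝓘.ρE.eigenbasis j)‖ ^ 2)
      (fun i j => mul_nonneg (hw0 _ _ (hp0 i) (hp0 j)) (sq_nonneg _)) hT0
      (by rw [← hTe, skewInfo, if_pos hdom]) J
    rw [le_div_iff₀ (by positivity), mul_comm, Finset.mul_sum]
    refine le_trans (Finset.sum_le_sum fun i _ => ?_) h1
    rw [Finset.mul_sum]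
    refine Finset.sum_le_sum fun j _ => ?_
    rw [← mul_assoc]
    exact mul_le_mul_of_nonneg_right (hf.arithWeight_le_skewWeight (hp0 i) (hp0 j)) (sq_nonneg _)
  have hC : opNorm (A * B - B * A) ≤ 2 * (ε * √(opNorm A ^ 2 / 4 + T / (2 * f 0))) := by
    refine opNorm_le_of_inner_le ?_ (by positivity) fun s hs => ?_
    · rw [Matrix.conjTranspose_sub, Matrix.conjTranspose_mul, Matrix.conjTranspose_mul, hB,
        hA.1.eq, neg_sub]
    · have h1 := norm_inner_commutator_le_of_worstError_le hA hB 𝓘 hε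
        (show 0 ≤ T / (2 * f 0) by positivity) h𝓘 hdom hsum hs
      rw [← neg_sub (B * A), map_neg, _root_.neg_apply, inner_neg_right, norm_neg]
      exact h1
  have h2 : √(opNorm A ^ 2 / 4 + T / (2 * f 0)) ≤ opNorm A / 2 + √T / √(2 * f 0) := by
    rw [← Real.sqrt_div hT0]
    refine Real.sqrt_le_iff.2 ⟨by positivity, ?_⟩
    have h3 := Real.sq_sqrt (show 0 ≤ T / (2 * f 0) by positivity)
    nlinarith [mul_nonneg ha (Real.sqrt_nonneg (T / (2 * f 0)))]
  -- Multiplying by √(2 f(0)) restores √T exactly, and √(2 f(0)) ≤ 1 keeps the other term below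
  -- ‖A‖/2.
  have h4 : √(f 0 / 2) * 2 = √(2 * f 0) := by
    rw [show 2 * f 0 = f 0 / 2 * 2 ^ 2 by ring, Real.sqrt_mul (by positivity),
      Real.sqrt_sq zero_le_two]
  have hpos : 0 < √(2 * f 0) := Real.sqrt_pos.2 (by positivity)
  have h5 : √(2 * f 0) ≤ 1 := Real.sqrt_le_one.2 (by linarith)
  have h6 : √(f 0 / 2) * opNorm (A * B - B * A) / ε ≤ opNorm A / 2 + √T := by
    rw [div_le_iff₀ hε]
    calc √(f 0 / 2) * opNorm (A * B - B * A)
        ≤ √(f 0 / 2) * (2 * (ε * (opNorm A / 2 + √T / √(2 * f 0)))) := by gcongr; exact hC.trans (by gcongr)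
      _ = (√(2 * f 0) * (opNorm A / 2) + √T) * ε := by
          rw [← mul_assoc, h4]; field_simp
      _ ≤ _ := by
          have := mul_le_mul_of_nonneg_right h5 (show 0 ≤ opNorm A / 2 by positivity)
          rw [one_mul] at this
          gcongr
  calc (√(f 0 / 2) * opNorm (A * B - B * A) / ε - opNorm A / 2) ^ 2 ≤ √T ^ 2 :=
        pow_le_pow_left₀ hL (by linarith) 2
    _ = T := Real.sq_sqrt hT0

end LowerBoundCost

/-! ### Position, translations and Gaussian states on L²(ℝ). -/

section Position

open MeasureTheory ProbabilityTheory

/-- The Hilbert space `L²(ℝ)`. -/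
abbrev LineSpace : Type := Lp ℂ 2 (volume : Measure ℝ)

theorem aestronglyMeasurable_ofReal_mul (φ : LineSpace) :
    AEStronglyMeasurable (fun x : ℝ => (x : ℂ) * φ x) volume :=
  Complex.continuous_ofReal.aestronglyMeasurable.mul (Lp.aestronglyMeasurable φ)

/-- Multiplication by the coordinate on `L²(ℝ)`, with its natural domain. -/
noncomputable def position : LineSpace →ₗ.[ℂ] LineSpace where
  domain :=
    { carrier := {φ | MemLp (fun x : ℝ => (x : ℂ) * φ x) 2 volume}
      add_mem' := fun {φ ψ} hφ hψ => by
        refine (MemLp.add hφ hψ).ae_eq ?_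
        filter_upwards [Lp.coeFn_add φ ψ] with x hx
        simp only [hx, Pi.add_apply, mul_add]
      zero_mem' := by
        refine (MemLp.zero (ε := ℂ) (p := 2) (μ := (volume : Measure ℝ))).ae_eq ?_
        filter_upwards [Lp.coeFn_zero ℂ 2 (volume : Measure ℝ)] with x hx
        rw [hx, Pi.zero_apply, mul_zero]
      smul_mem' := fun c φ hφ => by
        refine (MemLp.const_smul hφ c).ae_eq ?_
        filter_upwards [Lp.coeFn_smul c φ] with x hx
        simp only [hx, Pi.smul_apply, smul_eq_mul]
        ring }
  toFun :=
    { toFun := fun φ => MemLp.toLp _ φ.2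
      map_add' := fun φ ψ => by
        rw [← MemLp.toLp_add]
        refine MemLp.toLp_congr _ _ ?_
        filter_upwards [Lp.coeFn_add (φ : LineSpace) ψ] with x hx
        simp only [Submodule.coe_add, hx, Pi.add_apply, mul_add]
      map_smul' := fun c φ => by
        rw [RingHom.id_apply, ← MemLp.toLp_const_smul]
        refine MemLp.toLp_congr _ _ ?_
        filter_upwards [Lp.coeFn_smul c (φ : LineSpace)] with x hx
        simp only [Submodule.coe_smul, hx, Pi.smul_apply, smul_eq_mul]
        ring }

theorem mem_position_domain {φ : LineSpace} :
    φ ∈ position.domain ↔ MemLp (fun x : ℝ => (x : ℂ) * φ x) 2 volume := Iff.rfl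

theorem coeFn_position (φ : position.domain) :
    position φ =ᵐ[volume] fun x : ℝ => (x : ℂ) * (φ : LineSpace) x := MemLp.coeFn_toLp φ.2

/-- The solution is y/(x - z). For |Im z| = 1 both 1/(x - z) and x/(x - z) are bounded in x, so it
is square integrable and in the domain. -/
theorem exists_position_sub_smul (z : ℂ) (hz : |z.im| = 1) (y : LineSpace) :
    ∃ φ : position.domain, position φ - z • (φ : LineSpace) = y := by
  have hne : ∀ x : ℝ, (x : ℂ) - z ≠ 0 := fun x h => by
    have := congrArg Complex.im h
    simp at this
    simp [this] at hz
  have h1 : ∀ x : ℝ, 1 ≤ ‖(x : ℂ) - z‖ := fun x => by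
    have := Complex.abs_im_le_norm ((x : ℂ) - z)
    simpa [hz] using this
  have h2 : ∀ x : ℝ, ‖(x : ℂ)‖ ≤ (1 + ‖z‖) * ‖(x : ℂ) - z‖ := fun x => by
    have h3 := norm_add_le ((x : ℂ) - z) z
    rw [sub_add_cancel] at h3
    nlinarith [h1 x, norm_nonneg z]
  have hmeas : AEStronglyMeasurable (fun x : ℝ => ((x : ℂ) - z)⁻¹ * y x) volume := by
    refine AEStronglyMeasurable.mul ?_ (Lp.aestronglyMeasurable y)
    exact (Continuous.inv₀ (by fun_prop) hne).aestronglyMeasurable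
  have hm : MemLp (fun x : ℝ => ((x : ℂ) - z)⁻¹ * y x) 2 volume := by
    refine (Lp.memLp y).of_le hmeas (Eventually.of_forall fun x => ?_)
    rw [norm_mul, norm_inv]
    exact mul_le_of_le_one_left (norm_nonneg _) (inv_le_one_of_one_le₀ (h1 x))
  have hc := hm.coeFn_toLp
  have hd : hm.toLp _ ∈ position.domain := by
    rw [mem_position_domain]
    refine (Lp.memLp y).of_le_mul (c := 1 + ‖z‖) (aestronglyMeasurable_ofReal_mul _) ?_
    filter_upwards [hc] with x hx
    rw [hx, ← mul_assoc, norm_mul, norm_mul, norm_inv, ← div_eq_mul_inv]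
    refine mul_le_mul_of_nonneg_right ?_ (norm_nonneg _)
    rw [div_le_iff₀ (zero_lt_one.trans_le (h1 x))]
    exact h2 x
  refine ⟨⟨_, hd⟩, ?_⟩
  ext1
  filter_upwards [hc, coeFn_position ⟨_, hd⟩, Lp.coeFn_smul z (hm.toLp _),
    Lp.coeFn_sub (position ⟨_, hd⟩) (z • hm.toLp _)] with x h3 h4 h5 h6
  rw [h6, Pi.sub_apply, h4, h5, Pi.smul_apply, h3, smul_eq_mul, ← sub_mul,
    mul_inv_cancel_left₀ (hne x)]

theorem isSelfAdjoint_position : IsSelfAdjoint position := by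
  refine isSelfAdjoint_of_surjective (fun φ ψ => ?_) (fun y => ?_)
    (exists_position_sub_smul _ (by simp))
  · rw [L2.inner_def, L2.inner_def]
    refine integral_congr_ae ?_
    filter_upwards [coeFn_position φ, coeFn_position ψ] with x h1 h2
    rw [h1, h2]
    simp only [RCLike.inner_apply, map_mul, Complex.conj_ofReal]
    ring
  · obtain ⟨φ, h⟩ := exists_position_sub_smul (-Complex.I) (by simp) y
    exact ⟨φ, by rw [← h]; simp⟩

/-- Translation by `a` on `L²(ℝ)`. -/
noncomputable def translation (a : ℝ) : LineSpace ≃ₗᵢ[ℂ] LineSpace where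
  toLinearMap := (Lp.compMeasurePreservingₗᵢ ℂ (fun x : ℝ => x - a)
    (measurePreserving_sub_right volume a)).toLinearMap
  invFun := Lp.compMeasurePreservingₗᵢ ℂ (fun x : ℝ => x - (-a))
    (measurePreserving_sub_right volume (-a))
  left_inv φ := by
    have h1 := measurePreserving_sub_right (volume : Measure ℝ) a
    have h2 := measurePreserving_sub_right (volume : Measure ℝ) (-a)
    ext1
    change Lp.compMeasurePreserving _ h2 (Lp.compMeasurePreserving _ h1 φ) =ᵐ[volume] _
    filter_upwards [Lp.coeFn_compMeasurePreserving (Lp.compMeasurePreserving _ h1 φ) h2,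
      h2.quasiMeasurePreserving.ae (Lp.coeFn_compMeasurePreserving φ h1)] with x h3 h4
    rw [h3, Function.comp_apply, h4]
    simp
  right_inv φ := by
    have h1 := measurePreserving_sub_right (volume : Measure ℝ) a
    have h2 := measurePreserving_sub_right (volume : Measure ℝ) (-a)
    ext1
    change Lp.compMeasurePreserving _ h1 (Lp.compMeasurePreserving _ h2 φ) =ᵐ[volume] _
    filter_upwards [Lp.coeFn_compMeasurePreserving (Lp.compMeasurePreserving _ h2 φ) h1,
      h1.quasiMeasurePreserving.ae (Lp.coeFn_compMeasurePreserving φ h2)] with x h3 h4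
    rw [h3, Function.comp_apply, h4]
    simp
  norm_map' φ := Lp.norm_compMeasurePreserving φ (measurePreserving_sub_right volume a)

theorem coeFn_translation (a : ℝ) (φ : LineSpace) :
    translation a φ =ᵐ[volume] fun x => φ (x - a) :=
  Lp.coeFn_compMeasurePreserving φ (measurePreserving_sub_right volume a)

theorem translation_symm (a : ℝ) : (translation a).symm = translation (-a) := by
  ext1 φ
  rfl

theorem translation_toLp {φ : ℝ → ℂ} (hφ : MemLp φ 2 volume) (a : ℝ) :
    translation a (hφ.toLp φ) =ᵐ[volume] fun x => φ (x - a) :=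
  (coeFn_translation a _).trans ((measurePreserving_sub_right volume
    a).quasiMeasurePreserving.ae_eq_comp hφ.coeFn_toLp)

/-- The relation Q T_a = T_a (Q + a), through which a translation controlled by A absorbs A ⊗ 1 into
the pointer position. -/
theorem position_translation (a : ℝ) (φ : position.domain) :
    ∃ h : translation a φ ∈ position.domain,
      position ⟨translation a φ, h⟩ =
        translation a (position φ) + (a : ℂ) • translation a (φ : LineSpace) := by
  have h1 := coeFn_translation a (φ : LineSpace)
  have h2 := (coeFn_translation a (position φ)).trans ((measurePreserving_sub_right volume
    a).quasiMeasurePreserving.ae_eq_comp (coeFn_position φ))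
  set ψ := translation a (position φ) + (a : ℂ) • translation a (φ : LineSpace)
  have h3 : ψ =ᵐ[volume] fun x : ℝ => (x : ℂ) * translation a (φ : LineSpace) x := by
    filter_upwards [h1, h2, Lp.coeFn_add (translation a (position φ))
      ((a : ℂ) • translation a (φ : LineSpace)), Lp.coeFn_smul (a : ℂ)
      (translation a (φ : LineSpace))] with x e1 e2 e3 e4
    rw [e3, Pi.add_apply, e4, Pi.smul_apply, e2, e1]
    simp
    ring
  have h : translation a φ ∈ position.domain := (Lp.memLp ψ).ae_eq h3
  refine ⟨h, ?_⟩
  ext1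
  exact (coeFn_position ⟨_, h⟩).trans h3.symm

open scoped NNReal

/-- The square root of the centred Gaussian density of variance `v`. -/
noncomputable def gaussianAmplitude (v : ℝ≥0) (x : ℝ) : ℝ := √(gaussianPDFReal 0 v x)

/-- Completing the square: (x - a)² + (x - b)² = 2(x - (a + b)/2)² + (a - b)²/2. -/
theorem gaussianAmplitude_mul (v : ℝ≥0) (hv : v ≠ 0) (a b x : ℝ) :
    gaussianAmplitude v (x - a) * gaussianAmplitude v (x - b) =
      Real.exp (-((a - b) ^ 2 / (8 * v))) * gaussianPDFReal ((a + b) / 2) v x := by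
  have hv' : (v : ℝ) ≠ 0 := by exact_mod_cast hv
  rw [gaussianAmplitude, gaussianAmplitude, ← Real.sqrt_mul (gaussianPDFReal_nonneg _ _ _)]
  have e : gaussianPDFReal 0 v (x - a) * gaussianPDFReal 0 v (x - b) =
      (Real.exp (-((a - b) ^ 2 / (8 * v))) * gaussianPDFReal ((a + b) / 2) v x) ^ 2 := by
    simp only [gaussianPDFReal]
    have e1 : ∀ c p q r s : ℝ, Real.exp p * Real.exp q = Real.exp (r + s) ^ 2 →
        c * Real.exp p * (c * Real.exp q) = (Real.exp r * (c * Real.exp s)) ^ 2 := by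
      intro c p q r s h
      rw [Real.exp_add] at h
      linear_combination c ^ 2 * h
    apply e1
    rw [← Real.exp_add, ← Real.exp_nat_mul]
    congr 1
    push_cast
    field_simp
    ring
  rw [e, Real.sqrt_sq]
  exact mul_nonneg (Real.exp_pos _).le (gaussianPDFReal_nonneg _ _ _)

theorem gaussianAmplitude_mul_self (v : ℝ≥0) (x : ℝ) :
    gaussianAmplitude v x * gaussianAmplitude v x = gaussianPDFReal 0 v x :=
  Real.mul_self_sqrt (gaussianPDFReal_nonneg _ _ _)

theorem measurable_gaussianAmplitude (v : ℝ≥0) : Measurable (gaussianAmplitude v) :=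
  (measurable_gaussianPDFReal 0 v).sqrt

theorem memLp_gaussianAmplitude (v : ℝ≥0) :
    MemLp (fun x => (gaussianAmplitude v x : ℂ)) 2 volume := by
  have hm : AEStronglyMeasurable (fun x => (gaussianAmplitude v x : ℂ)) volume :=
    (Complex.measurable_ofReal.comp (measurable_gaussianAmplitude v)).aestronglyMeasurable
  rw [memLp_two_iff_integrable_sq_norm hm]
  refine (integrable_gaussianPDFReal 0 v).congr (Eventually.of_forall fun x => ?_)
  simp only [Complex.norm_real, Real.norm_eq_abs, sq_abs]
  rw [sq, gaussianAmplitude_mul_self]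

/-- The Gaussian wave function of position variance `v`. -/
noncomputable def gaussianState (v : ℝ≥0) : LineSpace := (memLp_gaussianAmplitude v).toLp _

theorem inner_translation_gaussianState {v : ℝ≥0} (hv : v ≠ 0) (a b : ℝ) :
    ⟪translation a (gaussianState v), translation b (gaussianState v)⟫_ℂ =
      (Real.exp (-((a - b) ^ 2 / (8 * v))) : ℂ) := by
  rw [L2.inner_def]
  have h : (fun x => ⟪translation a (gaussianState v) x, translation b (gaussianState v) x⟫_ℂ)
      =ᵐ[volume] fun x => ((Real.exp (-((a - b) ^ 2 / (8 * v))) *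
        gaussianPDFReal ((a + b) / 2) v x : ℝ) : ℂ) := by
    filter_upwards [translation_toLp (memLp_gaussianAmplitude v) a,
      translation_toLp (memLp_gaussianAmplitude v) b] with x h1 h2
    rw [gaussianState, h1, h2, ← gaussianAmplitude_mul v hv]
    simp [mul_comm]
  rw [integral_congr_ae h, integral_complex_ofReal, integral_const_mul,
    integral_gaussianPDFReal_eq_one _ hv, mul_one]

theorem norm_gaussianState {v : ℝ≥0} (hv : v ≠ 0) : ‖gaussianState v‖ = 1 := by
  have h := inner_translation_gaussianState hv 0 0
  rw [LinearIsometryEquiv.inner_map_map] at h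
  have h' := inner_self_eq_norm_sq (𝕜 := ℂ) (gaussianState v)
  rw [h] at h'
  exact (pow_eq_one_iff_of_nonneg (norm_nonneg _) two_ne_zero).1 (by simpa using h'.symm)

theorem gaussianState_mem_domain {v : ℝ≥0} (hv : v ≠ 0) : gaussianState v ∈ position.domain := by
  rw [mem_position_domain,
    memLp_two_iff_integrable_sq_norm (aestronglyMeasurable_ofReal_mul _)]
  have h1 : Integrable (fun x : ℝ => x ^ 2) (gaussianReal 0 v) :=
    (memLp_id_gaussianReal (μ := 0) (v := v) 2).integrable_sq
  rw [gaussianReal_of_var_ne_zero 0 hv, integrable_withDensity_iff_integrable_smul'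
    (measurable_gaussianPDF 0 v) (Eventually.of_forall fun x => gaussianPDF_lt_top)] at h1
  refine h1.congr ?_
  filter_upwards [(memLp_gaussianAmplitude v).coeFn_toLp] with x hx
  rw [gaussianState, hx, toReal_gaussianPDF, norm_mul, mul_pow, smul_eq_mul]
  simp only [Complex.norm_real, Real.norm_eq_abs, sq_abs]
  rw [sq (gaussianAmplitude v x), gaussianAmplitude_mul_self]
  ring

theorem integral_mul_gaussianPDFReal {v : ℝ≥0} (hv : v ≠ 0) (f : ℝ → ℝ) :
    ∫ x, f x * gaussianPDFReal 0 v x = ∫ x, f x ∂(gaussianReal 0 v) := by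
  rw [integral_gaussianReal_eq_integral_smul hv]
  simp [mul_comm]

theorem inner_position_gaussianState {v : ℝ≥0} (hv : v ≠ 0) :
    ⟪position ⟨gaussianState v, gaussianState_mem_domain hv⟩, gaussianState v⟫_ℂ = 0 := by
  rw [L2.inner_def]
  have h : (fun x => ⟪position ⟨gaussianState v, gaussianState_mem_domain hv⟩ x,
      gaussianState v x⟫_ℂ) =ᵐ[volume] fun x => ((x * gaussianPDFReal 0 v x : ℝ) : ℂ) := by
    filter_upwards [coeFn_position ⟨gaussianState v, gaussianState_mem_domain hv⟩,
      (memLp_gaussianAmplitude v).coeFn_toLp] with x h1 h2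
    rw [h1, gaussianState, h2, ← gaussianAmplitude_mul_self]
    simp
    ring
  rw [integral_congr_ae h, integral_complex_ofReal, integral_mul_gaussianPDFReal hv fun x => x,
    integral_id_gaussianReal, Complex.ofReal_zero]

theorem norm_sq_position_gaussianState {v : ℝ≥0} (hv : v ≠ 0) :
    ‖position ⟨gaussianState v, gaussianState_mem_domain hv⟩‖ ^ 2 = v := by
  have h0 : ⟪position ⟨gaussianState v, gaussianState_mem_domain hv⟩,
      position ⟨gaussianState v, gaussianState_mem_domain hv⟩⟫_ℂ = ((v : ℝ) : ℂ) := by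
    rw [L2.inner_def]
    have h : (fun x => ⟪position ⟨gaussianState v, gaussianState_mem_domain hv⟩ x,
        position ⟨gaussianState v, gaussianState_mem_domain hv⟩ x⟫_ℂ) =ᵐ[volume]
        fun x => ((x ^ 2 * gaussianPDFReal 0 v x : ℝ) : ℂ) := by
      filter_upwards [coeFn_position ⟨gaussianState v, gaussianState_mem_domain hv⟩,
        (memLp_gaussianAmplitude v).coeFn_toLp] with x h1 h2
      rw [h1, gaussianState, h2, ← gaussianAmplitude_mul_self]
      simp only [RCLike.inner_apply, map_mul, Complex.conj_ofReal, Complex.ofReal_mul,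
        Complex.ofReal_pow]
      ring
    rw [integral_congr_ae h, integral_complex_ofReal,
      integral_mul_gaussianPDFReal hv fun x => x ^ 2]
    have h1 := variance_fun_id_gaussianReal (μ := 0) (v := v)
    rw [variance_of_integral_eq_zero (X := fun x => x) measurable_id.aemeasurable
      integral_id_gaussianReal] at h1
    rw [h1]
  have h1 := inner_self_eq_norm_sq (𝕜 := ℂ)
    (position ⟨gaussianState v, gaussianState_mem_domain hv⟩)
  rw [h0] at h1
  simpa using h1.symm

end Position

/-! ### Isometries of the composite system that change the total quantity. -/

section Intertwine

variable {H : Type} [NormedAddCommGroup H] [InnerProductSpace ℂ H]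

/-- `T` maps the domain of `A` to that of `A'`, and `A' T = T A` there. -/
def Intertwines (T : H →ₗ[ℂ] H) (A A' : H →ₗ.[ℂ] H) : Prop :=
  ∀ x : A.domain, ∃ h : T x ∈ A'.domain, A' ⟨T x, h⟩ = T (A x)

theorem Intertwines.comp {S T : H →ₗ[ℂ] H} {A A' A'' : H →ₗ.[ℂ] H} (hS : Intertwines S A' A'')
    (hT : Intertwines T A A') : Intertwines (S.comp T) A A'' := by
  intro x
  obtain ⟨h1, e1⟩ := hT x
  obtain ⟨h2, e2⟩ := hS ⟨T x, h1⟩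
  exact ⟨h2, e2.trans (congrArg S e1)⟩

variable {d : ℕ} {E : Type} [NormedAddCommGroup E] [InnerProductSpace ℂ E]

theorem intertwines_leftOp {S X Y : Matrix (Fin d) (Fin d) ℂ} (h : S * X = Y * S)
    (M : E →ₗ.[ℂ] E) :
    Intertwines (leftOp S : Composite d E →ₗ[ℂ] Composite d E) (totalOp X M) (totalOp Y M) := by
  intro x
  obtain ⟨h1, e1⟩ := commutesWith_leftOp_rightOp S M x
  refine ⟨h1, ?_⟩
  rw [totalOp_apply, totalOp_apply, map_add, ← leftOp_mul, ← leftOp_mul, h]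
  congr 1

theorem leftOp_diagonal_apply (D : Fin d → ℂ) (x : Composite d E) (k : Fin d) :
    leftOp (diagonal D) x k = D k • x k := by
  simp [leftOp_apply, Matrix.diagonal_apply]

/-- The isometry `∑ |k⟩⟨k| ⊗ T k`. -/
noncomputable abbrev diagOp (T : Fin d → E ≃ₗᵢ[ℂ] E) : Composite d E ≃ₗᵢ[ℂ] Composite d E :=
  LinearIsometryEquiv.piLpCongrRight 2 T

theorem intertwines_diagOp {T : Fin d → E ≃ₗᵢ[ℂ] E} {M : E →ₗ.[ℂ] E} {c D D' : Fin d → ℂ}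
    (hT : ∀ k (φ : M.domain), ∃ h : T k φ ∈ M.domain,
      M ⟨T k φ, h⟩ = T k (M φ) + c k • T k (φ : E)) (hD : D' + c = D) :
    Intertwines ((diagOp T).toLinearEquiv : Composite d E →ₗ[ℂ] Composite d E)
      (totalOp (diagonal D) M) (totalOp (diagonal D') M) := by
  intro x
  have h : diagOp T x.1 ∈ (rightOp (d := d) M).domain := fun k => (hT k ⟨x.1 k, x.2 k⟩).1
  refine ⟨h, ?_⟩
  change totalOp (diagonal D') M ⟨diagOp T x.1, h⟩ = diagOp T (totalOp (diagonal D) M x)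
  ext k
  obtain ⟨h1, e1⟩ := hT k ⟨x.1 k, x.2 k⟩
  change leftOp (diagonal D') (diagOp T x.1) k + M ⟨T k (x.1 k), h1⟩ =
    T k (leftOp (diagonal D) x.1 k + M ⟨x.1 k, x.2 k⟩)
  rw [e1, leftOp_diagonal_apply, leftOp_diagonal_apply, map_add, map_smul, ← hD, Pi.add_apply,
    add_smul, LinearIsometryEquiv.piLpCongrRight_apply]
  abel

/-- The isometry `V ⊗ 1` for a unitary matrix `V`. -/
noncomputable def unitaryOp (V : unitary (Matrix (Fin d) (Fin d) ℂ)) :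
    Composite d E ≃ₗᵢ[ℂ] Composite d E where
  toLinearMap := leftOp (V : Matrix (Fin d) (Fin d) ℂ)
  invFun := leftOp (star (V : Matrix (Fin d) (Fin d) ℂ))
  left_inv x := by
    change leftOp _ (leftOp _ x) = x
    rw [← leftOp_mul, Unitary.coe_star_mul_self, leftOp_one]
  right_inv x := by
    change leftOp _ (leftOp _ x) = x
    rw [← leftOp_mul, Unitary.mul_star_self_of_mem V.2, leftOp_one]
  norm_map' x := by
    change ‖leftOp (V : Matrix (Fin d) (Fin d) ℂ) x‖ = ‖x‖
    have h : ⟪leftOp (V : Matrix (Fin d) (Fin d) ℂ) x, leftOp (V : Matrix (Fin d) (Fin d) ℂ) x⟫_ℂ =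
        ⟪x, x⟫_ℂ := by
      rw [inner_leftOp_left, ← leftOp_mul, ← Matrix.star_eq_conjTranspose,
        Unitary.coe_star_mul_self, leftOp_one]
    rw [@norm_eq_sqrt_re_inner ℂ, h, ← @norm_eq_sqrt_re_inner ℂ]

/-- The swap of two copies of `ℂ^d`. -/
noncomputable def swapOp : Composite d (Composite d E) ≃ₗᵢ[ℂ] Composite d (Composite d E) where
  toFun x := WithLp.toLp 2 fun a => WithLp.toLp 2 fun b => x b a
  invFun x := WithLp.toLp 2 fun a => WithLp.toLp 2 fun b => x b a
  map_add' x y := rfl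
  map_smul' c x := rfl
  left_inv x := rfl
  right_inv x := rfl
  norm_map' x := by
    have h : ‖(WithLp.toLp 2 fun a => WithLp.toLp 2 fun b => x b a :
        Composite d (Composite d E))‖ ^ 2 = ‖x‖ ^ 2 := by
      simp only [PiLp.norm_sq_eq_of_L2]
      exact Finset.sum_comm
    exact (pow_left_inj₀ (norm_nonneg _) (norm_nonneg _) two_ne_zero).1 h

theorem swapOp_apply (x : Composite d (Composite d E)) (a b : Fin d) :
    swapOp x a b = x b a := rfl

theorem intertwines_swapOp (Q : E →ₗ.[ℂ] E) :
    Intertwines ((swapOp (d := d) (E := E)).toLinearEquiv : Composite d (Composite d E) →ₗ[ℂ] _)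
      (totalOp 0 (rightOp (d := d) Q)) (totalOp 0 (rightOp (d := d) Q)) := by
  intro x
  have h : swapOp x.1 ∈ (rightOp (d := d) (rightOp (d := d) Q)).domain := fun a b => x.2 b a
  refine ⟨h, ?_⟩
  change totalOp 0 _ ⟨swapOp x.1, h⟩ = swapOp (totalOp 0 _ x)
  have h0 : ∀ y : Composite d (Composite d E), leftOp (0 : Matrix (Fin d) (Fin d) ℂ) y = 0 := by
    intro y; ext a; simp [leftOp_apply]
  rw [totalOp_apply, totalOp_apply, h0, h0, zero_add, zero_add]
  rfl

end Intertwine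

/-! ### The measuring device and its conservation law. -/

section Device

variable {d : ℕ} {E : Type} [NormedAddCommGroup E] [InnerProductSpace ℂ E]

/-- The diagonalised controlled isometry `∑ V|k⟩⟨k|V† ⊗ T k`. -/
noncomputable def controlOp (V : unitary (Matrix (Fin d) (Fin d) ℂ)) (T : Fin d → E ≃ₗᵢ[ℂ] E) :
    Composite d E ≃ₗᵢ[ℂ] Composite d E :=
  ((unitaryOp V).symm.trans (diagOp T)).trans (unitaryOp V)

theorem controlOp_apply (V : unitary (Matrix (Fin d) (Fin d) ℂ)) (T : Fin d → E ≃ₗᵢ[ℂ] E)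
    (x : Composite d E) :
    controlOp V T x = leftOp (V : Matrix (Fin d) (Fin d) ℂ)
      (diagOp T (leftOp (star (V : Matrix (Fin d) (Fin d) ℂ)) x)) := rfl

theorem controlOp_symm (V : unitary (Matrix (Fin d) (Fin d) ℂ)) (T : Fin d → E ≃ₗᵢ[ℂ] E) :
    (controlOp V T).symm = controlOp V fun k => (T k).symm := rfl

theorem intertwines_controlOp {V : unitary (Matrix (Fin d) (Fin d) ℂ)} {T : Fin d → E ≃ₗᵢ[ℂ] E}
    {M : E →ₗ.[ℂ] E} {c D D' : Fin d → ℂ}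
    (hT : ∀ k (φ : M.domain), ∃ h : T k φ ∈ M.domain,
      M ⟨T k φ, h⟩ = T k (M φ) + c k • T k (φ : E)) (hD : D' + c = D) :
    Intertwines ((controlOp V T).toLinearEquiv : Composite d E →ₗ[ℂ] Composite d E)
      (totalOp ((V : Matrix (Fin d) (Fin d) ℂ) * diagonal D * star (V : Matrix (Fin d) (Fin d) ℂ)) M)
      (totalOp ((V : Matrix (Fin d) (Fin d) ℂ) * diagonal D' * star (V : Matrix (Fin d) (Fin d) ℂ))
        M) := by
  have h1 : (star (V : Matrix (Fin d) (Fin d) ℂ)) *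
      ((V : Matrix (Fin d) (Fin d) ℂ) * diagonal D * star (V : Matrix (Fin d) (Fin d) ℂ)) =
      diagonal D * star (V : Matrix (Fin d) (Fin d) ℂ) := by
    rw [mul_assoc, ← mul_assoc, Unitary.coe_star_mul_self, one_mul]
  have h2 : (V : Matrix (Fin d) (Fin d) ℂ) * diagonal D' =
      (V : Matrix (Fin d) (Fin d) ℂ) * diagonal D' * star (V : Matrix (Fin d) (Fin d) ℂ) *
        (V : Matrix (Fin d) (Fin d) ℂ) := by
    rw [mul_assoc _ (star _), Unitary.coe_star_mul_self, mul_one]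
  exact (intertwines_leftOp h2 M).comp ((intertwines_diagOp hT hD).comp (intertwines_leftOp h1 M))

/-- The bounded operator `B ⊗ 1` on `ℂ^d ⊗ E`, as a partially defined operator. -/
noncomputable def meterOp (B : Matrix (Fin d) (Fin d) ℂ) : Composite d E →ₗ.[ℂ] Composite d E :=
  LinearMap.toPMap (leftOp B) ⊤

theorem meterOp_apply (B : Matrix (Fin d) (Fin d) ℂ)
    (x : (meterOp (E := E) B).domain) : meterOp B x = leftOp B x.1 := rfl

theorem mem_meterOp_domain (B : Matrix (Fin d) (Fin d) ℂ) (x : Composite d E) :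
    x ∈ (meterOp (E := E) B).domain := Submodule.mem_top

theorem exists_inverse_sub_smul {B : Matrix (Fin d) (Fin d) ℂ} (hB : Bᴴ = B) {z : ℂ}
    (hz : z.im ≠ 0) :
    ∃ R : Matrix (Fin d) (Fin d) ℂ, (B - z • 1) * R = 1 ∧ R * (B - z • 1) = 1 := by
  have hdet : (B - z • 1).det ≠ 0 := by
    intro h0
    obtain ⟨v, hv, hBv⟩ := Matrix.exists_mulVec_eq_zero_iff.2 h0
    have h1 : toEuclideanCLM (𝕜 := ℂ) B (WithLp.toLp 2 v) = z • WithLp.toLp 2 v := by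
      rw [toEuclideanCLM_toLp]
      rw [Matrix.sub_mulVec, Matrix.smul_mulVec, Matrix.one_mulVec, sub_eq_zero] at hBv
      rw [hBv]; rfl
    have h2 := inner_toEuclideanCLM_left B (WithLp.toLp 2 v) (WithLp.toLp 2 v)
    rw [hB, h1, inner_smul_left, inner_smul_right] at h2
    have h3 : ⟪WithLp.toLp 2 v, WithLp.toLp 2 v⟫_ℂ ≠ 0 := by
      rw [inner_self_ne_zero]
      simpa using hv
    exact hz (Complex.conj_eq_iff_im.1 (mul_right_cancel₀ h3 h2))
  have hu : IsUnit (B - z • 1).det := isUnit_iff_ne_zero.2 hdet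
  exact ⟨(B - z • 1)⁻¹, Matrix.mul_nonsing_inv _ hu, Matrix.nonsing_inv_mul _ hu⟩

theorem leftOp_sub_smul_one (B : Matrix (Fin d) (Fin d) ℂ) (z : ℂ) (x : Composite d E) :
    leftOp (B - z • 1) x = leftOp B x - z • x := by
  rw [leftOp_sub]
  congr 1
  ext a
  simp [leftOp_apply, Matrix.one_apply]

/-- The resolvent of B ⊗ 1 is (B - z)⁻¹ ⊗ 1, which acts on the factor that 1 ⊗ Q leaves alone. -/
theorem stronglyCommute_meterOp {B : Matrix (Fin d) (Fin d) ℂ} (hB : Bᴴ = B) (Q : E →ₗ.[ℂ] E) :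
    StronglyCommute (meterOp (E := E) B) (rightOp (d := d) Q) := by
  intro z hz R hR
  obtain ⟨S, -, hS⟩ := exists_inverse_sub_smul hB hz
  have h : (R : Composite d E →ₗ[ℂ] Composite d E) = leftOp S := by
    ext1 y
    obtain ⟨h1, e1⟩ := hR.1 y
    rw [meterOp_apply, ← leftOp_sub_smul_one] at e1
    nth_rw 2 [← e1]
    rw [← leftOp_mul, hS, leftOp_one]
    rfl
  rw [h]
  exact commutesWith_leftOp_rightOp S Q

theorem isSelfAdjoint_meterOp [CompleteSpace E] {B : Matrix (Fin d) (Fin d) ℂ} (hB : Bᴴ = B) :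
    IsSelfAdjoint (meterOp (E := E) B) := by
  have hs : ∀ z : ℂ, z.im ≠ 0 → ∀ y : Composite d E, ∃ x : (meterOp (E := E) B).domain,
      meterOp B x - z • (x : Composite d E) = y := fun z hz y => by
    obtain ⟨S, hS, -⟩ := exists_inverse_sub_smul hB hz
    refine ⟨⟨leftOp S y, mem_meterOp_domain B _⟩, ?_⟩
    rw [meterOp_apply, ← leftOp_sub_smul_one, ← leftOp_mul, hS, leftOp_one]
  refine isSelfAdjoint_of_surjective (fun x y => ?_) (fun y => ?_) (hs _ (by simp))
  · rw [meterOp_apply, meterOp_apply, inner_leftOp_left, hB]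
  · obtain ⟨x, hx⟩ := hs (-Complex.I) (by simp) y
    exact ⟨x, by rw [← hx]; simp⟩

/-- Translation of the pointer `L²(ℝ)` in `ℂ^d ⊗ L²(ℝ)`. -/
noncomputable abbrev shiftOp (d : ℕ) (a : ℝ) :
    Composite d LineSpace ≃ₗᵢ[ℂ] Composite d LineSpace :=
  diagOp fun _ => translation a

theorem shiftOp_symm (a : ℝ) : (shiftOp d a).symm = shiftOp d (-a) := by
  rw [shiftOp, diagOp, LinearIsometryEquiv.piLpCongrRight_symm]
  simp only [translation_symm]

theorem rightOp_position_shiftOp (a : ℝ) (φ : (rightOp (d := d) position).domain) :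
    ∃ h : shiftOp d a φ ∈ (rightOp (d := d) position).domain,
      rightOp position ⟨shiftOp d a φ, h⟩ =
        shiftOp d a (rightOp position φ) + (a : ℂ) • shiftOp d a (φ : Composite d LineSpace) := by
  refine ⟨fun k => (position_translation a ⟨φ.1 k, φ.2 k⟩).1, ?_⟩
  ext1 k
  exact (position_translation a ⟨φ.1 k, φ.2 k⟩).2

/-- The measurement device: the swap of system and meter, in the frame which turns the total
conserved quantity into the position of the pointer. -/
noncomputable def device (V : unitary (Matrix (Fin d) (Fin d) ℂ)) (D : Fin d → ℝ) :
    Composite d (Composite d LineSpace) ≃ₗᵢ[ℂ] Composite d (Composite d LineSpace) :=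
  ((controlOp V fun k => shiftOp d (D k)).trans swapOp).trans
    (controlOp V fun k => shiftOp d (D k)).symm

/-- The controlled shift turns A ⊗ 1 + 1 ⊗ Q into 1 ⊗ Q, the swap preserves 1 ⊗ Q, and the inverse
shift restores the total. -/
theorem device_conservation (V : unitary (Matrix (Fin d) (Fin d) ℂ)) (D : Fin d → ℝ) :
    CommutesWith ((device V D).toLinearEquiv : Composite d (Composite d LineSpace) →ₗ[ℂ] _)
      (totalOp ((V : Matrix (Fin d) (Fin d) ℂ) * diagonal (fun k => (D k : ℂ)) *
        star (V : Matrix (Fin d) (Fin d) ℂ)) (rightOp (d := d) position)) := by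
  have h1 := intertwines_controlOp (V := V) (T := fun k => shiftOp d (D k))
    (M := rightOp (d := d) position) (D := fun k => (D k : ℂ)) (D' := 0)
    (c := fun k => (D k : ℂ)) (fun k φ => rightOp_position_shiftOp (D k) φ) (zero_add _)
  have h3 := intertwines_controlOp (V := V) (T := fun k => shiftOp d (-D k))
    (M := rightOp (d := d) position) (D := 0) (D' := fun k => (D k : ℂ))
    (c := fun k => ((-D k : ℝ) : ℂ)) (fun k φ => rightOp_position_shiftOp (-D k) φ)
    (by funext k; simp)
  simp only [← shiftOp_symm] at h3
  rw [diagonal_zero', mul_zero, zero_mul] at h1 h3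
  exact h3.comp ((intertwines_swapOp position).comp h1)

end Device

/-! ### Linear growth of the commutator with exp(ixA). -/

section CommutatorGrowth

/-- For a one-parameter group `e` of contractions with generator `a`, the commutator with `b` grows
at most linearly. -/
theorem norm_mul_sub_mul_le {𝔸 : Type*} [NormedRing 𝔸] [NormedAlgebra ℝ 𝔸] {e : ℝ → 𝔸} {a b : 𝔸}
    (he0 : e 0 = 1) (hder : ∀ x, HasDerivAt e (e x * a) x) (hcomm : ∀ x, e x * a = a * e x)
    (hinv : ∀ x, e (-x) * e x = 1) (hn : ∀ x, ‖e x‖ ≤ 1) (x : ℝ) :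
    ‖e x * b - b * e x‖ ≤ |x| * ‖a * b - b * a‖ := by
  -- The derivative of e(y) b e(-y) is e(y)[a, b]e(-y), of norm at most ‖[a, b]‖; the mean value
  -- inequality then applies.
  have hF : ∀ y, HasDerivAt (fun y => e y * b * e (-y)) (e y * (a * b - b * a) * e (-y)) y := by
    intro y
    have h1 : HasDerivAt (fun y => e (-y)) (-(e (-y) * a)) y := by
      have h := (hder (-y)).scomp y (hasDerivAt_neg y)
      rw [neg_smul, one_smul] at h
      exact h
    refine (((hder y).mul_const b).mul h1).congr_deriv ?_
    rw [hcomm (-y)]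
    noncomm_ring
  have hb : ∀ y ∈ (Set.univ : Set ℝ), ‖e y * (a * b - b * a) * e (-y)‖ ≤ ‖a * b - b * a‖ := by
    intro y _
    calc ‖e y * (a * b - b * a) * e (-y)‖ ≤ ‖e y‖ * ‖a * b - b * a‖ * ‖e (-y)‖ :=
          (norm_mul_le _ _).trans (mul_le_mul_of_nonneg_right (norm_mul_le _ _) (norm_nonneg _))
      _ ≤ 1 * ‖a * b - b * a‖ * 1 := by gcongr <;> exact hn _
      _ = _ := by ring
  have h1 := convex_univ.norm_image_sub_le_of_norm_hasDerivWithin_le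
    (fun y _ => (hF y).hasDerivWithinAt) hb (Set.mem_univ 0) (Set.mem_univ x)
  simp only [neg_zero, he0, one_mul, mul_one, sub_zero, Real.norm_eq_abs] at h1
  have h2 : e x * b - b * e x = (e x * b * e (-x) - b) * e x := by
    rw [sub_mul, mul_assoc _ (e (-x)), hinv, mul_one]
  rw [h2]
  calc ‖(e x * b * e (-x) - b) * e x‖ ≤ ‖e x * b * e (-x) - b‖ * ‖e x‖ := norm_mul_le _ _
    _ ≤ (‖a * b - b * a‖ * |x|) * 1 := by gcongr; exact hn _
    _ = _ := by ring

variable {d : ℕ}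

/-- The projection onto the `k`-th column of the unitary `V`. -/
noncomputable def columnProj (V : unitary (Matrix (Fin d) (Fin d) ℂ)) (k : Fin d) :
    Matrix (Fin d) (Fin d) ℂ :=
  (V : Matrix (Fin d) (Fin d) ℂ) * diagonal (Pi.single k 1) * star (V : Matrix (Fin d) (Fin d) ℂ)

theorem sum_smul_columnProj (V : unitary (Matrix (Fin d) (Fin d) ℂ)) (c : Fin d → ℂ) :
    ∑ k, c k • columnProj V k =
      (V : Matrix (Fin d) (Fin d) ℂ) * diagonal c * star (V : Matrix (Fin d) (Fin d) ℂ) := by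
  have h : diagonal c = ∑ k, c k • diagonal (Pi.single k (1 : ℂ)) := by
    ext i j
    simp only [Matrix.sum_apply, Matrix.smul_apply, Matrix.diagonal_apply, smul_eq_mul]
    split_ifs <;> simp [Pi.single_apply]
  rw [h, Finset.mul_sum, Finset.sum_mul]
  refine Finset.sum_congr rfl fun k _ => ?_
  rw [columnProj, Matrix.mul_smul, Matrix.smul_mul]

theorem conj_diagonal_mul (V : unitary (Matrix (Fin d) (Fin d) ℂ)) (c c' : Fin d → ℂ) :
    (V : Matrix (Fin d) (Fin d) ℂ) * diagonal c * star (V : Matrix (Fin d) (Fin d) ℂ) *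
      ((V : Matrix (Fin d) (Fin d) ℂ) * diagonal c' * star (V : Matrix (Fin d) (Fin d) ℂ)) =
      (V : Matrix (Fin d) (Fin d) ℂ) * diagonal (fun k => c k * c' k) *
        star (V : Matrix (Fin d) (Fin d) ℂ) := by
  calc _ = (V : Matrix (Fin d) (Fin d) ℂ) * diagonal c * (star (V : Matrix (Fin d) (Fin d) ℂ) *
      (V : Matrix (Fin d) (Fin d) ℂ)) * diagonal c' * star (V : Matrix (Fin d) (Fin d) ℂ) := by
        noncomm_ring
    _ = _ := by
        rw [Unitary.coe_star_mul_self, mul_one, mul_assoc _ (diagonal c), diagonal_mul_diagonal]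

/-- The phases `exp (i x D k)`. -/
noncomputable def phase (D : Fin d → ℝ) (x : ℝ) (k : Fin d) : ℂ :=
  Complex.exp ((x * D k : ℝ) * Complex.I)

theorem phase_neg_mul (D : Fin d → ℝ) (x : ℝ) :
    (fun k => phase D (-x) k * phase D x k) = fun _ => 1 := by
  funext k
  rw [phase, phase, ← Complex.exp_add]
  simp

theorem star_phase (D : Fin d → ℝ) (x : ℝ) : star (phase D x) = phase D (-x) := by
  funext k
  simp only [phase, Pi.star_apply, RCLike.star_def, ← Complex.exp_conj]
  simp

theorem phase_zero (D : Fin d → ℝ) : phase D 0 = fun _ => 1 := by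
  funext k
  simp [phase]

theorem hasDerivAt_phase (D : Fin d → ℝ) (x : ℝ) (k : Fin d) :
    HasDerivAt (fun x => phase D x k) (phase D x k * (Complex.I * D k)) x := by
  have h2 : HasDerivAt (fun x : ℝ => ((x * D k : ℝ) : ℂ) * Complex.I) (D k * Complex.I) x := by
    have h3 := ((hasDerivAt_id x).mul_const (D k)).ofReal_comp.mul_const Complex.I
    simpa using h3
  refine h2.cexp.congr_deriv ?_
  rw [phase, mul_comm (D k : ℂ)]

theorem hasDerivAt_sum_phase_smul {F : Type*} [NormedAddCommGroup F] [NormedSpace ℂ F]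
    (D : Fin d → ℝ) (P : Fin d → F) (x : ℝ) :
    HasDerivAt (fun x => ∑ k, phase D x k • P k)
      (∑ k, (phase D x k * (Complex.I * D k)) • P k) x :=
  HasDerivAt.fun_sum fun k _ => (hasDerivAt_phase D x k).smul_const _

/-- The sum of phases times column projections is exp(ixA), so this is the growth bound with
generator iA. The isomorphism φ carries the matrices to an algebra with a C*-norm. -/
theorem norm_map_phase_commutator_le {𝔸 : Type*} [NormedRing 𝔸] [StarRing 𝔸] [CStarRing 𝔸]
    [NormedAlgebra ℂ 𝔸] (φ : Matrix (Fin d) (Fin d) ℂ ≃⋆ₐ[ℂ] 𝔸)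
    (V : unitary (Matrix (Fin d) (Fin d) ℂ)) (D : Fin d → ℝ) (B : Matrix (Fin d) (Fin d) ℂ)
    (x : ℝ) :
    ‖φ ((∑ k, phase D x k • columnProj V k) * B - B * ∑ k, phase D x k • columnProj V k)‖ ≤
      |x| * ‖φ (((V : Matrix (Fin d) (Fin d) ℂ) * diagonal (fun k => (D k : ℂ)) *
        star (V : Matrix (Fin d) (Fin d) ℂ)) * B - B * ((V : Matrix (Fin d) (Fin d) ℂ) *
          diagonal (fun k => (D k : ℂ)) * star (V : Matrix (Fin d) (Fin d) ℂ)))‖ := by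
  set A := (V : Matrix (Fin d) (Fin d) ℂ) * diagonal (fun k => (D k : ℂ)) *
        star (V : Matrix (Fin d) (Fin d) ℂ) with hA
  let e : ℝ → 𝔸 := fun x => φ ((V : Matrix (Fin d) (Fin d) ℂ) * diagonal (phase D x) *
    star (V : Matrix (Fin d) (Fin d) ℂ))
  have hmul : ∀ c c' : Fin d → ℂ, φ ((V : Matrix (Fin d) (Fin d) ℂ) * diagonal c *
      star (V : Matrix (Fin d) (Fin d) ℂ)) * φ ((V : Matrix (Fin d) (Fin d) ℂ) * diagonal c' *
      star (V : Matrix (Fin d) (Fin d) ℂ)) = φ ((V : Matrix (Fin d) (Fin d) ℂ) *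
        diagonal (fun k => c k * c' k) * star (V : Matrix (Fin d) (Fin d) ℂ)) := fun c c' => by
    rw [← map_mul, conj_diagonal_mul]
  have hone : φ ((V : Matrix (Fin d) (Fin d) ℂ) * diagonal (fun _ => (1 : ℂ)) *
      star (V : Matrix (Fin d) (Fin d) ℂ)) = 1 := by
    rw [diagonal_one, mul_one, Unitary.mul_star_self_of_mem V.2, map_one]
  have ha : Complex.I • φ A = φ ((V : Matrix (Fin d) (Fin d) ℂ) *
      diagonal (fun k => Complex.I * D k) * star (V : Matrix (Fin d) (Fin d) ℂ)) := by
    rw [← map_smul, hA, ← sum_smul_columnProj, ← sum_smul_columnProj, Finset.smul_sum]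
    simp only [smul_smul]
  have hinv : ∀ x, e (-x) * e x = 1 := fun x => by
    rw [hmul, ← hone]
    rw [phase_neg_mul]
  have hstar : ∀ x, star (e x) = e (-x) := fun x => by
    simp only [e]
    rw [← map_star, star_mul, star_mul, star_star, ← mul_assoc, Matrix.star_eq_conjTranspose
      (diagonal _), Matrix.diagonal_conjTranspose, star_phase]
  have hn : ∀ x, ‖e x‖ ≤ 1 := fun x => by
    have h := CStarRing.norm_star_mul_self (x := e x)
    rw [hstar, hinv] at h
    -- The algebra may be trivial, so only ‖1‖ ≤ 1 is available, from ‖1‖ = ‖1‖².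
    have h1 := CStarRing.norm_star_mul_self (x := (1 : 𝔸))
    rw [star_one, one_mul] at h1
    have h2 : ‖(1 : 𝔸)‖ ≤ 1 := by nlinarith [norm_nonneg (1 : 𝔸)]
    nlinarith [norm_nonneg (e x)]
  have hder : ∀ x, HasDerivAt e (e x * (Complex.I • φ A)) x := fun x => by
    have h5 : e = fun x => ∑ k, phase D x k • φ (columnProj V k) := by
      funext x
      simp only [e]
      rw [← sum_smul_columnProj, map_sum]
      simp only [map_smul]
    rw [h5]
    refine (hasDerivAt_sum_phase_smul D (fun k => φ (columnProj V k)) x).congr_deriv ?_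
    rw [← h5, ha, hmul, ← sum_smul_columnProj, map_sum]
    simp only [map_smul]
  have hcomm : ∀ x, e x * (Complex.I • φ A) = (Complex.I • φ A) * e x := fun x => by
    rw [ha, hmul, hmul]
    simp only [mul_comm]
  have he0 : e 0 = 1 := by
    rw [← hone]
    simp only [e, phase_zero]
  have h := norm_mul_sub_mul_le (b := φ B) he0 hder hcomm hinv hn x
  rw [smul_mul_assoc, mul_smul_comm, ← smul_sub, norm_smul, Complex.norm_I, one_mul, ← map_mul,
    ← map_mul, ← map_sub] at h
  rw [sum_smul_columnProj]
  simpa only [map_sub, map_mul, e] using h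

theorem norm_phase_commutator_le (V : unitary (Matrix (Fin d) (Fin d) ℂ)) (D : Fin d → ℝ)
    (B : Matrix (Fin d) (Fin d) ℂ) (x : ℝ) :
    opNorm ((∑ k, phase D x k • columnProj V k) * B - B * ∑ k, phase D x k • columnProj V k) ≤
      |x| * opNorm (((V : Matrix (Fin d) (Fin d) ℂ) * diagonal (fun k => (D k : ℂ)) *
        star (V : Matrix (Fin d) (Fin d) ℂ)) * B - B * ((V : Matrix (Fin d) (Fin d) ℂ) *
          diagonal (fun k => (D k : ℂ)) * star (V : Matrix (Fin d) (Fin d) ℂ))) :=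
  norm_map_phase_commutator_le (toEuclideanCLM (n := Fin d) (𝕜 := ℂ)) V D B x

end CommutatorGrowth

/-! ### The noise of the device as a Gaussian average. -/

section DeviceNoise

variable {d : ℕ}

/-- `1 ⊗ B ⊗ 1` on `ℂ^d ⊗ ℂ^d ⊗ E`. -/
noncomputable def meterMap {E : Type} [NormedAddCommGroup E] [InnerProductSpace ℂ E]
    (B : Matrix (Fin d) (Fin d) ℂ) (y : Composite d (Composite d E)) :
    Composite d (Composite d E) :=
  WithLp.toLp 2 fun a => leftOp B (y a)

theorem meterMap_leftOp {E : Type} [NormedAddCommGroup E] [InnerProductSpace ℂ E]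
    (B S : Matrix (Fin d) (Fin d) ℂ) (y : Composite d (Composite d E)) :
    meterMap B (leftOp S y) = leftOp S (meterMap B y) := by
  ext1 a
  change leftOp B (leftOp S y a) = ∑ b, S a b • leftOp B (y b)
  rw [leftOp_apply, map_sum]
  simp only [map_smul]

theorem leftOp_shiftOp (B : Matrix (Fin d) (Fin d) ℂ) (a : ℝ) (φ : Composite d LineSpace) :
    leftOp B (shiftOp d a φ) = shiftOp d a (leftOp B φ) := by
  ext1 k
  rw [LinearIsometryEquiv.piLpCongrRight_apply, LinearIsometryEquiv.piLpCongrRight_apply]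
  change _ = translation a (leftOp B φ k)
  rw [leftOp_apply, leftOp_apply, map_sum]
  simp only [map_smul]

theorem meterMap_controlOp (B : Matrix (Fin d) (Fin d) ℂ)
    (V : unitary (Matrix (Fin d) (Fin d) ℂ)) (D : Fin d → ℝ)
    (y : Composite d (Composite d LineSpace)) :
    meterMap B (controlOp V (fun k => shiftOp d (D k)) y) =
      controlOp V (fun k => shiftOp d (D k)) (meterMap B y) := by
  rw [controlOp_apply, controlOp_apply, meterMap_leftOp, ← meterMap_leftOp B (star _)]
  congr 1
  ext1 k
  exact leftOp_shiftOp B (D k) _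

theorem meterMap_swapOp {E : Type} [NormedAddCommGroup E] [InnerProductSpace ℂ E]
    (B : Matrix (Fin d) (Fin d) ℂ) (y : Composite d (Composite d E)) :
    meterMap B (swapOp y) = swapOp (leftOp B y) := by
  ext a b
  change leftOp B (swapOp y a) b = leftOp B y b a
  rw [leftOp_apply, leftOp_apply]
  simp [swapOp_apply]

/-- W commutes with B on the meter, and the swap turns it into B on the system. Thus the noise is B
⊗ 1 - W†(B ⊗ 1)W, and applying the isometry W leaves the commutator of W with B ⊗ 1. -/
theorem norm_noiseOp_conj_swapOp {E : Type} [NormedAddCommGroup E] [InnerProductSpace ℂ E]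
    (B : Matrix (Fin d) (Fin d) ℂ) (W : Composite d (Composite d E) ≃ₗᵢ[ℂ] Composite d (Composite d E))
    (hW : ∀ y, meterMap B (W.symm y) = W.symm (meterMap B y)) (x : Composite d (Composite d E))
    (h : x ∈ (noiseOp (E := Composite d E) B (meterOp B) ((W.trans swapOp).trans W.symm)).domain) :
    ‖noiseOp (E := Composite d E) B (meterOp B) ((W.trans swapOp).trans W.symm) ⟨x, h⟩‖ =
      ‖W (leftOp B x) - leftOp B (W x)‖ := by
  have h1 : noiseOp (E := Composite d E) B (meterOp B) ((W.trans swapOp).trans W.symm) ⟨x, h⟩ =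
      leftOp B x - W.symm (swapOp.symm (W (meterMap B (W.symm (swapOp (W x)))))) := rfl
  rw [h1, hW, meterMap_swapOp, W.apply_symm_apply, LinearIsometryEquiv.symm_apply_apply,
    ← W.norm_map, map_sub, W.apply_symm_apply]

theorem norm_noiseOp_device (B : Matrix (Fin d) (Fin d) ℂ)
    (V : unitary (Matrix (Fin d) (Fin d) ℂ)) (D : Fin d → ℝ)
    (x : Composite d (Composite d LineSpace))
    (h : x ∈ (noiseOp (E := Composite d LineSpace) B (meterOp B) (device V D)).domain) :
    ‖noiseOp (E := Composite d LineSpace) B (meterOp B) (device V D) ⟨x, h⟩‖ =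
      ‖controlOp V (fun k => shiftOp d (D k)) (leftOp B x) -
        leftOp B (controlOp V (fun k => shiftOp d (D k)) x)‖ := by
  refine norm_noiseOp_conj_swapOp B _ (fun y => ?_) x h
  rw [controlOp_symm]
  simp only [shiftOp_symm]
  exact meterMap_controlOp B V (fun k => -D k) y

theorem toEuclideanCLM_commutator_apply (P B : Matrix (Fin d) (Fin d) ℂ)
    (s : EuclideanSpace ℂ (Fin d)) :
    toEuclideanCLM (𝕜 := ℂ) (P * B - B * P) s =
      toEuclideanCLM (𝕜 := ℂ) P (toEuclideanCLM (𝕜 := ℂ) B s) -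
        toEuclideanCLM (𝕜 := ℂ) B (toEuclideanCLM (𝕜 := ℂ) P s) := by
  ext a
  rw [PiLp.sub_apply]
  simp only [ofLp_toEuclideanCLM, Matrix.sub_mulVec, Matrix.mulVec_mulVec, Pi.sub_apply]

theorem toEuclideanCLM_sum_smul_apply (c : Fin d → ℂ) (P : Fin d → Matrix (Fin d) (Fin d) ℂ)
    (s : EuclideanSpace ℂ (Fin d)) :
    toEuclideanCLM (𝕜 := ℂ) (∑ j, c j • P j) s = ∑ j, c j • toEuclideanCLM (𝕜 := ℂ) (P j) s := by
  ext a
  rw [WithLp.ofLp_sum, Finset.sum_apply, ofLp_toEuclideanCLM, Matrix.sum_mulVec, Finset.sum_apply]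
  refine Finset.sum_congr rfl fun j _ => ?_
  rw [PiLp.smul_apply, ofLp_toEuclideanCLM, Matrix.smul_mulVec, Pi.smul_apply]

theorem controlOp_tmul {E : Type} [NormedAddCommGroup E] [InnerProductSpace ℂ E]
    (V : unitary (Matrix (Fin d) (Fin d) ℂ)) (T : Fin d → E ≃ₗᵢ[ℂ] E)
    (s : EuclideanSpace ℂ (Fin d)) (ψ : E) :
    controlOp V T (tmul s ψ) =
      ∑ k, tmul (toEuclideanCLM (𝕜 := ℂ) (columnProj V k) s) (T k ψ) := by
  rw [controlOp_apply, leftOp_tmul]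
  set t := toEuclideanCLM (𝕜 := ℂ) (star (V : Matrix (Fin d) (Fin d) ℂ)) s with ht
  have hP : ∀ k, toEuclideanCLM (𝕜 := ℂ) (columnProj V k) s =
      t k • WithLp.toLp 2 fun a => (V : Matrix (Fin d) (Fin d) ℂ) a k := by
    intro k
    rw [columnProj, mul_assoc, map_mul, map_mul, mul_apply_eq_comp, mul_apply_eq_comp, ← ht]
    ext a
    rw [ofLp_toEuclideanCLM, ofLp_toEuclideanCLM]
    simp [Matrix.mulVec, dotProduct, Matrix.diagonal_apply, Pi.single_apply, mul_comm]
  ext a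
  rw [leftOp_apply, WithLp.ofLp_sum, Finset.sum_apply]
  refine Finset.sum_congr rfl fun k _ => ?_
  rw [hP, tmul_apply, LinearIsometryEquiv.piLpCongrRight_apply]
  simp only [tmul_apply, map_smul, smul_smul, PiLp.smul_apply, smul_eq_mul]
  rw [mul_comm]

open MeasureTheory ProbabilityTheory
open scoped NNReal

/-- The overlap exp(-(a - b)²/(8v)) of two translated Gaussians is the characteristic function at a
- b of the centred Gaussian law of variance 1/(4v), the momentum distribution. Expanding both
squared norms into pair terms and matching them replaces a Fourier transform. -/
theorem norm_sum_tmul_shift_sq {k : EuclideanSpace ℂ (Fin d)} (hk : ‖k‖ = 1) {v : ℝ≥0}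
    (hv : v ≠ 0) (D : Fin d → ℝ) (q : Fin d → EuclideanSpace ℂ (Fin d)) :
    ‖∑ j, tmul (q j) (shiftOp d (D j) (tmul k (gaussianState v)))‖ ^ 2 =
      ∫ x, ‖∑ j, phase D x j • q j‖ ^ 2 ∂(gaussianReal 0 (1 / (4 * v))) ∧
    Integrable (fun x => ‖∑ j, phase D x j • q j‖ ^ 2) (gaussianReal 0 (1 / (4 * v))) := by
  set μ := gaussianReal 0 (1 / (4 * v)) with hμ
  have hv' : (v : ℝ) ≠ 0 := by exact_mod_cast hv
  have hshift : ∀ a, shiftOp d a (tmul k (gaussianState v)) =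
      tmul k (translation a (gaussianState v)) := fun a => by
    ext1 i
    exact map_smul (translation a) (k i) (gaussianState v)
  have hexp : ∀ i j (x : ℝ), Complex.exp (((D j - D i : ℝ) : ℂ) * x * Complex.I) =
      starRingEnd ℂ (phase D x i) * phase D x j := fun i j x => by
    rw [phase, phase, ← Complex.exp_conj, ← Complex.exp_add]
    congr 1
    simp
    ring
  have hint : ∀ i j, Integrable (fun x : ℝ => Complex.exp (((D j - D i : ℝ) : ℂ) * x * Complex.I))
      μ := fun i j => by
    refine Integrable.of_bound (C := 1) (Continuous.aestronglyMeasurable (by fun_prop))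
      (Eventually.of_forall fun x => ?_)
    rw [← Complex.ofReal_mul, Complex.norm_exp_ofReal_mul_I]
  have hchar : ∀ i j, ∫ x : ℝ, Complex.exp (((D j - D i : ℝ) : ℂ) * x * Complex.I) ∂μ =
      (Real.exp (-((D i - D j) ^ 2 / (8 * v))) : ℂ) := fun i j => by
    rw [← charFun_apply_real, hμ, charFun_gaussianReal, Complex.ofReal_exp]
    congr 1
    push_cast
    have : (v : ℂ) ≠ 0 := by exact_mod_cast hv
    field_simp
    ring
  have hpt : ∀ x, ((‖∑ j, phase D x j • q j‖ ^ 2 : ℝ) : ℂ) =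
      ∑ i, ∑ j, ⟪q i, q j⟫_ℂ * Complex.exp (((D j - D i : ℝ) : ℂ) * x * Complex.I) := fun x => by
    have h := inner_self_eq_norm_sq_to_K (𝕜 := ℂ) (∑ j, phase D x j • q j)
    simp only [sum_inner, inner_sum, inner_smul_left, inner_smul_right] at h
    rw [Complex.ofReal_pow]
    refine h.symm.trans ?_
    simp only [Finset.mul_sum]
    rw [Finset.sum_comm]
    refine Finset.sum_congr rfl fun i _ => Finset.sum_congr rfl fun j _ => ?_
    rw [hexp]
    ring
  have hintsum : Integrable (fun x : ℝ => ∑ i, ∑ j, ⟪q i, q j⟫_ℂ *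
      Complex.exp (((D j - D i : ℝ) : ℂ) * x * Complex.I)) μ :=
    integrable_finsetSum _ fun i _ => integrable_finsetSum _ fun j _ =>
      (hint i j).const_mul _
  have hintR : Integrable (fun x => ‖∑ j, phase D x j • q j‖ ^ 2) μ := by
    have h := hintsum.re
    refine h.congr (Eventually.of_forall fun x => ?_)
    simp only [← hpt]
    rfl
  refine ⟨?_, hintR⟩
  have h1 : ((‖∑ j, tmul (q j) (shiftOp d (D j) (tmul k (gaussianState v)))‖ ^ 2 : ℝ) : ℂ) =
      ∑ i, ∑ j, ⟪q i, q j⟫_ℂ * (Real.exp (-((D i - D j) ^ 2 / (8 * v))) : ℂ) := by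
    have h := inner_self_eq_norm_sq_to_K (𝕜 := ℂ)
      (∑ j, tmul (q j) (shiftOp d (D j) (tmul k (gaussianState v))))
    simp only [sum_inner, inner_sum, hshift, inner_tmul_tmul,
      inner_translation_gaussianState hv] at h
    rw [inner_self_eq_norm_sq_to_K, hk] at h
    rw [Complex.ofReal_pow]
    simp only [hshift]
    refine h.symm.trans ?_
    rw [Finset.sum_comm]
    refine Finset.sum_congr rfl fun i _ => Finset.sum_congr rfl fun j _ => ?_
    simp
  have h2 : ((∫ x, ‖∑ j, phase D x j • q j‖ ^ 2 ∂μ : ℝ) : ℂ) =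
      ∑ i, ∑ j, ⟪q i, q j⟫_ℂ * (Real.exp (-((D i - D j) ^ 2 / (8 * v))) : ℂ) := by
    rw [← integral_complex_ofReal]
    simp only [hpt]
    rw [integral_finsetSum _ fun i _ => integrable_finsetSum _ fun j _ => (hint i j).const_mul _]
    refine Finset.sum_congr rfl fun i _ => ?_
    rw [integral_finsetSum _ fun j _ => (hint i j).const_mul _]
    refine Finset.sum_congr rfl fun j _ => ?_
    rw [integral_const_mul, hchar]
  exact_mod_cast h1.trans h2.symm

/-- The noise vector is ∑ [P_j, B]s ⊗ T_j(k ⊗ g), with P_j the spectral projections and g the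
Gaussian. Its squared norm is the average of ‖[exp(ixA), B]s‖² ≤ x² ‖[A, B]‖², and x² averages to
1/(4v). -/
theorem norm_sq_noiseOp_device_le (V : unitary (Matrix (Fin d) (Fin d) ℂ)) (D : Fin d → ℝ)
    {A : Matrix (Fin d) (Fin d) ℂ} (hA : A = (V : Matrix (Fin d) (Fin d) ℂ) *
      diagonal (fun k => (D k : ℂ)) * star (V : Matrix (Fin d) (Fin d) ℂ))
    (B : Matrix (Fin d) (Fin d) ℂ) {k s : EuclideanSpace ℂ (Fin d)} (hk : ‖k‖ = 1) (hs : ‖s‖ = 1)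
    {v : ℝ≥0} (hv : v ≠ 0)
    (h : tmul s (tmul k (gaussianState v)) ∈
      (noiseOp (E := Composite d LineSpace) B (meterOp B) (device V D)).domain) :
    ‖noiseOp (E := Composite d LineSpace) B (meterOp B) (device V D) ⟨_, h⟩‖ ^ 2 ≤
      opNorm (A * B - B * A) ^ 2 / (4 * v) := by
  let q : Fin d → EuclideanSpace ℂ (Fin d) := fun j =>
    toEuclideanCLM (𝕜 := ℂ) (columnProj V j * B - B * columnProj V j) s
  have h1 : controlOp V (fun k => shiftOp d (D k)) (leftOp B (tmul s (tmul k (gaussianState v)))) -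
      leftOp B (controlOp V (fun k => shiftOp d (D k)) (tmul s (tmul k (gaussianState v)))) =
      ∑ j, tmul (q j) (shiftOp d (D j) (tmul k (gaussianState v))) := by
    rw [leftOp_tmul, controlOp_tmul, controlOp_tmul, map_sum, ← Finset.sum_sub_distrib]
    refine Finset.sum_congr rfl fun j _ => ?_
    rw [leftOp_tmul, ← sub_tmul, ← toEuclideanCLM_commutator_apply]
  obtain ⟨h2, h3⟩ := norm_sum_tmul_shift_sq hk hv D q
  have hq : ∀ x, ∑ j, phase D x j • q j = toEuclideanCLM (𝕜 := ℂ)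
      ((∑ j, phase D x j • columnProj V j) * B - B * ∑ j, phase D x j • columnProj V j) s :=
    fun x => by
      rw [← toEuclideanCLM_sum_smul_apply, Finset.sum_mul, Finset.mul_sum,
        ← Finset.sum_sub_distrib]
      simp only [Matrix.smul_mul, Matrix.mul_smul, smul_sub]
  have hle : ∀ x, ‖∑ j, phase D x j • q j‖ ^ 2 ≤ opNorm (A * B - B * A) ^ 2 * x ^ 2 := fun x => by
    rw [hq, mul_comm, ← sq_abs x, ← mul_pow]
    refine pow_le_pow_left₀ (norm_nonneg _) ?_ 2
    refine (ContinuousLinearMap.le_opNorm _ _).trans ?_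
    rw [hs, mul_one, hA]
    exact norm_phase_commutator_le V D B x
  have hsq : Integrable (fun x : ℝ => x ^ 2) (gaussianReal 0 (1 / (4 * v))) :=
    (memLp_id_gaussianReal (μ := 0) (v := 1 / (4 * v)) 2).integrable_sq
  have hvar : ∫ x, x ^ 2 ∂(gaussianReal 0 (1 / (4 * v))) = ((1 / (4 * v) : ℝ≥0) : ℝ) := by
    have h1 := variance_fun_id_gaussianReal (μ := 0) (v := 1 / (4 * v))
    rwa [variance_of_integral_eq_zero (X := fun x => x) measurable_id.aemeasurable
      integral_id_gaussianReal] at h1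
  rw [norm_noiseOp_device, h1, h2]
  refine (integral_mono h3 (hsq.const_mul _) hle).trans (le_of_eq ?_)
  rw [integral_const_mul, hvar]
  push_cast
  ring

end DeviceNoise

/-! ### Skew information of pure states. -/

section PureSkewInfo

variable {H : Type} [NormedAddCommGroup H] [InnerProductSpace ℂ H] [CompleteSpace H]

/-- Only pairs containing i₀ matter. With any other index the coefficient is 1/2, whatever f is, and
the two orders add up to ‖As‖² by Parseval. The pair (i₀, i₀) has coefficient 0, and the zero mean
makes its share of Parseval's sum vanish as well. -/
theorem skewInfo_pureState (f : ℝ → ℝ) {A : H →ₗ.[ℂ] H} (hA : IsSelfAdjoint A) {s : H}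
    (hs : ‖s‖ = 1) (hsA : s ∈ A.domain) (h0 : ⟪A ⟨s, hsA⟩, s⟫_ℂ = 0) :
    skewInfo f (pureState s hs) A = ENNReal.ofReal (‖A ⟨s, hsA⟩‖ ^ 2) := by
  classical
  obtain ⟨i₀, h1, hz, c, hc, hcs⟩ := pureState_eigen s hs
  generalize pureState s hs = ρ at i₀ h1 hz hcs ⊢
  have hmem : ρ.eigenbasis i₀ ∈ A.domain := hcs ▸ A.domain.smul_mem c hsA
  set t := A ⟨ρ.eigenbasis i₀, hmem⟩ with ht
  have htc : t = c • A ⟨s, hsA⟩ := by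
    rw [← LinearPMap.map_smul]
    exact congrArg A (Subtype.ext hcs)
  have htn : ‖t‖ = ‖A ⟨s, hsA⟩‖ := by rw [htc, norm_smul, hc, one_mul]
  have ht0 : ⟪t, ρ.eigenbasis i₀⟫_ℂ = 0 := by
    rw [htc, hcs, inner_smul_left, inner_smul_right, h0, mul_zero, mul_zero]
  have hterm : ∀ i j, ENNReal.ofReal (skewWeight f (ρ.eigenvalue i) (ρ.eigenvalue j) *
      ‖matrixElement A (ρ.eigenbasis i) (ρ.eigenbasis j)‖ ^ 2) =
      (if i = i₀ then ENNReal.ofReal (1 / 2) * ENNReal.ofReal (‖⟪ρ.eigenbasis j, t⟫_ℂ‖ ^ 2) else 0) +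
      (if j = i₀ then ENNReal.ofReal (1 / 2) * ENNReal.ofReal (‖⟪ρ.eigenbasis i, t⟫_ℂ‖ ^ 2)
        else 0) := fun i j => by
    by_cases hi : i = i₀ <;> by_cases hj : j = i₀
    · rw [if_pos hi, if_pos hj, hi, hj, h1, norm_inner_symm, ht0]
      simp [skewWeight]
    · rw [if_pos hi, if_neg hj, hi, h1, hz j hj, matrixElement_of_left hmem, norm_inner_symm,
        add_zero, ← ENNReal.ofReal_mul (by norm_num), ← ht]
      simp [skewWeight]
    · rw [if_neg hi, if_pos hj, hj, h1, hz i hi, matrixElement_of_right hA hmem,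
        zero_add, ← ENNReal.ofReal_mul (by norm_num), ← ht]
      simp [skewWeight]
    · rw [if_neg hi, if_neg hj, hz i hi, hz j hj]
      simp [skewWeight]
  have hdom : ∀ i, 0 < ρ.eigenvalue i → ρ.eigenbasis i ∈ A.domain := fun i hi => by
    by_cases h : i = i₀
    · rwa [h]
    · rw [hz i h] at hi
      exact absurd hi (lt_irrefl _)
  rw [skewInfo, if_pos hdom]
  simp only [hterm, ENNReal.tsum_add]
  rw [tsum_eq_single i₀ fun i hi => by simp [hi]]
  simp only [if_true, tsum_ite_eq, ENNReal.tsum_mul_left, tsum_ofReal_normSq_inner]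
  rw [← add_mul, ← ENNReal.ofReal_add (by norm_num) (by norm_num), add_halves,
    ENNReal.ofReal_one, one_mul, htn]

end PureSkewInfo

/-! ### Implementations of prescribed cost and the two bounds on the cost. -/

section Construction

variable {d : ℕ} {A B : Matrix (Fin d) (Fin d) ℂ}
open scoped NNReal

theorem worstError_le_of_pureState {E : Type} [NormedAddCommGroup E] [InnerProductSpace ℂ E]
    [CompleteSpace E] (𝓘 : Implementation A E) {e : E} (he : ‖e‖ = 1)
    (hρ : 𝓘.ρE = pureState e he) {K : ℝ} (hK : 0 ≤ K)
    (hN : ∀ s : EuclideanSpace ℂ (Fin d), ‖s‖ = 1 →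
      ∃ h : tmul s e ∈ (noiseOp B 𝓘.ME 𝓘.U).domain, ‖noiseOp B 𝓘.ME 𝓘.U ⟨_, h⟩‖ ≤ K) :
    𝓘.worstError B ≤ ENNReal.ofReal K := by
  refine iSup_le fun ρS => ?_
  have hsq : 𝓘.sqError B ρS ≤ ENNReal.ofReal (K ^ 2) := by
    obtain ⟨i₀, h1, hz, c, hc, hcs⟩ := pureState_eigen e he
    rw [Implementation.sqError, hρ]
    obtain ⟨hq, hq1, -⟩ := ρS.eigen_spec
    calc _ ≤ ∑' a, ENNReal.ofReal (ρS.eigenvalue a) * ENNReal.ofReal (K ^ 2) := by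
          refine ENNReal.tsum_le_tsum fun a => ?_
          rw [tsum_eq_single i₀ fun i hi => by simp [hz i hi], h1, mul_one]
          refine mul_le_mul_right ?_ _
          have hs : ‖c • ρS.eigenbasis a‖ = 1 := by
            rw [norm_smul, hc, ρS.eigenbasis.orthonormal.1, one_mul]
          obtain ⟨h, hle⟩ := hN _ hs
          have heq : tmul (ρS.eigenbasis a) ((pureState e he).eigenbasis i₀) =
              tmul (c • ρS.eigenbasis a) e := by rw [hcs, tmul_smul, smul_tmul]
          rw [dif_pos (heq ▸ h)]
          simp only [heq]
          exact ENNReal.ofReal_le_ofReal (pow_le_pow_left₀ (norm_nonneg _) hle 2)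
      _ = ENNReal.ofReal (K ^ 2) := by
          rw [ENNReal.tsum_mul_right, ← ENNReal.ofReal_tsum_of_nonneg hq hq1.summable,
            hq1.tsum_eq, ENNReal.ofReal_one, one_mul]
  calc 𝓘.sqError B ρS ^ (1 / 2 : ℝ) ≤ ENNReal.ofReal (K ^ 2) ^ (1 / 2 : ℝ) :=
        ENNReal.rpow_le_rpow hsq (by norm_num)
    _ = ENNReal.ofReal K := by
        rw [ENNReal.ofReal_rpow_of_nonneg (by positivity) (by norm_num), ← Real.sqrt_eq_rpow,
          Real.sqrt_sq hK]

/-- The pointer is the Gaussian of variance ξ², the meter starts in k. Any unit vector k will do,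
because W commutes with B on the meter and the error does not see its initial state. -/
theorem exists_implementation (hA : A.IsHermitian) (hB : Bᴴ = B)
    {k : EuclideanSpace ℂ (Fin d)} (hk : ‖k‖ = 1) {ξ : ℝ} (hξ : 0 < ξ) :
    ∃ 𝓘 : Implementation A (Composite d LineSpace),
      (∀ f : ℝ → ℝ, skewInfo f 𝓘.ρE 𝓘.AE = ENNReal.ofReal (ξ ^ 2)) ∧
      𝓘.worstError B ≤ ENNReal.ofReal (opNorm (A * B - B * A) / (2 * ξ)) := by
  set v : ℝ≥0 := ⟨ξ ^ 2, by positivity⟩ with hvdef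
  have hv : v ≠ 0 := by
    rw [← NNReal.coe_ne_zero]
    exact (pow_pos hξ 2).ne'
  have hvc : (v : ℝ) = ξ ^ 2 := rfl
  have hg := gaussianState_mem_domain hv
  set e : Composite d LineSpace := tmul k (gaussianState v) with hedef
  have he : ‖e‖ = 1 := by rw [hedef, norm_tmul, hk, norm_gaussianState hv, one_mul]
  have hmem : e ∈ (rightOp (d := d) position).domain := tmul_mem_rightOp_domain hg
  have hAV : A = (hA.eigenvectorUnitary : Matrix (Fin d) (Fin d) ℂ) *
      diagonal (fun k => (hA.eigenvalues k : ℂ)) *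
        star (hA.eigenvectorUnitary : Matrix (Fin d) (Fin d) ℂ) := hA.spectral_theorem
  have hcons : CommutesWith ((device hA.eigenvectorUnitary hA.eigenvalues).toLinearEquiv :
      Composite d (Composite d LineSpace) →ₗ[ℂ] _) (totalOp A (rightOp (d := d) position)) := by
    have h := device_conservation hA.eigenvectorUnitary hA.eigenvalues
    rwa [← hAV] at h
  refine ⟨⟨rightOp position, isSelfAdjoint_rightOp isSelfAdjoint_position, meterOp B,
    isSelfAdjoint_meterOp hB, stronglyCommute_meterOp hB position, pureState e he,
    device hA.eigenvectorUnitary hA.eigenvalues, hcons⟩, fun f => ?_, ?_⟩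
  · have h := rightOp_tmul hg hmem
    refine (skewInfo_pureState f (isSelfAdjoint_rightOp isSelfAdjoint_position) he hmem ?_).trans ?_
    · rw [h, inner_tmul_tmul, inner_position_gaussianState hv, mul_zero]
    · rw [h, norm_tmul, hk, one_mul, norm_sq_position_gaussianState hv, hvc]
  · refine worstError_le_of_pureState _ he rfl
      (div_nonneg (opNorm_nonneg _) (by positivity)) fun s hs => ?_
    refine ⟨fun a => mem_meterOp_domain B _, ?_⟩
    refine (pow_le_pow_iff_left₀ (norm_nonneg _)
      (div_nonneg (opNorm_nonneg _) (by positivity)) two_ne_zero).1 ?_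
    refine (norm_sq_noiseOp_device_le _ _ hAV B hk hs hv _).trans (le_of_eq ?_)
    rw [hvc]
    ring

theorem cost_le (hA : A.IsHermitian) (hB : Bᴴ = B) {k : EuclideanSpace ℂ (Fin d)} (hk : ‖k‖ = 1)
    (f : ℝ → ℝ) {ε ξ : ℝ} (hξ : 0 < ξ) (h : opNorm (A * B - B * A) / (2 * ξ) ≤ ε) :
    cost f A B ε ≤ ENNReal.ofReal (ξ ^ 2) := by
  obtain ⟨𝓘, h1, h2⟩ := exists_implementation hA hB hk hξ
  rw [← h1 f]
  exact iInf_le_of_le _ <| iInf_le_of_le _ <| iInf_le_of_le _ <| iInf_le_of_le _ <|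
    iInf_le_of_le 𝓘 <| iInf_le_of_le (h2.trans (ENNReal.ofReal_le_ofReal h)) le_rfl

theorem cost_ne_top (hA : A.IsHermitian) (hB : Bᴴ = B) {k : EuclideanSpace ℂ (Fin d)}
    (hk : ‖k‖ = 1) (f : ℝ → ℝ) {ε : ℝ} (hε : 0 < ε) : cost f A B ε ≠ ⊤ := by
  have hC := opNorm_nonneg (A * B - B * A)
  -- Adding 1 keeps ξ positive when the commutator vanishes.
  have h := cost_le hA hB hk f (ξ := opNorm (A * B - B * A) / (2 * ε) + 1) (ε := ε)
    (by positivity) ?_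
  · exact ne_top_of_le_ne_top ENNReal.ofReal_ne_top h
  · rw [div_le_iff₀ (by positivity)]
    have : ε * (2 * (opNorm (A * B - B * A) / (2 * ε) + 1)) = opNorm (A * B - B * A) + 2 * ε := by
      field_simp
    linarith

theorem sqrt_cost_le (hA : A.IsHermitian) (hB : Bᴴ = B) {k : EuclideanSpace ℂ (Fin d)}
    (hk : ‖k‖ = 1) (f : ℝ → ℝ) {ε : ℝ} (hε : 0 < ε) :
    √(cost f A B ε).toReal ≤ opNorm (A * B - B * A) / (2 * ε) := by
  have hC := opNorm_nonneg (A * B - B * A)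
  refine le_of_forall_pos_le_add fun δ hδ => ?_
  have h := cost_le hA hB hk f (ξ := opNorm (A * B - B * A) / (2 * ε) + δ) (ε := ε)
    (by positivity) ?_
  · refine (Real.sqrt_le_left (by positivity)).2 ?_
    exact ENNReal.toReal_le_of_le_ofReal (by positivity) h
  · rw [div_le_iff₀ (by positivity)]
    have : ε * (2 * (opNorm (A * B - B * A) / (2 * ε) + δ)) =
        opNorm (A * B - B * A) + 2 * ε * δ := by
      field_simp
    nlinarith [mul_pos hε hδ]

theorem le_sqrt_cost (hA : A.PosSemidef) (hB : Bᴴ = B) {k : EuclideanSpace ℂ (Fin d)}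
    (hk : ‖k‖ = 1) {f : ℝ → ℝ} (hf : IsStandardMonotone f) {ε : ℝ} (hε : 0 < ε) :
    √(f 0 / 2) * opNorm (A * B - B * A) / ε - opNorm A / 2 ≤ √(cost f A B ε).toReal := by
  rcases lt_or_ge (√(f 0 / 2) * opNorm (A * B - B * A) / ε - opNorm A / 2) 0 with hL | hL
  · exact hL.le.trans (Real.sqrt_nonneg _)
  · refine Real.le_sqrt_of_sq_le ?_
    rw [← ENNReal.ofReal_le_iff_le_toReal (cost_ne_top hA.1 hB hk f hε)]
    exact le_iInf fun E => le_iInf fun _ => le_iInf fun _ => le_iInf fun _ => le_iInf fun 𝓘 =>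
      le_iInf fun h => ofReal_sq_le_skewInfo hA hB hf 𝓘 hε h hL

end Construction

end WAY

/-! ### The main theorem. -/

theorem mainTheorem1 {d : ℕ} (A B : Matrix (Fin d) (Fin d) ℂ)
    (hA : A.PosSemidef) (hA₀ : ∃ v : Fin d → ℂ, v ≠ 0 ∧ A *ᵥ v = 0) (hB : B.IsHermitian) :
    (∀ f : ℝ → ℝ, WAY.IsStandardMonotone f → ∀ ε : ℝ, 0 < ε →
      WAY.cost f A B ε ≠ ⊤ ∧
      √(f 0 / 2) * WAY.opNorm (A * B - B * A) / ε - WAY.opNorm A / 2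
        ≤ √(WAY.cost f A B ε).toReal ∧
      (ε ≤ WAY.opNorm (A * B - B * A) / (8 * WAY.opNorm A) →
        √(WAY.cost f A B ε).toReal ≤ WAY.opNorm (A * B - B * A) / (2 * ε) + WAY.opNorm A)) ∧
    (∀ f : ℝ → ℝ, WAY.IsStandardMonotone f → f 0 = 1 / 2 → ∀ᶠ ε in 𝓝[>] (0 : ℝ),
      |√(WAY.cost f A B ε).toReal - WAY.opNorm (A * B - B * A) / (2 * ε)| ≤ WAY.opNorm A) ∧
    (∀ ξ : ℝ, 0 < ξ → ∃ (E : Type) (_ : NormedAddCommGroup E) (_ : InnerProductSpace ℂ E)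
      (_ : CompleteSpace E) (𝓘 : WAY.Implementation A E),
      (∀ f : ℝ → ℝ, WAY.IsStandardMonotone f →
        WAY.skewInfo f 𝓘.ρE 𝓘.AE = ENNReal.ofReal (ξ ^ 2)) ∧
      𝓘.worstError B ^ 2 ≤ ENNReal.ofReal
        (WAY.opNorm (A * B - B * A) ^ 2 / (4 * ξ ^ 2) * (1 + WAY.opNorm A ^ 2 / ξ ^ 2) *
          Real.exp (WAY.opNorm A ^ 2 / (2 * ξ ^ 2)))) := by
  -- The kernel vector, normalised, supplies the initial state of the meter.
  obtain ⟨w, hw, -⟩ := hA₀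
  have hw' : (WithLp.toLp 2 w : EuclideanSpace ℂ (Fin d)) ≠ 0 := by simpa using hw
  have hk := norm_smul_inv_norm (𝕜 := ℂ) hw'
  have ha := WAY.opNorm_nonneg A
  have hC := WAY.opNorm_nonneg (A * B - B * A)
  refine ⟨fun f hf ε hε => ⟨WAY.cost_ne_top hA.1 hB hk f hε,
    WAY.le_sqrt_cost hA hB hk hf hε, fun _ => ?_⟩, fun f hf hf0 => ?_, fun ξ hξ => ?_⟩
  -- The device already achieves ‖[A, B]‖/(2ε), so the summand ‖A‖ is slack.
  · exact (WAY.sqrt_cost_le hA.1 hB hk f hε).trans (le_add_of_nonneg_right ha)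
  · filter_upwards [self_mem_nhdsWithin] with ε hε
    have h1 := WAY.sqrt_cost_le hA.1 hB hk f hε
    have h2 := WAY.le_sqrt_cost hA hB hk hf hε
    -- At f(0) = 1/2 the leading terms of the two bounds coincide, which leaves a gap of at most
    -- ‖A‖/2.
    have h3 : √(f 0 / 2) = 1 / 2 := by
      rw [hf0, show (1 / 2 / 2 : ℝ) = (1 / 2) ^ 2 by norm_num, Real.sqrt_sq (by norm_num)]
    rw [h3, show 1 / 2 * WAY.opNorm (A * B - B * A) / ε =
      WAY.opNorm (A * B - B * A) / (2 * ε) by ring] at h2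
    rw [abs_le]
    constructor <;> linarith
  · obtain ⟨𝓘, h1, h2⟩ := WAY.exists_implementation hA.1 hB hk hξ
    refine ⟨_, _, _, inferInstance, 𝓘, fun f _ => h1 f, ?_⟩
    refine (pow_le_pow_left₀ zero_le h2 2).trans ?_
    rw [← ENNReal.ofReal_pow (div_nonneg hC (by positivity))]
    refine ENNReal.ofReal_le_ofReal ?_
    rw [div_pow, mul_assoc, show (2 * ξ) ^ 2 = 4 * ξ ^ 2 by ring]
    -- The device has squared error at most ‖[A, B]‖²/(4ξ²); the two further factors are at least 1.
    refine le_mul_of_one_le_right (by positivity) (one_le_mul_of_one_le_of_one_le ?_ ?_)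
    · exact le_add_of_nonneg_right (by positivity)
    · exact Real.one_le_exp (by positivity)
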